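/- Conventions. Locally convex spaces are Hausdorff; a complex locally convex space is also regarded as a real one. Let $E,F$ be locally convex spaces and let $U\subseteq E$ have dense interior. A map $f:U\to F$ is $C^1$ if it is continuous, the directional derivatives $df(x).v=\lim_{h\to0}\frac1h(f(x+hv)-f(x))$ ($h$ real) exist for $x\in\operatorname{int}(U)$, $v\in E$, and $(x,v)\mapsto df(x).v$ extends to a continuous map $df:U\times E\to F$. It is $C^{n+1}$ if it is $C^1$ and $df$ is $C^n$, and smooth if it is $C^n$ for all $n$; put $d^0f=f$ and $d^{n+1}f=d^n(df)$. If $E,F$ are complex, a smooth $f$ is holomorphic if $df(x)$ is $\mathbb C$-linear for all $x\in\operatorname{int}(U)$. A smooth manifold with corners modelled on $E$ is a Hausdorff space $M$ with a maximal atlas of homeomorphisms from open subsets of $M$ onto relatively open subsets of $E^+=\bigcap_{k=1}^n\lambda_k^{-1}([0,\infty))$, where $\lambda_1,\dots,\lambda_n$ are continuous real-linear functionals such that $E^+$ has non-empty (hence dense) interior, with smooth coordinate changes; it is a complex manifold with corners if $E$ is complex and the coordinate changes are holomorphic (the atlas then being maximal among such). For $E^+=E$ one gets manifolds without boundary. A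 Lie group (respectively complex Lie group) $K$ is a group with the structure of a smooth (respectively complex) manifold without boundary modelled on a locally convex (respectively complex locally convex) space such that the group operations are smooth (respectively holomorphic). The underlying locally convex space of its Lie algebra $\mathfrak k$ is identified with the modelling space of $K$. $C^\infty(M,K)$ (respectively $C^\infty_{\mathbb C}(M,K)$) is the set of continuous maps $M\to K$ that are smooth (respectively holomorphic) in all charts of $M$ and $K$; similarly for maps into a locally convex space. $C^\infty(M,\mathfrak k)$ carries the coarsest topology for which all the maps $f\mapsto d^n(f\circ\psi^{-1})\in C(\psi(U)\times E^{2^n-1},\mathfrak k)$ ($\psi:U\to E$ a chart of $M$, $n\ge0$) are continuous with respect to the compact-open topology, and $C^\infty_{\mathbb C}(M,\mathfrak k)$ the induced topology. Theorem. Let $M$ be a compact manifold with corners, let $K$ be a Lie group, and let $\varphi:W\to\varphi(W)\subseteq\mathfrak k$ be a chart of $K$ with $e\in W$ and $\varphi(e)=0$. (a) If $M$ and $K$ are smooth, then $C^\infty(M,\mathfrak k)$ is a locally convex space, $C^\infty(M,K)$ is a group under pointwise operations, and there is a unique smooth manifold structure (topology and maximal atlas) on $C^\infty(M,K)$, modelled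 on $C^\infty(M,\mathfrak k)$, which turns it into a Lie group and for which $$\varphi_*:\{\gamma\in C^\infty(M,K):\gamma(M)\subseteq W\}\to\{\xi\in C^\infty(M,\mathfrak k):\xi(M)\subseteq\varphi(W)\},\qquad \gamma\mapsto\varphi\circ\gamma,$$ is a bijection and a chart. (b) If $M$ is smooth and $K$ is complex, then $C^\infty(M,\mathfrak k)$ is a complex locally convex space, $C^\infty(M,K)$ is a group under pointwise operations, and there is a unique complex manifold structure on $C^\infty(M,K)$, modelled on $C^\infty(M,\mathfrak k)$, which turns it into a complex Lie group and for which $\varphi_*$ as in (a) is a bijection and a chart. (c) If $M$ and $K$ are complex, then $C^\infty_{\mathbb C}(M,\mathfrak k)$ is a complex locally convex space, $C^\infty_{\mathbb C}(M,K)$ is a group under pointwise operations, and there is a unique complex manifold structure on $C^\infty_{\mathbb C}(M,K)$, modelled on $C^\infty_{\mathbb C}(M,\mathfrak k)$, which turns it into a complex Lie group and for which the restriction of $\varphi_*$ to $\{\gamma\in C^\infty_{\mathbb C}(M,K):\gamma(M)\subseteq W\}\to\{\xi\in C^\infty_{\mathbb C}(M,\mathfrak k):\xi(M)\subseteq\varphi(W)\}$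 is a bijection and a chart. -/

import Mathlib

open Set Filter Topology

universe u v w x

namespace MappingGroup

section Calculus

/-- `df : E × E → F` is the differential of `f` on `U`: at interior points `df (x, v)` is the
directional derivative of `f` at `x` along `v` (with real increments), and `df` is continuous
on `U × E`. If `U` has dense interior and `F` is Hausdorff, `df` is unique on `U × E`. -/
structure HasDifferentialOn {E : Type u} {F : Type v}
    [AddCommGroup E] [Module ℝ E] [TopologicalSpace E]
    [AddCommGroup F] [Module ℝ F] [TopologicalSpace F]
    (f : E → F) (df : E × E → F) (U : Set E) : Prop where
  tendsto : ∀ x ∈ interior U, ∀ v : E,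
    Tendsto (fun h : ℝ => h⁻¹ • (f (x + h • v) - f x)) (𝓝[≠] 0) (𝓝 (df (x, v)))
  continuousOn : ContinuousOn df (U ×ˢ univ)

/-- `f` is of class `C^n` on the set `U` (with dense interior): for `n = 0` it is continuous; for
`n + 1` it is continuous, its differential on the interior of `U` exists and extends
continuously to `U × E`, and this extension is of class `C^n` on `U × E`. -/
def IsCn {F : Type v} [AddCommGroup F] [Module ℝ F] [TopologicalSpace F] :
    ℕ → ∀ {E : Type u} [AddCommGroup E] [Module ℝ E] [TopologicalSpace E],
      (E → F) → Set E → Prop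
  | 0, _, _, _, _, f, U => ContinuousOn f U
  | n + 1, E, _, _, _, f, U => ContinuousOn f U ∧
      ∃ df : E × E → F, HasDifferentialOn f df U ∧ IsCn n df (U ×ˢ univ)

/-- `f` is smooth on `U` and, at interior points, its differential is `𝕜`-linear.
For `𝕜 = ℝ` this is smoothness (real linearity of the differential of a `C^1` map between
locally convex spaces is automatic); for `𝕜 = ℂ` it is holomorphy. -/
def IsSmoothOn (𝕜 : Type*) [Semiring 𝕜] {E : Type u} {F : Type v}
    [AddCommGroup E] [Module ℝ E] [Module 𝕜 E] [TopologicalSpace E]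
    [AddCommGroup F] [Module ℝ F] [Module 𝕜 F] [TopologicalSpace F]
    (f : E → F) (U : Set E) : Prop :=
  (∀ n : ℕ, IsCn n f U) ∧
    ∃ df : E × E → F, HasDifferentialOn f df U ∧
      ∀ x ∈ interior U, IsLinearMap 𝕜 (fun v => df (x, v))

open Classical in
/-- The differential of `f` on `U` (zero if there is none). -/
noncomputable def differential {E : Type u} {F : Type v}
    [AddCommGroup E] [Module ℝ E] [TopologicalSpace E]
    [AddCommGroup F] [Module ℝ F] [TopologicalSpace F]
    (f : E → F) (U : Set E) : E × E → F :=
  if h : ∃ df : E × E → F, HasDifferentialOn f df U then h.choose else 0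

/-- For a family `g i : U → F` of maps, the coarsest topology on the index set `I` for which
`i ↦ d^n (g i)` is continuous into `C(U × E^(2^n - 1), F)` with the compact-open topology. Here
`d^0 g = g` and `d^(n+1) g = d^n (dg)`. -/
@[reducible] noncomputable def derivTopology {I : Type w} {F : Type v}
    [AddCommGroup F] [Module ℝ F] [TopologicalSpace F] :
    ℕ → ∀ {E : Type u} [AddCommGroup E] [Module ℝ E] [TopologicalSpace E],
      (I → E → F) → Set E → TopologicalSpace I
  | 0, _, _, _, _, g, U => TopologicalSpace.generateFrom
      {S | ∃ K ⊆ U, IsCompact K ∧ ∃ O : Set F, IsOpen O ∧ S = {i | MapsTo (g i) K O}}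
  | n + 1, _, _, _, _, g, U => derivTopology n (fun i => differential (g i) U) (U ×ˢ univ)

variable {E : Type u} {F : Type v}
  [AddCommGroup E] [Module ℝ E] [TopologicalSpace E]
  [AddCommGroup F] [Module ℝ F] [TopologicalSpace F]

theorem HasDifferentialOn.add [IsTopologicalAddGroup F] {f g : E → F} {df dg : E × E → F}
    {U : Set E} (hf : HasDifferentialOn f df U) (hg : HasDifferentialOn g dg U) :
    HasDifferentialOn (f + g) (df + dg) U where
  tendsto x hx v := by
    refine ((hf.tendsto x hx v).add (hg.tendsto x hx v)).congr fun h => ?_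
    rw [← smul_add]
    congr 1
    simp only [Pi.add_apply]
    abel
  continuousOn := hf.continuousOn.add hg.continuousOn

theorem HasDifferentialOn.const_smul {R : Type*} [Semiring R] [Module R F]
    [SMulCommClass ℝ R F] [ContinuousConstSMul R F] (c : R) {f : E → F} {df : E × E → F}
    {U : Set E} (hf : HasDifferentialOn f df U) :
    HasDifferentialOn (c • f) (c • df) U where
  tendsto x hx v := by
    refine ((hf.tendsto x hx v).const_smul c).congr fun h => ?_
    simp only [Pi.smul_apply]
    rw [← smul_sub, smul_comm h⁻¹ c]
  continuousOn := hf.continuousOn.const_smul c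

theorem HasDifferentialOn.zero (U : Set E) :
    HasDifferentialOn (0 : E → F) (0 : E × E → F) U where
  tendsto x hx v := by simpa using tendsto_const_nhds
  continuousOn := continuousOn_const

theorem IsCn.add [IsTopologicalAddGroup F] (n : ℕ) {E : Type u} [AddCommGroup E] [Module ℝ E]
    [TopologicalSpace E] {f g : E → F} {U : Set E} (hf : IsCn n f U) (hg : IsCn n g U) :
    IsCn n (f + g) U := by
  induction n generalizing E with
  | zero => exact ContinuousOn.add hf hg
  | succ n ih =>
    obtain ⟨hf0, df, hdf, hf1⟩ := hf
    obtain ⟨hg0, dg, hdg, hg1⟩ := hg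
    exact ⟨hf0.add hg0, df + dg, hdf.add hdg, ih hf1 hg1⟩

theorem IsCn.const_smul {R : Type*} [Semiring R] [Module R F]
    [SMulCommClass ℝ R F] [ContinuousConstSMul R F] (c : R) (n : ℕ) {E : Type u}
    [AddCommGroup E] [Module ℝ E] [TopologicalSpace E] {f : E → F} {U : Set E}
    (hf : IsCn n f U) : IsCn n (c • f) U := by
  induction n generalizing E with
  | zero => exact ContinuousOn.const_smul hf c
  | succ n ih =>
    obtain ⟨hf0, df, hdf, hf1⟩ := hf
    exact ⟨hf0.const_smul c, c • df, hdf.const_smul c, ih hf1⟩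

theorem IsCn.zero (n : ℕ) {E : Type u} [AddCommGroup E] [Module ℝ E] [TopologicalSpace E]
    (U : Set E) : IsCn n (0 : E → F) U := by
  induction n generalizing E with
  | zero => exact continuousOn_const
  | succ n ih => exact ⟨continuousOn_const, 0, HasDifferentialOn.zero U, ih _⟩

end Calculus

section Manifolds

/-- The closed cone `E^+` cut out by finitely many continuous real functionals. -/
def posCone {E : Type u} [AddCommGroup E] [Module ℝ E] [TopologicalSpace E] {n : ℕ}
    (lam : Fin n → (E →L[ℝ] ℝ)) : Set E :=
  {x | ∀ i, 0 ≤ lam i x}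

/-- A homeomorphism from an open subset of `X` onto a relatively open subset of `H ⊆ E`. -/
structure IsChart {X : Type w} {E : Type u} [TopologicalSpace E] (tX : TopologicalSpace X)
    (H : Set E) (φ : PartialEquiv X E) : Prop where
  isOpen_source : IsOpen[tX] φ.source
  target_eq : ∃ O : Set E, IsOpen O ∧ φ.target = O ∩ H
  continuousOn : ContinuousOn φ φ.source
  continuousOn_symm : ContinuousOn φ.symm φ.target

/-- Smoothness (`𝕜 = ℝ`) or holomorphy (`𝕜 = ℂ`) of the coordinate change from `φ` to `ψ`. -/
def SmoothChange (𝕜 : Type*) [Semiring 𝕜] {X : Type w} {E : Type u}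
    [AddCommGroup E] [Module ℝ E] [Module 𝕜 E] [TopologicalSpace E]
    (φ ψ : PartialEquiv X E) : Prop :=
  IsSmoothOn 𝕜 (fun x => ψ (φ.symm x)) {x | x ∈ φ.target ∧ φ.symm x ∈ ψ.source}

/-- A smooth (`𝕜 = ℝ`) or complex (`𝕜 = ℂ`) manifold structure on the set `X`, with charts onto
relatively open subsets of `H ⊆ E`: a Hausdorff topology and a maximal atlas.
With `H = posCone lam` it is a manifold with corners, with `H = univ` one without boundary. -/
structure ManifoldStructure (𝕜 : Type*) [Semiring 𝕜] (X : Type w) (E : Type u)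
    [AddCommGroup E] [Module ℝ E] [Module 𝕜 E] [TopologicalSpace E] (H : Set E) where
  top : TopologicalSpace X
  t2 : @T2Space X top
  atlas : Set (PartialEquiv X E)
  isChart : ∀ φ ∈ atlas, IsChart top H φ
  cover : ∀ x : X, ∃ φ ∈ atlas, x ∈ φ.source
  compatible : ∀ φ ∈ atlas, ∀ ψ ∈ atlas, SmoothChange 𝕜 φ ψ
  maximal : ∀ ρ : PartialEquiv X E, IsChart top H ρ →
    (∀ φ ∈ atlas, SmoothChange 𝕜 φ ρ ∧ SmoothChange 𝕜 ρ φ) → ρ ∈ atlas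

/-- `f` is a smooth (`𝕜 = ℝ`) or holomorphic (`𝕜 = ℂ`) map with respect to the atlases `A` and
`B`, where `B` is an atlas of a manifold without boundary (so that interior points of the
source are automatically mapped to interior points). -/
structure IsSmoothMap (𝕜 : Type*) [Semiring 𝕜] {X : Type w} {Y : Type x} {E : Type u}
    {F : Type v} [AddCommGroup E] [Module ℝ E] [Module 𝕜 E] [TopologicalSpace E]
    [AddCommGroup F] [Module ℝ F] [Module 𝕜 F] [TopologicalSpace F]
    (tX : TopologicalSpace X) (A : Set (PartialEquiv X E))
    (tY : TopologicalSpace Y) (B : Set (PartialEquiv Y F)) (f : X → Y) : Prop where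
  continuous : Continuous[tX, tY] f
  smooth : ∀ φ ∈ A, ∀ ψ ∈ B, IsSmoothOn 𝕜 (fun x => ψ (f (φ.symm x)))
    {x | x ∈ φ.target ∧ f (φ.symm x) ∈ ψ.source}

/-- A Lie group structure (smooth for `𝕜 = ℝ`, complex for `𝕜 = ℂ`) on the group `G`, modelled
on `F`. The manifold structure of `G × G` is given by the products of charts. -/
structure LieGroupStructure (𝕜 : Type*) [Semiring 𝕜] (G : Type w) [Group G] (F : Type u)
    [AddCommGroup F] [Module ℝ F] [Module 𝕜 F] [TopologicalSpace F]
    extends ManifoldStructure 𝕜 G F (univ : Set F) where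
  smooth_mul : IsSmoothMap 𝕜 (@instTopologicalSpaceProd G G top top)
    (Set.image2 (fun φ ψ => φ.prod ψ) atlas atlas) top atlas (fun p : G × G => p.1 * p.2)
  smooth_inv : IsSmoothMap 𝕜 top atlas top atlas (fun g : G => g⁻¹)

end Manifolds

section FunctionSpaces

variable (𝕜 : Type*) [Semiring 𝕜] {M : Type w} {E : Type u}
  [AddCommGroup E] [Module ℝ E] [Module 𝕜 E] [TopologicalSpace E]
  (A : Set (PartialEquiv M E)) (F : Type v)
  [AddCommGroup F] [Module ℝ F] [Module 𝕜 F] [TopologicalSpace F]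

/-- The space `C^∞(M, F)` (for `𝕜 = ℝ`), respectively `C^∞_ℂ(M, F)` (for `𝕜 = ℂ`), of smooth,
respectively holomorphic, maps from a manifold with atlas `A` to a locally convex space `F`. -/
def SmoothFun : Type (max w v) :=
  {f : M → F // ∀ φ ∈ A, IsSmoothOn 𝕜 (fun x => f (φ.symm x)) φ.target}

/-- The topology of compact convergence of all differentials: the coarsest one for which,
for all charts `φ : U → E` of `M` and all `n`, the map
`f ↦ d^n (f ∘ φ⁻¹) ∈ C(φ(U) × E^(2^n - 1), F)` is continuous with respect to the compact-open
topology. As the sets `φ(U) × E^(2^n - 1)` are the charts of the iterated tangent bundle `T^n M`,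
this is the topology induced by `f ↦ (d^n f)_n ∈ ∏ₙ C(T^n M, F)`. -/
noncomputable instance : TopologicalSpace (SmoothFun 𝕜 A F) :=
  ⨅ φ ∈ A, ⨅ n : ℕ, derivTopology n
    (fun (f : SmoothFun 𝕜 A F) (x : E) => f.1 (φ.symm x)) φ.target

variable {F} in
theorem IsSmoothOn.add [IsTopologicalAddGroup F] {f g : E → F} {U : Set E}
    (hf : IsSmoothOn 𝕜 f U) (hg : IsSmoothOn 𝕜 g U) : IsSmoothOn 𝕜 (f + g) U := by
  obtain ⟨hf0, df, hdf, hf1⟩ := hf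
  obtain ⟨hg0, dg, hdg, hg1⟩ := hg
  refine ⟨fun n => (hf0 n).add n (hg0 n), df + dg, hdf.add hdg, fun x hx => ?_⟩
  constructor
  · intro a b
    simp only [Pi.add_apply, (hf1 x hx).map_add, (hg1 x hx).map_add]
    abel
  · intro c a
    simp only [Pi.add_apply, (hf1 x hx).map_smul, (hg1 x hx).map_smul, smul_add]

variable {F} in
theorem IsSmoothOn.const_smul {R : Type*} [Semiring R] [Module R F]
    [SMulCommClass ℝ R F] [SMulCommClass 𝕜 R F] [ContinuousConstSMul R F] (c : R)
    {f : E → F} {U : Set E} (hf : IsSmoothOn 𝕜 f U) : IsSmoothOn 𝕜 (c • f) U := by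
  obtain ⟨hf0, df, hdf, hf1⟩ := hf
  refine ⟨fun n => (hf0 n).const_smul c n, c • df, hdf.const_smul c, fun x hx => ?_⟩
  constructor
  · intro a b
    simp only [Pi.smul_apply, (hf1 x hx).map_add, smul_add]
  · intro r a
    simp only [Pi.smul_apply, (hf1 x hx).map_smul]
    rw [smul_comm r c]

theorem IsSmoothOn.zero (U : Set E) : IsSmoothOn 𝕜 (0 : E → F) U :=
  ⟨fun n => IsCn.zero n U, 0, HasDifferentialOn.zero U, fun _ _ => (0 : E →ₗ[𝕜] F).isLinear⟩

variable [IsTopologicalAddGroup F]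

theorem IsSmoothOn.neg {f : E → F} {U : Set E} (hf : IsSmoothOn 𝕜 f U) :
    IsSmoothOn 𝕜 (-f) U := by
  have h := IsSmoothOn.const_smul 𝕜 (-1 : ℤ) hf
  simpa using h

/-- The smooth (holomorphic) functions as an additive subgroup of all functions. -/
def smoothFunAddSubgroup : AddSubgroup (M → F) where
  carrier := {f | ∀ φ ∈ A, IsSmoothOn 𝕜 (fun x => f (φ.symm x)) φ.target}
  add_mem' hf hg φ hφ := (hf φ hφ).add 𝕜 (hg φ hφ)
  zero_mem' φ _ := IsSmoothOn.zero 𝕜 F φ.target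
  neg_mem' hf φ hφ := (hf φ hφ).neg 𝕜

/-- Pointwise addition. -/
noncomputable instance : AddCommGroup (SmoothFun 𝕜 A F) :=
  inferInstanceAs (AddCommGroup (smoothFunAddSubgroup 𝕜 A F))

/-- Pointwise scalar multiplication, by real or by complex scalars. -/
noncomputable instance {R : Type*} [Semiring R] [Module R F]
    [SMulCommClass ℝ R F] [SMulCommClass 𝕜 R F] [ContinuousConstSMul R F] :
    Module R (SmoothFun 𝕜 A F) where
  smul c f := ⟨c • f.1, fun φ hφ => (f.2 φ hφ).const_smul 𝕜 c⟩
  one_smul f := Subtype.ext (one_smul R f.1)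
  mul_smul a b f := Subtype.ext (mul_smul a b f.1)
  smul_zero a := Subtype.ext (smul_zero (A := M → F) a)
  smul_add a f g := Subtype.ext (smul_add a f.1 g.1)
  add_smul a b f := Subtype.ext (add_smul a b f.1)
  zero_smul f := Subtype.ext (zero_smul R f.1)

end FunctionSpaces

/-- `F` is a Hausdorff locally convex topological vector space over `𝕜 ∈ {ℝ, ℂ}`. -/
structure IsLocallyConvexTVS (𝕜 : Type*) [Semiring 𝕜] [TopologicalSpace 𝕜] (F : Type v)
    [AddCommGroup F] [Module ℝ F] [Module 𝕜 F] [TopologicalSpace F] : Prop where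
  isTopologicalAddGroup : IsTopologicalAddGroup F
  continuousSMul : ContinuousSMul 𝕜 F
  locallyConvexSpace : LocallyConvexSpace ℝ F
  t2Space : T2Space F

/-- `Φ` is the push-forward `γ ↦ φ ∘ γ` of the chart `φ : W → φ(W)`, defined on the set of all
elements of `G` (a group of maps `M → K`) with values in `W`, with image the set of all elements
of the function space with values in `φ(W)`. -/
structure IsPushForward (𝕜 : Type*) [Semiring 𝕜] {M : Type w} {E : Type u}
    [AddCommGroup E] [Module ℝ E] [Module 𝕜 E] [TopologicalSpace E]
    {A : Set (PartialEquiv M E)} {F : Type v}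
    [AddCommGroup F] [Module ℝ F] [Module 𝕜 F] [TopologicalSpace F]
    {K : Type x} [Group K] (φ : PartialEquiv K F) {G : Subgroup (M → K)}
    (Φ : PartialEquiv G (SmoothFun 𝕜 A F)) : Prop where
  source_eq : Φ.source = {γ : G | ∀ m, γ.1 m ∈ φ.source}
  target_eq : Φ.target = {ξ : SmoothFun 𝕜 A F | ∀ m, ξ.1 m ∈ φ.target}
  apply_eq : ∀ γ ∈ Φ.source, ∀ m, (Φ γ).1 m = φ (γ.1 m)

end MappingGroup

-- A chart of the mapping group around `a` is `γ ↦ φ ∘ (a⁻¹ γ)` (`LieGroupStructure.leftChart`). In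
-- such charts the coordinate changes, the multiplication and the inversion all have the form `ξ ↦
-- (m ↦ f m (ξ m))`, where `f` is built from `φ` and the operations of `K`. So one analytic fact
-- carries the theorem, `SmoothFamily.isSmoothOn_push`: if `f` is jointly smooth on an open `Ω ⊆ M ×
-- F`, this push-forward is smooth on the set of `ξ` with graph in `Ω`. That set is open because `M`
-- is compact.
--
-- The push-forward is continuous because, by the chain rule, the iterated differentials of `f (·,
-- ξ)` depend continuously on those of `ξ` (`TendstoCn.comp_left`). Its differential is the
-- push-forward of the family of partial differentials of `f`, which is again a smooth family
-- (`SmoothFamily.differential`), so induction on the order gives every `C^n`. The difference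
-- quotients must converge together with all their differentials. For this, `tendstoCn_slope` shows
-- that a pointwise differentiable curve of maps, whose velocity is continuous for
-- `C^n`-convergence, is differentiable for `C^n`-convergence. It rests on exchanging the parameter
-- derivative with `d` (`hasSlope_differential`) and on a mean value theorem in locally convex
-- spaces, where estimates take the form of membership in closed convex sets.
--
-- At boundary points differentials are defined by continuous extension, so identities are proved at
-- interior points and carried over by a limit. Convergence is known on compact sets only. Hence the
-- limit is taken along a segment running into the interior; `Accessible` provides it, and convexity
-- of `posCone` provides `Accessible`.
--
-- Two scalar semirings treat the three cases at once: `𝕜` governs the maps on `M`, and `𝕝` the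
-- structure of `K` and of the mapping group. Stability of holomorphy under `d` uses the symmetry of
-- second derivatives.
--
-- For uniqueness, left translations are diffeomorphisms of any Lie group. A competing structure
-- containing the pushed-forward chart therefore contains all left charts; these cover the group,
-- and a covering family of charts determines both the topology and the maximal atlas.

universe y

set_option linter.unusedSectionVars false

namespace MappingGroup

/-! ### Curves in locally convex spaces and the mean value theorem. -/

section Curves

variable {F : Type v} [AddCommGroup F] [Module ℝ F] [TopologicalSpace F]

/-- The curve `α` has velocity `a` at the time `s`. -/
def HasSlope (α : ℝ → F) (a : F) (s : ℝ) : Prop :=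
  Tendsto (fun h : ℝ => h⁻¹ • (α (s + h) - α s)) (𝓝[≠] 0) (𝓝 a)

theorem HasSlope.comp_continuousLinearMap {α : ℝ → F} {a : F} {s : ℝ} (h : HasSlope α a s)
    (f : F →L[ℝ] ℝ) : HasDerivAt (fun t => f (α t)) (f a) s := by
  rw [hasDerivAt_iff_tendsto_slope_zero]
  refine ((f.continuous.tendsto a).comp h).congr fun t => ?_
  simp

theorem HasSlope.sub [IsTopologicalAddGroup F] {α β : ℝ → F} {a b : F} {s : ℝ}
    (hα : HasSlope α a s) (hβ : HasSlope β b s) : HasSlope (fun t => α t - β t) (a - b) s := by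
  refine (Tendsto.sub hα hβ).congr fun h => ?_
  rw [← smul_sub]
  congr 1
  exact sub_sub_sub_comm _ _ _ _

theorem HasSlope.const_smul [ContinuousConstSMul ℝ F] {α : ℝ → F} {a : F} {s : ℝ}
    (hα : HasSlope α a s) (c : ℝ) : HasSlope (fun t => c • α t) (c • a) s := by
  refine (Tendsto.const_smul hα c).congr fun h => ?_
  rw [← smul_sub, smul_comm]

/-- The mean value theorem needs a whole segment of times for one fixed index; this extracts a
radius that serves all late indices. -/
theorem exists_nhds_ball_of_eventually {ι : Type*} {l : Filter ι} {s₀ : ℝ} {p : ι × ℝ → Prop}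
    (h : ∀ᶠ z in l ×ˢ 𝓝 s₀, p z) :
    ∃ δ > 0, ∀ᶠ i in l, ∀ s ∈ Metric.ball s₀ δ, p (i, s) := by
  obtain ⟨pa, ha, pb, hb, hab⟩ := eventually_prod_iff.1 h
  obtain ⟨δ, hδ, hball⟩ := Metric.eventually_nhds_iff_ball.1 hb
  exact ⟨δ, hδ, ha.mono fun i hi s hs => hab hi (hball s hs)⟩

theorem uIcc_subset_ball {s₀ δ h : ℝ} (hh : |h| < δ) : uIcc s₀ (s₀ + h) ⊆ Metric.ball s₀ δ := by
  have h0 : s₀ ∈ Metric.ball s₀ δ := Metric.mem_ball_self ((abs_nonneg h).trans_lt hh)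
  have h1 : s₀ + h ∈ Metric.ball s₀ δ := by simpa [Metric.mem_ball, Real.dist_eq] using hh
  rw [← segment_eq_uIcc]
  exact (convex_ball s₀ δ).segment_subset h0 h1

variable [IsTopologicalAddGroup F] [ContinuousSMul ℝ F] [LocallyConvexSpace ℝ F]

theorem exists_isClosed_convex_nhds {y : F} {s : Set F} (hs : s ∈ 𝓝 y) :
    ∃ C ∈ 𝓝 y, IsClosed C ∧ Convex ℝ C ∧ C ⊆ s := by
  obtain ⟨t, ht, htc, hts⟩ := exists_mem_nhds_isClosed_subset hs
  obtain ⟨c, ⟨hc, hcc⟩, hct⟩ := (LocallyConvexSpace.convex_basis (𝕜 := ℝ) y).mem_iff.1 ht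
  exact ⟨closure c, mem_of_superset hc subset_closure, isClosed_closure, hcc.closure,
    (closure_minimal hct htc).trans hts⟩

/-- Closed convex sets are those for which the mean value theorem passes from velocities to
difference quotients, so limits are tested on them instead of with seminorms. -/
theorem tendsto_of_forall_isClosed_convex {ι : Type*} {l : Filter ι} {f : ι → F} {y : F}
    (h : ∀ C ∈ 𝓝 y, IsClosed C → Convex ℝ C → ∀ᶠ i in l, f i ∈ C) : Tendsto f l (𝓝 y) := by
  intro s hs
  obtain ⟨C, hC, h1, h2, h3⟩ := exists_isClosed_convex_nhds hs
  exact (h C hC h1 h2).mono fun i hi => h3 hi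

/-- The mean value theorem. -/
theorem slope_mem_of_forall_mem {α α' : ℝ → F} {a h : ℝ} (hh : h ≠ 0) {C : Set F}
    (hC : Convex ℝ C) (hC' : IsClosed C) (hα : ∀ s ∈ uIcc a (a + h), HasSlope α (α' s) s)
    (hm : ∀ s ∈ uIcc a (a + h), α' s ∈ C) : h⁻¹ • (α (a + h) - α a) ∈ C := by
  by_contra hn
  -- A continuous functional separates the quotient strictly from `C`; the scalar mean value theorem
  -- for `f ∘ α` then produces a velocity on the wrong side.
  obtain ⟨f, u, hf1, hf2⟩ := geometric_hahn_banach_closed_point hC hC' hn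
  have hd : ∀ s ∈ uIcc a (a + h), HasDerivAt (fun t => f (α t)) (f (α' s)) s :=
    fun s hs => (hα s hs).comp_continuousLinearMap f
  have key : ∃ c ∈ uIcc a (a + h), f (α' c) = h⁻¹ * (f (α (a + h)) - f (α a)) := by
    rcases lt_or_gt_of_ne hh with h0 | h0
    · have hlt : a + h < a := by linarith
      rw [uIcc_of_ge hlt.le] at hd ⊢
      obtain ⟨c, hc, hc'⟩ := exists_hasDerivAt_eq_slope (fun t => f (α t)) (fun s => f (α' s)) hlt
        (fun s hs => (hd s hs).continuousAt.continuousWithinAt)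
        (fun s hs => hd s (Ioo_subset_Icc_self hs))
      refine ⟨c, Ioo_subset_Icc_self hc, hc'.trans ?_⟩
      have : a - (a + h) = -h := by ring
      rw [this]
      field_simp
      ring
    · have hlt : a < a + h := by linarith
      rw [uIcc_of_le hlt.le] at hd ⊢
      obtain ⟨c, hc, hc'⟩ := exists_hasDerivAt_eq_slope (fun t => f (α t)) (fun s => f (α' s)) hlt
        (fun s hs => (hd s hs).continuousAt.continuousWithinAt)
        (fun s hs => hd s (Ioo_subset_Icc_self hs))
      refine ⟨c, Ioo_subset_Icc_self hc, hc'.trans ?_⟩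
      rw [add_sub_cancel_left]
      field_simp
  obtain ⟨c, hc, hc'⟩ := key
  have h1 := hf1 _ (hm c hc)
  rw [hc'] at h1
  rw [map_smul, map_sub, smul_eq_mul] at hf2
  linarith

/-- Limits of curves whose velocities converge (continuously) are differentiable. -/
theorem hasSlope_of_tendsto {ι : Type*} {l : Filter ι} [l.NeBot] {a b : ι → ℝ → F} {a₀ : ℝ → F}
    {b₀ : F} {s₀ : ℝ} (hd : ∀ᶠ p in l ×ˢ 𝓝 s₀, HasSlope (a p.1) (b p.1 p.2) p.2)
    (hb : Tendsto (fun p : ι × ℝ => b p.1 p.2) (l ×ˢ 𝓝 s₀) (𝓝 b₀))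
    (ha : ∀ᶠ s in 𝓝 s₀, Tendsto (fun i => a i s) l (𝓝 (a₀ s))) : HasSlope a₀ b₀ s₀ := by
  refine tendsto_of_forall_isClosed_convex fun C hC hC1 hC2 => ?_
  -- The radius does not depend on `i`. For a fixed small `h`, the quotients of all late `a i` lie
  -- in the closed set `C`, and so does their limit.
  obtain ⟨δ, hδ, hball⟩ := exists_nhds_ball_of_eventually (hd.and (hb.eventually_mem hC))
  obtain ⟨ε, hε, hε'⟩ := Metric.eventually_nhds_iff_ball.1 ha
  have hsmall : ∀ᶠ h : ℝ in 𝓝 0, |h| < min δ ε := by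
    have := Metric.ball_mem_nhds (0 : ℝ) (lt_min hδ hε)
    filter_upwards [this] with h hh
    simpa [Real.dist_eq] using hh
  filter_upwards [nhdsWithin_le_nhds hsmall, self_mem_nhdsWithin] with h hh hne
  have hlim : Tendsto (fun i => h⁻¹ • (a i (s₀ + h) - a i s₀)) l
      (𝓝 (h⁻¹ • (a₀ (s₀ + h) - a₀ s₀))) := by
    have hsub := uIcc_subset_ball (s₀ := s₀) (hh.trans_le (min_le_right δ ε))
    exact ((hε' _ (hsub right_mem_uIcc)).sub (hε' _ (hsub left_mem_uIcc))).const_smul _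
  refine hC1.mem_of_tendsto hlim (hball.mono fun i hi => ?_)
  have hsub := uIcc_subset_ball (s₀ := s₀) (hh.trans_le (min_le_left δ ε))
  exact slope_mem_of_forall_mem hne hC2 hC1 (fun s hs => (hi s (hsub hs)).1)
    fun s hs => (hi s (hsub hs)).2

end Curves

/-! ### Sets whose points are reached by segments from the interior. -/

section Accessible

variable {E : Type u} [AddCommGroup E] [Module ℝ E] [TopologicalSpace E]
  {E' : Type w} [AddCommGroup E'] [Module ℝ E'] [TopologicalSpace E']

/-- Every point of `U` is the initial point of a short segment in the interior of `U`. -/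
def Accessible (U : Set E) : Prop :=
  ∀ x ∈ U, ∃ u : E, ∀ᶠ t : ℝ in 𝓝[>] 0, x + t • u ∈ interior U

theorem interior_prod_univ (U : Set E) :
    interior (U ×ˢ (univ : Set E')) = interior U ×ˢ univ := by
  rw [interior_prod_eq, interior_univ]

theorem Accessible.prod_univ {U : Set E} (hU : Accessible U) :
    Accessible (U ×ˢ (univ : Set E')) := by
  rintro ⟨x, y⟩ ⟨hx, -⟩
  obtain ⟨u, hu⟩ := hU x hx
  refine ⟨(u, 0), hu.mono fun t ht => ?_⟩
  rw [interior_prod_univ]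
  exact ⟨ht, trivial⟩

variable [IsTopologicalAddGroup E] [ContinuousSMul ℝ E]

theorem tendsto_add_smul (x v : E) : Tendsto (fun t : ℝ => x + t • v) (𝓝 0) (𝓝 x) := by
  have : Continuous fun t : ℝ => x + t • v := by fun_prop
  simpa using this.tendsto 0

theorem eventually_add_smul_mem {U : Set E} {x : E} (hx : x ∈ interior U) (v : E) :
    ∀ᶠ t : ℝ in 𝓝 0, x + t • v ∈ interior U :=
  (tendsto_add_smul x v).eventually_mem (isOpen_interior.mem_nhds hx)

theorem _root_.IsOpen.accessible {U : Set E} (hU : IsOpen U) : Accessible U := fun x hx =>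
  ⟨0, Eventually.of_forall fun t => by simpa [hU.interior_eq] using hx⟩

theorem Accessible.inter_isOpen {U O : Set E} (hU : Accessible U) (hO : IsOpen O) :
    Accessible (U ∩ O) := by
  rintro x ⟨hx, hxO⟩
  obtain ⟨u, hu⟩ := hU x hx
  refine ⟨u, ?_⟩
  filter_upwards [hu, nhdsWithin_le_nhds
    ((tendsto_add_smul x u).eventually_mem (hO.mem_nhds hxO))] with t h1 h2
  rw [interior_inter, hO.interior_eq]
  exact ⟨h1, h2⟩

theorem Accessible.nhdsWithin_neBot {U : Set E} (hU : Accessible U) {x : E} (hx : x ∈ U) :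
    (𝓝[interior U] x).NeBot := by
  obtain ⟨u, hu⟩ := hU x hx
  have h : Tendsto (fun t : ℝ => x + t • u) (𝓝[>] 0) (𝓝[interior U] x) :=
    tendsto_nhdsWithin_iff.2 ⟨(tendsto_add_smul x u).mono_left nhdsWithin_le_nhds, hu⟩
  exact h.neBot

end Accessible

/-! ### Uniqueness, locality and real linearity of the differential. -/

section Differential

variable {E : Type u} {F : Type v}
  [AddCommGroup E] [Module ℝ E] [TopologicalSpace E]
  [IsTopologicalAddGroup E] [ContinuousSMul ℝ E]
  [AddCommGroup F] [Module ℝ F] [TopologicalSpace F]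
  {f g : E → F} {df dg : E × E → F} {U O : Set E}

theorem HasDifferentialOn.congr (hf : HasDifferentialOn f df U) (h : EqOn f g U) :
    HasDifferentialOn g df U where
  tendsto x hx v := by
    refine (hf.tendsto x hx v).congr' ?_
    filter_upwards [nhdsWithin_le_nhds (eventually_add_smul_mem hx v)] with t ht
    rw [h (interior_subset hx), h (interior_subset ht)]
  continuousOn := hf.continuousOn

theorem HasDifferentialOn.hasSlope (hf : HasDifferentialOn f df U) {x v : E} {t : ℝ}
    (hx : x + t • v ∈ interior U) :
    HasSlope (fun t : ℝ => f (x + t • v)) (df (x + t • v, v)) t := by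
  refine (hf.tendsto _ hx v).congr fun h => ?_
  simp only [add_smul, add_assoc]

/-- Limits are unique at interior points; elsewhere both functions are limits of their values on the
interior. -/
theorem HasDifferentialOn.eqOn [T2Space F] (hf : HasDifferentialOn f df U)
    (hg : HasDifferentialOn f dg U) (hU : Accessible U) : EqOn df dg (U ×ˢ univ) := by
  have hint : EqOn df dg (interior (U ×ˢ univ)) := by
    rw [interior_prod_univ]
    rintro ⟨x, v⟩ ⟨hx, -⟩
    exact tendsto_nhds_unique (hf.tendsto x hx v) (hg.tendsto x hx v)
  intro z hz
  have := hU.prod_univ.nhdsWithin_neBot hz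
  refine tendsto_nhds_unique (((hf.continuousOn z hz).mono_left
    (nhdsWithin_mono z interior_subset)).congr' ?_)
    ((hg.continuousOn z hz).mono_left (nhdsWithin_mono z interior_subset))
  filter_upwards [self_mem_nhdsWithin] with y hy using hint hy

theorem HasDifferentialOn.inter (hf : HasDifferentialOn f df U) (O : Set E) :
    HasDifferentialOn f df (U ∩ O) where
  tendsto x hx v := hf.tendsto x (interior_mono inter_subset_left hx) v
  continuousOn := hf.continuousOn.mono (prod_mono inter_subset_left subset_rfl)

theorem HasDifferentialOn.hasDifferentialOn_differential (hf : HasDifferentialOn f df U) :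
    HasDifferentialOn f (differential f U) U := by
  have h : ∃ df : E × E → F, HasDifferentialOn f df U := ⟨df, hf⟩
  rw [differential, dif_pos h]
  exact h.choose_spec

theorem HasDifferentialOn.differential_eqOn [T2Space F] (hf : HasDifferentialOn f df U)
    (hU : Accessible U) : EqOn (differential f U) df (U ×ˢ univ) :=
  hf.hasDifferentialOn_differential.eqOn hf hU

theorem differential_congr (h : EqOn f g U) : differential f U = differential g U := by
  have : HasDifferentialOn f (U := U) = HasDifferentialOn g (U := U) := by
    funext df
    exact propext ⟨fun hf => hf.congr h, fun hg => hg.congr h.symm⟩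
  have key : ∀ P Q : (E × E → F) → Prop, P = Q → (open Classical in
      (if h : ∃ df, P df then h.choose else 0) = if h : ∃ df, Q df then h.choose else 0) := by
    rintro P Q rfl
    rfl
  exact key _ _ this

theorem HasDifferentialOn.continuousAt (hf : HasDifferentialOn f df U) {x : E}
    (hx : x ∈ interior U) (v : E) : ContinuousAt df (x, v) := by
  refine (hf.continuousOn (x, v) ⟨interior_subset hx, trivial⟩).continuousAt ?_
  exact prod_mem_nhds (mem_interior_iff_mem_nhds.1 hx) univ_mem

section Linear

variable [IsTopologicalAddGroup F] [ContinuousSMul ℝ F] [LocallyConvexSpace ℝ F]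

/-- Strict differentiability of `C^1` maps. -/
theorem HasDifferentialOn.tendsto_slope (hf : HasDifferentialOn f df U) {ι : Type*}
    {l : Filter ι} {y w : ι → E} {h : ι → ℝ} {x v : E} (hx : x ∈ interior U)
    (hy : Tendsto y l (𝓝 x)) (hw : Tendsto w l (𝓝 v)) (hh : Tendsto h l (𝓝[≠] 0)) :
    Tendsto (fun i => (h i)⁻¹ • (f (y i + h i • w i) - f (y i))) l (𝓝 (df (x, v))) := by
  refine tendsto_of_forall_isClosed_convex fun C hC hC1 hC2 => ?_
  have hc : Tendsto (fun p : (E × E) × ℝ => (p.1.1 + p.2 • p.1.2, p.1.2))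
      (𝓝 (x, v) ×ˢ 𝓝 0) (𝓝 (x, v)) := by
    have : Continuous fun p : (E × E) × ℝ => (p.1.1 + p.2 • p.1.2, p.1.2) := by fun_prop
    rw [← nhds_prod_eq]
    simpa using this.tendsto ((x, v), 0)
  have hU : ∀ᶠ p : E × E in 𝓝 (x, v), p.1 ∈ interior U ∧ df p ∈ C :=
    (continuous_fst.continuousAt.eventually (isOpen_interior.mem_nhds hx)).and
      ((hf.continuousAt hx v).eventually hC)
  obtain ⟨δ, hδ, hball⟩ := exists_nhds_ball_of_eventually (hc.eventually hU)
  obtain ⟨hh0, hh1⟩ := tendsto_nhdsWithin_iff.1 hh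
  have hsmall : ∀ᶠ i in l, |h i| < δ := by
    filter_upwards [hh0.eventually (Metric.ball_mem_nhds (0 : ℝ) hδ)] with i hi
    simpa [Real.dist_eq] using hi
  filter_upwards [(hy.prodMk_nhds hw).eventually hball, hsmall, hh1] with i hi hi1 hi2
  have hsub := uIcc_subset_ball (s₀ := 0) hi1
  -- The segment from `y i` to `y i + h i • w i` stays close to `x`, where all velocities `df` lie
  -- in `C`.
  have := slope_mem_of_forall_mem (α := fun t : ℝ => f (y i + t • w i))
    (α' := fun t => df (y i + t • w i, w i)) (a := 0) (h := h i) hi2 hC2 hC1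
    (fun s hs => hf.hasSlope (hi s (hsub hs)).1) fun s hs => (hi s (hsub hs)).2
  simpa using this

/-- The increment along `h • (v + w)` is the increment along `h • v` followed by the one along `h •
w` at the moving base point `x + h • v`; strict differentiability handles the latter. -/
theorem HasDifferentialOn.map_add [T2Space F] (hf : HasDifferentialOn f df U) {x : E}
    (hx : x ∈ interior U) (v w : E) : df (x, v + w) = df (x, v) + df (x, w) := by
  refine tendsto_nhds_unique (hf.tendsto x hx (v + w)) ?_
  refine ((hf.tendsto x hx v).add (hf.tendsto_slope hx
    ((tendsto_add_smul x v).mono_left nhdsWithin_le_nhds) (tendsto_const_nhds (x := w))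
      tendsto_id)).congr fun h => ?_
  simp only [id]
  rw [← smul_add, smul_add h v w, ← add_assoc]
  congr 1
  abel

theorem HasDifferentialOn.map_zero [T2Space F] (hf : HasDifferentialOn f df U) {x : E}
    (hx : x ∈ interior U) : df (x, 0) = 0 := by
  simpa using hf.map_add hx 0 0

end Linear

end Differential

/-! ### The chain rule and first-order calculus. -/

section Composition

variable {E : Type u} {F : Type v} {H : Type w}
  [AddCommGroup E] [Module ℝ E] [TopologicalSpace E]
  [IsTopologicalAddGroup E] [ContinuousSMul ℝ E]
  [AddCommGroup F] [Module ℝ F] [TopologicalSpace F]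
  [IsTopologicalAddGroup F] [ContinuousSMul ℝ F]
  [AddCommGroup H] [Module ℝ H] [TopologicalSpace H]
  [IsTopologicalAddGroup H] [ContinuousSMul ℝ H]

/-- The chain rule. -/
theorem HasDifferentialOn.comp [LocallyConvexSpace ℝ F] {k : H → F} {dk : H × H → F} {Ω : Set H}
    {g : E → H} {dg : E × E → H} {U : Set E} (hk : HasDifferentialOn k dk Ω)
    (hg : HasDifferentialOn g dg U) (hgc : ContinuousOn g U) (hm : MapsTo g U Ω)
    (hm' : MapsTo g (interior U) (interior Ω)) :
    HasDifferentialOn (k ∘ g) (fun p => dk (g p.1, dg p)) U where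
  tendsto x hx v := by
    -- Write `g (x + h • v) = g x + h • w` with `w` the difference quotient of `g`; it varies with
    -- `h`, so strict differentiability of `k` is used.
    refine (hk.tendsto_slope (hm' hx) (tendsto_const_nhds (x := g x)) (hg.tendsto x hx v)
      tendsto_id).congr' ?_
    filter_upwards [self_mem_nhdsWithin] with h hh
    have hh' : h ≠ 0 := hh
    simp [smul_smul, hh']
  continuousOn := by
    refine hk.continuousOn.comp (ContinuousOn.prodMk
      (hgc.comp continuousOn_fst fun p hp => hp.1) hg.continuousOn) fun p hp => ⟨hm hp.1, trivial⟩

theorem HasDifferentialOn.comp_continuousLinearMap {f : F → H} {df : F × F → H} {U : Set F}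
    (hf : HasDifferentialOn f df U) (l : E →L[ℝ] F) {U' : Set E} (hm : MapsTo l U' U)
    (hm' : MapsTo l (interior U') (interior U)) :
    HasDifferentialOn (f ∘ l) (df ∘ l.prodMap l) U' where
  tendsto x hx v := (hf.tendsto (l x) (hm' hx) (l v)).congr fun h => by simp
  continuousOn := hf.continuousOn.comp (l.prodMap l).continuous.continuousOn
    fun p hp => ⟨hm hp.1, trivial⟩

theorem HasDifferentialOn.prodMk {f : E → F} {df : E × E → F} {g : E → H} {dg : E × E → H}
    {U : Set E} (hf : HasDifferentialOn f df U) (hg : HasDifferentialOn g dg U) :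
    HasDifferentialOn (fun x => (f x, g x)) (fun p => (df p, dg p)) U where
  tendsto x hx v := (hf.tendsto x hx v).prodMk_nhds (hg.tendsto x hx v)
  continuousOn := hf.continuousOn.prodMk hg.continuousOn

theorem _root_.ContinuousLinearMap.hasDifferentialOn (l : E →L[ℝ] F) (U : Set E) :
    HasDifferentialOn l (fun p => l p.2) U where
  tendsto x _ v := by
    refine tendsto_const_nhds.congr' ?_
    filter_upwards [self_mem_nhdsWithin] with h hh
    have hh' : h ≠ 0 := hh
    simp [smul_smul, hh']
  continuousOn := (l.continuous.comp continuous_snd).continuousOn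

theorem HasDifferentialOn.const (c : F) (U : Set E) :
    HasDifferentialOn (fun _ => c) (fun _ => (0 : F)) U where
  tendsto x _ v := by simpa using tendsto_const_nhds
  continuousOn := continuousOn_const

end Composition

/-! ### Restriction and locality of the class `C^n`. -/

section IsCn

variable {F : Type v} [AddCommGroup F] [Module ℝ F] [TopologicalSpace F]

theorem IsCn.continuousOn {n : ℕ} {E : Type u} [AddCommGroup E] [Module ℝ E] [TopologicalSpace E]
    {f : E → F} {U : Set E} (hf : IsCn n f U) : ContinuousOn f U := by
  cases n with
  | zero => exact hf
  | succ n => exact hf.1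

theorem IsCn.of_succ {n : ℕ} {E : Type u} [AddCommGroup E] [Module ℝ E] [TopologicalSpace E]
    {f : E → F} {U : Set E} (hf : IsCn (n + 1) f U) : IsCn n f U := by
  induction n generalizing E with
  | zero => exact hf.1
  | succ n ih =>
    obtain ⟨h0, df, h1, h2⟩ := hf
    exact ⟨h0, df, h1, ih h2⟩

theorem IsCn.of_le {m n : ℕ} (h : m ≤ n) {E : Type u} [AddCommGroup E] [Module ℝ E]
    [TopologicalSpace E] {f : E → F} {U : Set E} (hf : IsCn n f U) : IsCn m f U := by
  induction n, h using Nat.le_induction with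
  | base => exact hf
  | succ n _ ih => exact ih hf.of_succ

theorem IsCn.congr {n : ℕ} {E : Type u} [AddCommGroup E] [Module ℝ E] [TopologicalSpace E]
    [IsTopologicalAddGroup E] [ContinuousSMul ℝ E]
    {f g : E → F} {U : Set E} (hf : IsCn n f U) (h : EqOn f g U) : IsCn n g U := by
  cases n with
  | zero => exact ContinuousOn.congr hf h.symm
  | succ n =>
    obtain ⟨h0, df, h1, h2⟩ := hf
    exact ⟨h0.congr h.symm, df, h1.congr h, h2⟩

theorem IsCn.inter_isOpen {n : ℕ} {E : Type u} [AddCommGroup E] [Module ℝ E] [TopologicalSpace E]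
    [IsTopologicalAddGroup E] [ContinuousSMul ℝ E]
    {f : E → F} {U O : Set E} (hf : IsCn n f U) (hO : IsOpen O) : IsCn n f (U ∩ O) := by
  induction n generalizing E with
  | zero => exact ContinuousOn.mono hf inter_subset_left
  | succ n ih =>
    obtain ⟨h0, df, h1, h2⟩ := hf
    refine ⟨h0.mono inter_subset_left, df, h1.inter O, ?_⟩
    have := ih h2 (hO.prod isOpen_univ)
    rwa [prod_inter_prod, inter_self] at this

variable [T2Space F]

theorem IsCn.differential {n : ℕ} {E : Type u} [AddCommGroup E] [Module ℝ E] [TopologicalSpace E]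
    [IsTopologicalAddGroup E] [ContinuousSMul ℝ E]
    {f : E → F} {U : Set E} (hf : IsCn (n + 1) f U) (hU : Accessible U) :
    IsCn n (differential f U) (U ×ˢ univ) := by
  obtain ⟨h0, df, h1, h2⟩ := hf
  exact h2.congr (h1.differential_eqOn hU).symm

theorem IsCn.hasDifferentialOn {n : ℕ} {E : Type u} [AddCommGroup E] [Module ℝ E]
    [TopologicalSpace E] [IsTopologicalAddGroup E] [ContinuousSMul ℝ E] {f : E → F} {U : Set E} (hf : IsCn (n + 1) f U) :
    HasDifferentialOn f (MappingGroup.differential f U) U :=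
  hf.2.choose_spec.1.hasDifferentialOn_differential

theorem IsCn.of_local {n : ℕ} {E : Type u} [AddCommGroup E] [Module ℝ E] [TopologicalSpace E]
    [IsTopologicalAddGroup E] [ContinuousSMul ℝ E] {f : E → F} {U : Set E} (hU : Accessible U)
    (h : ∀ x ∈ U, ∃ O, IsOpen O ∧ x ∈ O ∧ IsCn n f (U ∩ O)) : IsCn n f U := by
  induction n generalizing E with
  | zero =>
    intro x hx
    obtain ⟨O, hO, hxO, hf⟩ := h x hx
    exact (continuousWithinAt_inter (hO.mem_nhds hxO)).1 (hf x ⟨hx, hxO⟩)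
  | succ n ih =>
    have hc : ContinuousOn f U := by
      intro x hx
      obtain ⟨O, hO, hxO, hf⟩ := h x hx
      exact (continuousWithinAt_inter (hO.mem_nhds hxO)).1 (hf.1 x ⟨hx, hxO⟩)
    choose! O hO hxO hf using h
    have hD : ∀ x ∈ U, HasDifferentialOn f (MappingGroup.differential f (U ∩ O x)) (U ∩ O x) :=
      fun x hx => (hf x hx).hasDifferentialOn
    -- The differential at `p` is read off in the neighbourhood chosen for its own base point;
    -- uniqueness on overlaps (`heq`) makes this consistent.
    set df : E × E → F := fun p => MappingGroup.differential f (U ∩ O p.1) p with hdf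
    have heq : ∀ x ∈ U, EqOn df (MappingGroup.differential f (U ∩ O x)) ((U ∩ O x) ×ˢ univ) := by
      rintro x hx ⟨y, v⟩ ⟨⟨hy, hyx⟩, -⟩
      have h1 := (hD y hy).inter (O x)
      have h2 := (hD x hx).inter (O y)
      rw [inter_right_comm] at h2
      exact h1.eqOn h2 ((hU.inter_isOpen (hO y hy)).inter_isOpen (hO x hx))
        ⟨⟨⟨hy, hxO y hy⟩, hyx⟩, trivial⟩
    have hset : ∀ x, (U ×ˢ (univ : Set E)) ∩ (O x ×ˢ univ) = (U ∩ O x) ×ˢ univ := fun x => by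
      rw [prod_inter_prod, inter_self]
    have hn : IsCn n df (U ×ˢ univ) := by
      refine ih hU.prod_univ ?_
      rintro ⟨x, v⟩ ⟨hx, -⟩
      refine ⟨O x ×ˢ univ, (hO x hx).prod isOpen_univ, ⟨hxO x hx, trivial⟩, ?_⟩
      rw [hset]
      exact ((hf x hx).differential (hU.inter_isOpen (hO x hx))).congr (heq x hx).symm
    refine ⟨hc, df, ⟨fun x hx v => ?_, hn.continuousOn⟩, hn⟩
    have hxU := interior_subset hx
    refine (hD x hxU).tendsto x ?_ v
    rw [interior_inter, (hO x hxU).interior_eq]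
    exact ⟨hx, hxO x hxU⟩

end IsCn

/-! ### Composition and pairing of `C^n` maps. -/

section IsCnComposition

variable {F : Type v} [AddCommGroup F] [Module ℝ F] [TopologicalSpace F]
  [IsTopologicalAddGroup F] [ContinuousSMul ℝ F]

theorem IsCn.comp_continuousLinearMap {n : ℕ} {E : Type u} [AddCommGroup E] [Module ℝ E]
    [TopologicalSpace E] [IsTopologicalAddGroup E] [ContinuousSMul ℝ E] {H : Type w}
    [AddCommGroup H] [Module ℝ H] [TopologicalSpace H] [IsTopologicalAddGroup H]
    [ContinuousSMul ℝ H] {f : H → F} {U : Set H} (hf : IsCn n f U) (l : E →L[ℝ] H) {U' : Set E}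
    (hm : MapsTo l U' U) (hm' : MapsTo l (interior U') (interior U)) : IsCn n (f ∘ l) U' := by
  induction n generalizing E H with
  | zero => exact ContinuousOn.comp hf l.continuous.continuousOn hm
  | succ n ih =>
    obtain ⟨h0, df, h1, h2⟩ := hf
    refine ⟨h0.comp l.continuous.continuousOn hm, _, h1.comp_continuousLinearMap l hm hm',
      ih h2 (l.prodMap l) (fun p hp => ⟨hm hp.1, trivial⟩) ?_⟩
    rw [interior_prod_univ, interior_prod_univ]
    exact fun p hp => ⟨hm' hp.1, trivial⟩

theorem IsCn.prodMk {n : ℕ} {E : Type u} [AddCommGroup E] [Module ℝ E]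
    [TopologicalSpace E] [IsTopologicalAddGroup E] [ContinuousSMul ℝ E] {H : Type w}
    [AddCommGroup H] [Module ℝ H] [TopologicalSpace H] [IsTopologicalAddGroup H]
    [ContinuousSMul ℝ H] {f : E → F} {g : E → H} {U : Set E} (hf : IsCn n f U) (hg : IsCn n g U) :
    IsCn n (fun x => (f x, g x)) U := by
  induction n generalizing E with
  | zero => exact ContinuousOn.prodMk hf hg
  | succ n ih =>
    obtain ⟨h0, df, h1, h2⟩ := hf
    obtain ⟨k0, dg, k1, k2⟩ := hg
    exact ⟨h0.prodMk k0, _, h1.prodMk k1, ih h2 k2⟩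

theorem IsCn.comp_fst {n : ℕ} {E : Type u} [AddCommGroup E] [Module ℝ E]
    [TopologicalSpace E] [IsTopologicalAddGroup E] [ContinuousSMul ℝ E] {H : Type w}
    [AddCommGroup H] [Module ℝ H] [TopologicalSpace H] [IsTopologicalAddGroup H]
    [ContinuousSMul ℝ H] {f : E → F} {U : Set E} (hf : IsCn n f U) :
    IsCn n (fun p : E × H => f p.1) (U ×ˢ univ) := by
  refine hf.comp_continuousLinearMap (ContinuousLinearMap.fst ℝ E H) (fun p hp => hp.1) ?_
  rw [interior_prod_univ]
  exact fun p hp => hp.1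

/-- The differential of `k ∘ g` is `dk ∘ (g ∘ fst, dg)`, a composite of maps of one order less, so
the induction must run over all spaces. -/
theorem IsCn.comp [LocallyConvexSpace ℝ F] {n : ℕ} {E : Type u} [AddCommGroup E] [Module ℝ E]
    [TopologicalSpace E] [IsTopologicalAddGroup E] [ContinuousSMul ℝ E] {H : Type w}
    [AddCommGroup H] [Module ℝ H] [TopologicalSpace H] [IsTopologicalAddGroup H]
    [ContinuousSMul ℝ H] {k : H → F} {Ω : Set H} {g : E → H} {U : Set E} (hk : IsCn n k Ω)
    (hg : IsCn n g U) (hm : MapsTo g U Ω) (hm' : MapsTo g (interior U) (interior Ω)) :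
    IsCn n (k ∘ g) U := by
  induction n generalizing E H with
  | zero => exact ContinuousOn.comp hk hg hm
  | succ n ih =>
    have hg0 := hg.of_succ
    obtain ⟨h0, df, h1, h2⟩ := hk
    obtain ⟨k0, dg, k1, k2⟩ := hg
    refine ⟨h0.comp k0 hm, _, h1.comp k1 k0 hm hm', ?_⟩
    refine ih (g := fun p : E × E => (g p.1, dg p)) h2 (hg0.comp_fst.prodMk k2)
      (fun p hp => ⟨hm hp.1, trivial⟩) ?_
    rw [interior_prod_univ, interior_prod_univ]
    exact fun p hp => ⟨hm' hp.1, trivial⟩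

theorem IsCn.const {n : ℕ} {E : Type u} [AddCommGroup E] [Module ℝ E]
    [TopologicalSpace E] [IsTopologicalAddGroup E] [ContinuousSMul ℝ E] (c : F) (U : Set E) :
    IsCn n (fun _ => c) U := by
  cases n with
  | zero => exact continuousOn_const
  | succ n => exact ⟨continuousOn_const, _, HasDifferentialOn.const c U, IsCn.zero n _⟩

theorem _root_.ContinuousLinearMap.isCn {n : ℕ} {E : Type u} [AddCommGroup E] [Module ℝ E]
    [TopologicalSpace E] [IsTopologicalAddGroup E] [ContinuousSMul ℝ E] (l : E →L[ℝ] F)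
    (U : Set E) : IsCn n l U := by
  induction n generalizing E with
  | zero => exact l.continuous.continuousOn
  | succ n ih =>
    exact ⟨l.continuous.continuousOn, _, l.hasDifferentialOn U,
      ih (l.comp (ContinuousLinearMap.snd ℝ E E)) _⟩

end IsCnComposition

/-! ### Continuous convergence on compact sets. -/

section CompactConvergence

/-- Continuous convergence on compact subsets of `U` (for continuous maps, this is convergence in
the compact-open topology). -/
def TendstoOnCompacts {ι : Type*} {E : Type*} {F : Type*} [TopologicalSpace E] [TopologicalSpace F]
    (g : ι → E → F) (l : Filter ι) (g₀ : E → F) (U : Set E) : Prop :=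
  ∀ K ⊆ U, IsCompact K → ∀ x ∈ K,
    Tendsto (fun p : ι × E => g p.1 p.2) (l ×ˢ 𝓝[K] x) (𝓝 (g₀ x))

variable {ι : Type*} {E E' F H : Type*} [TopologicalSpace E] [TopologicalSpace E']
  [TopologicalSpace F] [TopologicalSpace H] {l : Filter ι} {g g' : ι → E → F} {g₀ g₀' : E → F}
  {U : Set E}

theorem TendstoOnCompacts.congr (h : TendstoOnCompacts g l g₀ U)
    (hg : ∀ᶠ i in l, EqOn (g i) (g' i) U) (hg₀ : EqOn g₀ g₀' U) :
    TendstoOnCompacts g' l g₀' U := by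
  intro K hK hKc x hx
  rw [← hg₀ (hK hx)]
  refine (h K hK hKc x hx).congr' ?_
  filter_upwards [hg.prod_mk (self_mem_nhdsWithin (a := x) (s := K))] with p hp
  exact hp.1 (hK hp.2)

theorem TendstoOnCompacts.comp_right (h : TendstoOnCompacts g l g₀ U) {γ : E' → E} {U' : Set E'}
    (hγ : ContinuousOn γ U') (hm : MapsTo γ U' U) :
    TendstoOnCompacts (fun i => g i ∘ γ) l (g₀ ∘ γ) U' := by
  intro K hK hKc x hx
  have h1 := h (γ '' K) ((hm.mono_left hK).image_subset) (hKc.image_of_continuousOn (hγ.mono hK))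
    (γ x) (mem_image_of_mem γ hx)
  refine h1.comp (tendsto_id.prodMap ?_)
  exact (hγ.mono hK x hx).tendsto_nhdsWithin (mapsTo_image γ K)

/-- Continuous convergence passes through `k` by continuity at the single point `g₀ x`; no uniform
continuity is involved. -/
theorem TendstoOnCompacts.comp_left (h : TendstoOnCompacts g l g₀ U) {k : F → H} {Ω : Set F}
    (hk : ContinuousOn k Ω) (hg : ∀ᶠ i in l, MapsTo (g i) U Ω) (hg₀ : MapsTo g₀ U Ω) :
    TendstoOnCompacts (fun i => k ∘ g i) l (k ∘ g₀) U := by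
  intro K hK hKc x hx
  refine (hk (g₀ x) (hg₀ (hK hx))).tendsto.comp
    (tendsto_nhdsWithin_iff.2 ⟨h K hK hKc x hx, ?_⟩)
  filter_upwards [hg.prod_mk (self_mem_nhdsWithin (a := x) (s := K))] with p hp
  exact hp.1 (hK hp.2)

theorem TendstoOnCompacts.prodMk (h : TendstoOnCompacts g l g₀ U) {k : ι → E → H} {k₀ : E → H}
    (hk : TendstoOnCompacts k l k₀ U) :
    TendstoOnCompacts (fun i x => (g i x, k i x)) l (fun x => (g₀ x, k₀ x)) U :=
  fun _ hK hKc x hx => (h _ hK hKc x hx).prodMk_nhds (hk _ hK hKc x hx)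

theorem tendstoOnCompacts_const (h : ContinuousOn g₀ U) :
    TendstoOnCompacts (fun _ : ι => g₀) l g₀ U := fun _ hK _ x hx =>
  ((h x (hK hx)).mono_left (nhdsWithin_mono x hK)).comp tendsto_snd

theorem TendstoOnCompacts.tendsto_path (h : TendstoOnCompacts g l g₀ U) {γ : ℝ → E}
    {T : Set ℝ} (hT : IsCompact T) (hγ : ContinuousOn γ T) (hm : MapsTo γ T U) {t : ℝ}
    (ht : t ∈ T) :
    Tendsto (fun p : ι × ℝ => g p.1 (γ p.2)) (l ×ˢ 𝓝[T] t) (𝓝 (g₀ (γ t))) :=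
  h.comp_right hγ hm T subset_rfl hT t ht

end CompactConvergence

/-! ### Exchanging a parameter derivative with the differential. -/

section Interchange

variable {E : Type u} {F : Type v}
  [AddCommGroup E] [Module ℝ E] [TopologicalSpace E]
  [IsTopologicalAddGroup E] [ContinuousSMul ℝ E]
  [AddCommGroup F] [Module ℝ F] [TopologicalSpace F]
  [IsTopologicalAddGroup F] [ContinuousSMul ℝ F] [LocallyConvexSpace ℝ F]

/-- The curve is the limit, as `t → 0`, of `s ↦ t⁻¹ • (c s (x + t • v) - c s x)`. The velocities are
quotients of `c' s`, which the mean value theorem keeps in any closed convex neighbourhood of `dc'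
s₀ (x, v)`, uniformly for `s` near `s₀`. -/
theorem hasSlope_differential_interior {c c' : ℝ → E → F} {dc dc' : ℝ → E × E → F} {U : Set E}
    {J : Set ℝ} (hJ : IsOpen J) (h0 : ∀ s ∈ J, ∀ x ∈ U, HasSlope (fun s => c s x) (c' s x) s)
    (h1 : ∀ s ∈ J, HasDifferentialOn (c s) (dc s) U)
    (h2 : ∀ s ∈ J, HasDifferentialOn (c' s) (dc' s) U) {s₀ : ℝ} (hs : s₀ ∈ J)
    (h3 : TendstoOnCompacts dc' (𝓝 s₀) (dc' s₀) (U ×ˢ univ)) {x : E} (hx : x ∈ interior U)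
    (v : E) : HasSlope (fun s => dc s (x, v)) (dc' s₀ (x, v)) s₀ := by
  have hJs : ∀ᶠ s in 𝓝 s₀, s ∈ J := hJ.mem_nhds hs
  have hxv : ∀ᶠ t : ℝ in 𝓝 0, x + t • v ∈ interior U := eventually_add_smul_mem hx v
  -- Closed balls are chosen because `dc'` converges only on compact sets; since the ball is a
  -- neighbourhood of `0`, the restriction to it then disappears.
  obtain ⟨ε, hε, hball⟩ := Metric.nhds_basis_closedBall.eventually_iff.1 hxv
  have hpath := h3.tendsto_path (γ := fun t : ℝ => (x + t • v, v))
    (isCompact_closedBall (0 : ℝ) ε) (by fun_prop)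
    (fun t ht => ⟨interior_subset (hball ht), trivial⟩) (Metric.mem_closedBall_self hε.le)
  rw [nhdsWithin_eq_nhds.2 (Metric.closedBall_mem_nhds 0 hε)] at hpath
  simp only [zero_smul, add_zero] at hpath
  refine hasSlope_of_tendsto (l := 𝓝[≠] (0 : ℝ))
    (a := fun t s => t⁻¹ • (c s (x + t • v) - c s x))
    (b := fun t s => t⁻¹ • (c' s (x + t • v) - c' s x)) ?_ ?_ ?_
  · filter_upwards [(hxv.filter_mono (nhdsWithin_le_nhds (s := {0}ᶜ))).prod_mk hJs] with p hp
    exact ((h0 _ hp.2 _ (interior_subset hp.1)).sub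
      (h0 _ hp.2 _ (interior_subset hx))).const_smul _
  · refine tendsto_of_forall_isClosed_convex fun C hC hC1 hC2 => ?_
    have hev : ∀ᶠ p : ℝ × ℝ in 𝓝 s₀ ×ˢ 𝓝 0,
        x + p.2 • v ∈ interior U ∧ dc' p.1 (x + p.2 • v, v) ∈ C :=
      (tendsto_snd.eventually hxv).and (hpath.eventually hC)
    obtain ⟨δ, hδ, hb⟩ := exists_nhds_ball_of_eventually hev
    have hsmall : ∀ᶠ t : ℝ in 𝓝[≠] 0, |t| < δ ∧ t ≠ 0 := by
      filter_upwards [nhdsWithin_le_nhds (Metric.ball_mem_nhds (0 : ℝ) hδ),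
        self_mem_nhdsWithin] with t ht ht'
      exact ⟨by simpa [Real.dist_eq] using ht, ht'⟩
    filter_upwards [hsmall.prod_mk (hJs.and hb)] with ⟨t, s⟩ ⟨⟨ht, ht0⟩, hsJ, hsb⟩
    have hsub := uIcc_subset_ball (s₀ := 0) ht
    have := slope_mem_of_forall_mem (α := fun t : ℝ => c' s (x + t • v))
      (α' := fun t => dc' s (x + t • v, v)) (a := 0) (h := t) ht0 hC2 hC1
      (fun r hr => (h2 s hsJ).hasSlope (hsb r (hsub hr)).1) fun r hr => (hsb r (hsub hr)).2
    simpa using this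
  · filter_upwards [hJs] with s hsJ
    exact (h1 s hsJ).tendsto x hx v

/-- Differentiation with respect to a parameter commutes with the differential. -/
theorem hasSlope_differential {c c' : ℝ → E → F} {dc dc' : ℝ → E × E → F} {U : Set E}
    (hU : Accessible U)
    {J : Set ℝ} (hJ : IsOpen J) (h0 : ∀ s ∈ J, ∀ x ∈ U, HasSlope (fun s => c s x) (c' s x) s)
    (h1 : ∀ s ∈ J, HasDifferentialOn (c s) (dc s) U)
    (h2 : ∀ s ∈ J, HasDifferentialOn (c' s) (dc' s) U)
    (h3 : ∀ s ∈ J, TendstoOnCompacts dc' (𝓝 s) (dc' s) (U ×ˢ univ)) {s₀ : ℝ} (hs : s₀ ∈ J)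
    {z : E × E} (hz : z ∈ U ×ˢ (univ : Set E)) :
    HasSlope (fun s => dc s z) (dc' s₀ z) s₀ := by
  obtain ⟨x, v⟩ := z
  obtain ⟨hx, -⟩ := hz
  have hJs : ∀ᶠ s in 𝓝 s₀, s ∈ J := hJ.mem_nhds hs
  obtain ⟨u, hu⟩ := hU x hx
  obtain ⟨ε, hε, hIoc⟩ := (nhdsGT_basis (0 : ℝ)).eventually_iff.1 hu
  have hm : MapsTo (fun t : ℝ => (x + t • u, v)) (Icc 0 (ε / 2)) (U ×ˢ univ) := by
    rintro t ⟨ht0, ht1⟩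
    refine ⟨?_, trivial⟩
    rcases ht0.eq_or_lt with rfl | ht0
    · simpa using hx
    · exact interior_subset (hIoc ⟨ht0, by linarith⟩)
  have hc : Continuous fun t : ℝ => (x + t • u, v) := by fun_prop
  have h0mem : (0 : ℝ) ∈ Icc 0 (ε / 2) := ⟨le_rfl, by positivity⟩
  have hle : 𝓝[>] (0 : ℝ) ≤ 𝓝[Icc 0 (ε / 2)] 0 := by
    refine nhdsWithin_le_iff.2 (mem_of_superset (Ioc_mem_nhdsGT (show (0 : ℝ) < ε / 2 by
      positivity)) Ioc_subset_Icc_self)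
  have hpath := (h3 s₀ hs).tendsto_path isCompact_Icc hc.continuousOn hm h0mem
  simp only [zero_smul, add_zero] at hpath
  -- The interior case holds at `x + t • u` for small `t > 0`, and the compact path ending at `x`
  -- supplies the convergence of the velocities.
  refine hasSlope_of_tendsto (l := 𝓝[>] (0 : ℝ)) (a := fun t s => dc s (x + t • u, v))
    (b := fun t s => dc' s (x + t • u, v)) ?_ ?_ ?_
  · filter_upwards [hu.prod_mk hJs] with p hp
    exact hasSlope_differential_interior hJ h0 h1 h2 hp.2 (h3 _ hp.2) hp.1 v
  · refine (hpath.comp (tendsto_snd.prodMk tendsto_fst)).mono_left ?_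
    exact prod_mono hle le_rfl
  · filter_upwards [hJs] with s hsJ
    have h4 := ((h1 s hsJ).continuousOn (x, v) ⟨hx, trivial⟩).tendsto
    refine h4.comp (tendsto_nhdsWithin_iff.2 ⟨?_, ?_⟩)
    · have := (hc.tendsto 0).mono_left (nhdsWithin_le_nhds (s := Ioi 0))
      simpa using this
    · filter_upwards [hu] with t ht
      exact ⟨interior_subset ht, trivial⟩

end Interchange

/-! ### Homogeneity of the differential and symmetry of second derivatives. -/

section Schwarz

variable {E : Type u} {F : Type v}
  [AddCommGroup E] [Module ℝ E] [TopologicalSpace E]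
  [IsTopologicalAddGroup E] [ContinuousSMul ℝ E]
  [AddCommGroup F] [Module ℝ F] [TopologicalSpace F]
  [IsTopologicalAddGroup F] [ContinuousSMul ℝ F] [LocallyConvexSpace ℝ F] [T2Space F]
  {f : E → F} {df : E × E → F} {ddf : (E × E) × (E × E) → F} {U : Set E}

theorem HasDifferentialOn.map_smul (hf : HasDifferentialOn f df U) {x : E}
    (hx : x ∈ interior U) (c : ℝ) (v : E) : df (x, c • v) = c • df (x, v) := by
  rcases eq_or_ne c 0 with rfl | hc
  · simp [hf.map_zero hx]
  refine tendsto_nhds_unique (hf.tendsto x hx (c • v)) ?_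
  have hl : Tendsto (fun h : ℝ => h * c) (𝓝[≠] 0) (𝓝[≠] 0) := by
    refine tendsto_nhdsWithin_iff.2 ⟨?_, ?_⟩
    · have : Continuous fun h : ℝ => h * c := by fun_prop
      simpa using (this.tendsto 0).mono_left (nhdsWithin_le_nhds (s := {0}ᶜ))
    · filter_upwards [self_mem_nhdsWithin] with h hh
      exact mul_ne_zero hh hc
  refine ((hf.tendsto_slope hx (tendsto_const_nhds (x := x)) (tendsto_const_nhds (x := v))
    hl).const_smul c).congr fun h => ?_
  rw [smul_smul, smul_smul, mul_inv, mul_comm h⁻¹, mul_inv_cancel_left₀ hc]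

/-- Symmetry of second derivatives. -/
theorem HasDifferentialOn.symmetric (hf : HasDifferentialOn f df U)
    (hdf : HasDifferentialOn df ddf (U ×ˢ univ)) {x : E} (hx : x ∈ interior U) (v w : E) :
    ddf ((x, v), (w, 0)) = ddf ((x, w), (v, 0)) := by
  have hint : ∀ {y a : E}, y ∈ interior U → (y, a) ∈ interior (U ×ˢ (univ : Set E)) := by
    intro y a hy
    rw [interior_prod_univ]
    exact ⟨hy, trivial⟩
  have hcont : Continuous fun p : ℝ × E => p.2 + p.1 • v := by fun_prop
  have hev : ∀ᶠ p : ℝ × E in 𝓝 0 ×ˢ 𝓝 x, p.2 + p.1 • v ∈ interior U := by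
    have := hcont.tendsto (0, x)
    rw [nhds_prod_eq] at this
    simp only [zero_smul, add_zero] at this
    exact this.eventually (isOpen_interior.mem_nhds hx)
  obtain ⟨J, hJ, h0J, V, hV, hxV, hJV⟩ : ∃ J : Set ℝ, IsOpen J ∧ 0 ∈ J ∧ ∃ V : Set E, IsOpen V ∧
      x ∈ V ∧ ∀ s ∈ J, ∀ y ∈ V, y + s • v ∈ interior U := by
    obtain ⟨J, hJ, V, hV, h⟩ := mem_prod_iff.1 hev
    obtain ⟨J', hJ', hJ'o, hJ'0⟩ := mem_nhds_iff.1 hJ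
    obtain ⟨V', hV', hV'o, hV'x⟩ := mem_nhds_iff.1 hV
    exact ⟨J', hJ'o, hJ'0, V', hV'o, hV'x, fun s hs y hy =>
      @h (s, y) ⟨hJ' hs, hV' hy⟩⟩
  -- The same velocity is computed twice: here by differentiating the translates `f (· + s • v)` in
  -- `s` before differentiating along `w`, and in `h8` directly from `ddf`.
  have key : HasSlope (fun s : ℝ => df (x + s • v, w))
      (ddf ((x + (0 : ℝ) • v, v), (w, 0))) 0 := by
    refine hasSlope_differential_interior (U := V) hJ (c := fun s y => f (y + s • v))
      (c' := fun s y => df (y + s • v, v)) (dc := fun s p => df (p.1 + s • v, p.2))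
      (dc' := fun s p => ddf ((p.1 + s • v, v), (p.2, 0)))
      (fun s hs y hy => hf.hasSlope (hJV s hs y hy)) ?_ ?_ h0J ?_ (hV.interior_eq.symm ▸ hxV) w
    · intro s hs
      refine ⟨fun y hy a => ?_, ?_⟩
      · refine (hf.tendsto _ (hJV s hs y (interior_subset hy)) a).congr fun h => ?_
        rw [add_right_comm]
      · exact hf.continuousOn.comp (by fun_prop) fun p hp =>
          ⟨interior_subset (hJV s hs _ hp.1), trivial⟩
    · intro s hs
      refine ⟨fun y hy a => ?_, ?_⟩
      · refine (hdf.tendsto _ (hint (hJV s hs y (interior_subset hy))) (a, 0)).congr fun h => ?_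
        simp only [Prod.mk_add_mk, Prod.smul_mk, smul_zero, add_zero, add_right_comm y]
      · exact hdf.continuousOn.comp (by fun_prop) fun p hp =>
          ⟨⟨interior_subset (hJV s hs _ hp.1), trivial⟩, trivial⟩
    · rintro K hK hKc ⟨y, a⟩ hy
      have h5 := hdf.continuousAt (hint (hJV 0 h0J y (hK hy).1) (a := v)) (a, 0)
      have h6 : Continuous fun p : ℝ × E × E => ((p.2.1 + p.1 • v, v), (p.2.2, (0 : E))) := by
        fun_prop
      have h7 := h6.tendsto (0, y, a)
      rw [nhds_prod_eq] at h7
      exact (h5.tendsto.comp h7).mono_left (prod_mono le_rfl nhdsWithin_le_nhds)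
  have h8 : HasSlope (fun s : ℝ => df (x + s • v, w)) (ddf ((x, w), (v, 0))) 0 := by
    have := hdf.hasSlope (x := (x, w)) (v := (v, 0)) (t := 0) (by simpa using hint hx)
    simpa using this
  rw [zero_smul, add_zero] at key
  exact tendsto_nhds_unique key h8

end Schwarz

/-! ### Smooth and holomorphic maps between locally convex spaces. -/

section IsSmoothOn

variable {𝕜 : Type*} [Semiring 𝕜] {E : Type u} {F : Type v} {H : Type w}
  [AddCommGroup E] [Module ℝ E] [Module 𝕜 E] [TopologicalSpace E]
  [IsTopologicalAddGroup E] [ContinuousSMul ℝ E]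
  [AddCommGroup F] [Module ℝ F] [Module 𝕜 F] [TopologicalSpace F]
  [IsTopologicalAddGroup F] [ContinuousSMul ℝ F] [LocallyConvexSpace ℝ F] [T2Space F]
  [AddCommGroup H] [Module ℝ H] [Module 𝕜 H] [TopologicalSpace H]
  [IsTopologicalAddGroup H] [ContinuousSMul ℝ H]
  {f g : E → F} {U O : Set E}

theorem isLinearMap_of_tendsto [ContinuousConstSMul 𝕜 F] {ι : Type*} {l : Filter ι} [l.NeBot]
    {L : ι → E → F} {L₀ : E → F} (hL : ∀ᶠ i in l, IsLinearMap 𝕜 (L i))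
    (h : ∀ x, Tendsto (fun i => L i x) l (𝓝 (L₀ x))) : IsLinearMap 𝕜 L₀ where
  map_add a b := tendsto_nhds_unique (h (a + b))
    (((h a).add (h b)).congr' (hL.mono fun _ hi => (hi.map_add a b).symm))
  map_smul c a := tendsto_nhds_unique (h (c • a))
    (((h a).const_smul c).congr' (hL.mono fun _ hi => (hi.map_smul c a).symm))

theorem _root_.IsLinearMap.comp {A B C : Type*} [AddCommMonoid A] [AddCommMonoid B]
    [AddCommMonoid C] [Module 𝕜 A] [Module 𝕜 B] [Module 𝕜 C] {k : B → C} {h : A → B}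
    (hk : IsLinearMap 𝕜 k) (hh : IsLinearMap 𝕜 h) : IsLinearMap 𝕜 (fun a => k (h a)) :=
  ((hk.mk' k).comp (hh.mk' h)).isLinear

theorem IsSmoothOn.isCn (hf : IsSmoothOn 𝕜 f U) (n : ℕ) : IsCn n f U := hf.1 n

theorem IsSmoothOn.continuousOn (hf : IsSmoothOn 𝕜 f U) : ContinuousOn f U := hf.1 0

theorem IsSmoothOn.hasDifferentialOn (hf : IsSmoothOn 𝕜 f U) :
    HasDifferentialOn f (differential f U) U := (hf.isCn 1).hasDifferentialOn

theorem IsSmoothOn.isLinearMap (hf : IsSmoothOn 𝕜 f U) {x : E} (hx : x ∈ interior U) :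
    IsLinearMap 𝕜 (fun v => differential f U (x, v)) := by
  obtain ⟨df, h1, h2⟩ := hf.2
  convert h2 x hx using 2 with v
  exact tendsto_nhds_unique (hf.hasDifferentialOn.tendsto x hx v) (h1.tendsto x hx v)

theorem IsSmoothOn.congr (hf : IsSmoothOn 𝕜 f U) (h : EqOn f g U) : IsSmoothOn 𝕜 g U :=
  ⟨fun n => (hf.1 n).congr h, hf.2.imp fun _ hd => ⟨hd.1.congr h, hd.2⟩⟩

theorem IsSmoothOn.inter_isOpen (hf : IsSmoothOn 𝕜 f U) (hO : IsOpen O) :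
    IsSmoothOn 𝕜 f (U ∩ O) :=
  ⟨fun n => (hf.1 n).inter_isOpen hO, hf.2.imp fun _ hd =>
    ⟨hd.1.inter O, fun x hx => hd.2 x (interior_mono inter_subset_left hx)⟩⟩

theorem IsSmoothOn.of_local (hU : Accessible U)
    (h : ∀ x ∈ U, ∃ O, IsOpen O ∧ x ∈ O ∧ IsSmoothOn 𝕜 f (U ∩ O)) : IsSmoothOn 𝕜 f U := by
  have hn : ∀ n, IsCn n f U := fun n => IsCn.of_local hU fun x hx =>
    (h x hx).imp fun O hO => ⟨hO.1, hO.2.1, hO.2.2.isCn n⟩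
  refine ⟨hn, _, (hn 1).hasDifferentialOn, fun x hx => ?_⟩
  obtain ⟨O, hO, hxO, hf⟩ := h x (interior_subset hx)
  have hx' : x ∈ interior (U ∩ O) := by
    rw [interior_inter, hO.interior_eq]
    exact ⟨hx, hxO⟩
  convert hf.isLinearMap hx' using 2 with v
  exact tendsto_nhds_unique ((hn 1).hasDifferentialOn.tendsto x hx v)
    (hf.hasDifferentialOn.tendsto x hx' v)

theorem IsSmoothOn.comp {k : H → F} {Ω : Set H} {g : E → H} (hk : IsSmoothOn 𝕜 k Ω)
    (hg : IsSmoothOn 𝕜 g U) (hm : MapsTo g U Ω) (hm' : MapsTo g (interior U) (interior Ω)) :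
    IsSmoothOn 𝕜 (k ∘ g) U := by
  refine ⟨fun n => (hk.1 n).comp (hg.1 n) hm hm', ?_⟩
  obtain ⟨dk, h1, h2⟩ := hk.2
  obtain ⟨dg, h3, h4⟩ := hg.2
  exact ⟨_, h1.comp h3 (hg.1 0) hm hm', fun x hx => (h2 _ (hm' hx)).comp (h4 x hx)⟩

theorem IsSmoothOn.comp_continuousLinearMap {k : H → F} {Ω : Set H} (hk : IsSmoothOn 𝕜 k Ω)
    (l : E →L[ℝ] H) (hl : IsLinearMap 𝕜 l) (hm : MapsTo l U Ω)
    (hm' : MapsTo l (interior U) (interior Ω)) : IsSmoothOn 𝕜 (k ∘ l) U := by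
  refine ⟨fun n => (hk.1 n).comp_continuousLinearMap l hm hm', ?_⟩
  obtain ⟨dk, h1, h2⟩ := hk.2
  exact ⟨_, h1.comp_continuousLinearMap l hm hm', fun x hx => (h2 _ (hm' hx)).comp hl⟩

theorem IsSmoothOn.prodMk {g : E → H} (hf : IsSmoothOn 𝕜 f U) (hg : IsSmoothOn 𝕜 g U) :
    IsSmoothOn 𝕜 (fun x => (f x, g x)) U := by
  refine ⟨fun n => (hf.1 n).prodMk (hg.1 n), ?_⟩
  obtain ⟨df, h1, h2⟩ := hf.2
  obtain ⟨dg, h3, h4⟩ := hg.2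
  exact ⟨_, h1.prodMk h3, fun x hx => (((h2 x hx).mk' _).prod ((h4 x hx).mk' _)).isLinear⟩

theorem IsSmoothOn.const (c : F) (U : Set E) : IsSmoothOn 𝕜 (fun _ => c) U :=
  ⟨fun _ => IsCn.const c U, _, HasDifferentialOn.const c U,
    fun _ _ => (0 : E →ₗ[𝕜] F).isLinear⟩

theorem _root_.ContinuousLinearMap.isSmoothOn (l : E →L[ℝ] F) (hl : IsLinearMap 𝕜 l)
    (U : Set E) : IsSmoothOn 𝕜 l U :=
  ⟨fun _ => l.isCn U, _, l.hasDifferentialOn U, fun _ _ => hl⟩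

theorem IsSmoothOn.restrictScalars {𝕝 : Type*} [CommSemiring 𝕝] {𝕜 : Type*} [CommSemiring 𝕜]
    [Algebra 𝕜 𝕝] [Module 𝕜 E] [Module 𝕜 F] [Module 𝕝 E] [Module 𝕝 F] [IsScalarTower 𝕜 𝕝 E]
    [IsScalarTower 𝕜 𝕝 F] (hf : IsSmoothOn 𝕝 f U) : IsSmoothOn 𝕜 f U :=
  ⟨hf.1, hf.2.imp fun _ h =>
    ⟨h.1, fun x hx => (((h.2 x hx).mk' _).restrictScalars 𝕜).isLinear⟩⟩

/-- The point is `𝕜`-linearity of the second differential. It splits as `ddf ((x, v), (w, 0)) + df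
(x, w')`, and by symmetry the first term is the derivative of `df (·, w)` along `v`: a limit of maps
that are `𝕜`-linear in `w`. -/
theorem IsSmoothOn.differential [ContinuousConstSMul 𝕜 F] [SMulCommClass ℝ 𝕜 F]
    (hf : IsSmoothOn 𝕜 f U) (hU : Accessible U) :
    IsSmoothOn 𝕜 (differential f U) (U ×ˢ univ) := by
  have hn : ∀ n, IsCn n (MappingGroup.differential f U) (U ×ˢ univ) :=
    fun n => (hf.isCn (n + 1)).differential hU
  have hd := hf.hasDifferentialOn
  have hdd := (hn 1).hasDifferentialOn
  refine ⟨hn, _, hdd, ?_⟩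
  rintro ⟨x, v⟩ hxv
  have hint : ∀ a : E, (x, a) ∈ interior (U ×ˢ (univ : Set E)) := by
    intro a
    rw [interior_prod_univ] at hxv ⊢
    exact ⟨hxv.1, trivial⟩
  have hx : x ∈ interior U := by
    rw [interior_prod_univ] at hxv
    exact hxv.1
  set df := MappingGroup.differential f U
  set ddf := MappingGroup.differential df (U ×ˢ univ)
  have h1 : IsLinearMap 𝕜 fun w => ddf ((x, v), (w, 0)) := by
    refine isLinearMap_of_tendsto (l := 𝓝[≠] (0 : ℝ))
      (L := fun h w => h⁻¹ • (df (x + h • v, w) - df (x, w))) ?_ fun w => ?_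
    · filter_upwards [(eventually_add_smul_mem hx v).filter_mono nhdsWithin_le_nhds] with h hh
      have h2 : IsLinearMap 𝕜 fun w => df (x + h • v, w) := hf.isLinearMap hh
      have h3 : IsLinearMap 𝕜 fun w => df (x, w) := hf.isLinearMap hx
      constructor
      · intro a b
        rw [h2.map_add, h3.map_add, ← smul_add]
        congr 1
        exact add_sub_add_comm _ _ _ _
      · intro c a
        rw [h2.map_smul, h3.map_smul, ← smul_sub, smul_comm]
    · rw [hd.symmetric hdd hx v w]
      have := hdd.tendsto (x, w) (hint w) (v, 0)
      simpa using this
  have h2 : ∀ w, ddf ((x, v), (0, w)) = df (x, w) := by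
    intro w
    refine tendsto_nhds_unique (hdd.tendsto (x, v) (hint v) (0, w)) ?_
    refine tendsto_const_nhds.congr' ?_
    filter_upwards [self_mem_nhdsWithin] with h hh
    have hh' : h ≠ 0 := hh
    simp [hd.map_add hx, hd.map_smul hx, smul_smul, hh']
  have h3 : (fun q : E × E => ddf ((x, v), q)) = fun q => ddf ((x, v), (q.1, 0)) + df (x, q.2) := by
    funext q
    rw [← h2 q.2, ← hdd.map_add (hint v)]
    simp
  rw [h3]
  have h4 := h1.comp (LinearMap.fst 𝕜 E E).isLinear
  have h5 := (hf.isLinearMap hx).comp (LinearMap.snd 𝕜 E E).isLinear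
  exact ((h4.mk' _) + (h5.mk' _)).isLinear

end IsSmoothOn

/-! ### Convergence of iterated differentials. -/

section TendstoCn

/-- Convergence of `d^n (g i)` to `d^n g₀`, uniformly on compact subsets of `U × E^(2^n - 1)`. -/
def TendstoCn {ι : Type*} {F : Type v} [AddCommGroup F] [Module ℝ F] [TopologicalSpace F] :
    ℕ → ∀ {E : Type u} [AddCommGroup E] [Module ℝ E] [TopologicalSpace E],
      (ι → E → F) → Filter ι → (E → F) → Set E → Prop
  | 0, _, _, _, _, g, l, g₀, U => TendstoOnCompacts g l g₀ U
  | n + 1, _, _, _, _, g, l, g₀, U =>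
      TendstoCn n (fun i => differential (g i) U) l (differential g₀ U) (U ×ˢ univ)

variable {ι : Type*} {F : Type v} [AddCommGroup F] [Module ℝ F] [TopologicalSpace F]
  {H : Type w} [AddCommGroup H] [Module ℝ H] [TopologicalSpace H]
  {l : Filter ι}

theorem TendstoCn.congr {n : ℕ} {E : Type u} [AddCommGroup E] [Module ℝ E] [TopologicalSpace E]
    [IsTopologicalAddGroup E] [ContinuousSMul ℝ E] {g g' : ι → E → F} {g₀ g₀' : E → F} {U : Set E}
    (h : TendstoCn n g l g₀ U) (hg : ∀ᶠ i in l, EqOn (g i) (g' i) U) (hg₀ : EqOn g₀ g₀' U) :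
    TendstoCn n g' l g₀' U := by
  induction n generalizing E with
  | zero => exact TendstoOnCompacts.congr h hg hg₀
  | succ n ih =>
    exact ih h (hg.mono fun i hi => by rw [differential_congr hi]; exact fun _ _ => rfl)
      (by rw [differential_congr hg₀]; exact fun _ _ => rfl)

variable [T2Space F]

theorem tendstoCn_const {n : ℕ} {E : Type u} [AddCommGroup E] [Module ℝ E]
    [TopologicalSpace E] [IsTopologicalAddGroup E] [ContinuousSMul ℝ E] {g₀ : E → F} {U : Set E}
    (hU : Accessible U) (h : IsCn n g₀ U) : TendstoCn n (fun _ : ι => g₀) l g₀ U := by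
  induction n generalizing E with
  | zero => exact tendstoOnCompacts_const h
  | succ n ih => exact ih hU.prod_univ (h.differential hU)

theorem TendstoCn.prodMk [T2Space H] {n : ℕ} {E : Type u} [AddCommGroup E] [Module ℝ E]
    [TopologicalSpace E] [IsTopologicalAddGroup E] [ContinuousSMul ℝ E]
    [IsTopologicalAddGroup F] [ContinuousSMul ℝ F] [IsTopologicalAddGroup H] [ContinuousSMul ℝ H]
    {g : ι → E → F} {g₀ : E → F} {k : ι → E → H} {k₀ : E → H} {U : Set E}
    (hU : Accessible U) (hg : TendstoCn n g l g₀ U) (hk : TendstoCn n k l k₀ U)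
    (hgn : ∀ᶠ i in l, IsCn n (g i) U) (hkn : ∀ᶠ i in l, IsCn n (k i) U) (hg₀ : IsCn n g₀ U)
    (hk₀ : IsCn n k₀ U) :
    TendstoCn n (fun i x => (g i x, k i x)) l (fun x => (g₀ x, k₀ x)) U := by
  induction n generalizing E with
  | zero => exact TendstoOnCompacts.prodMk hg hk
  | succ n ih =>
    refine (ih hU.prod_univ hg hk (hgn.mono fun i hi => hi.differential hU)
      (hkn.mono fun i hi => hi.differential hU) (hg₀.differential hU)
      (hk₀.differential hU)).congr ?_ ?_
    · filter_upwards [hgn, hkn] with i h1 h2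
      exact ((h1.hasDifferentialOn.prodMk h2.hasDifferentialOn).differential_eqOn hU).symm
    · exact ((hg₀.hasDifferentialOn.prodMk hk₀.hasDifferentialOn).differential_eqOn hU).symm

theorem TendstoCn.comp_continuousLinearMap {n : ℕ} {E : Type u} [AddCommGroup E] [Module ℝ E]
    [TopologicalSpace E] [IsTopologicalAddGroup E] [ContinuousSMul ℝ E]
    {E' : Type w} [AddCommGroup E'] [Module ℝ E'] [TopologicalSpace E'] [IsTopologicalAddGroup E']
    [ContinuousSMul ℝ E'] [IsTopologicalAddGroup F] [ContinuousSMul ℝ F]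
    {g : ι → E → F} {g₀ : E → F} {U : Set E} {U' : Set E'}
    (hU' : Accessible U') (hU : Accessible U) (hg : TendstoCn n g l g₀ U)
    (hgn : ∀ᶠ i in l, IsCn n (g i) U) (hg₀ : IsCn n g₀ U) (L : E' →L[ℝ] E) (hm : MapsTo L U' U)
    (hm' : MapsTo L (interior U') (interior U)) :
    TendstoCn n (fun i => g i ∘ L) l (g₀ ∘ L) U' := by
  induction n generalizing E E' with
  | zero => exact TendstoOnCompacts.comp_right hg L.continuous.continuousOn hm
  | succ n ih =>
    refine (ih hU'.prod_univ hU.prod_univ hg (hgn.mono fun i hi => hi.differential hU)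
      (hg₀.differential hU) (L.prodMap L) (fun p hp => ⟨hm hp.1, trivial⟩) ?_).congr ?_ ?_
    · rw [interior_prod_univ, interior_prod_univ]
      exact fun p hp => ⟨hm' hp.1, trivial⟩
    · filter_upwards [hgn] with i hi
      exact ((hi.hasDifferentialOn.comp_continuousLinearMap L hm hm').differential_eqOn hU').symm
    · exact ((hg₀.hasDifferentialOn.comp_continuousLinearMap L hm hm').differential_eqOn hU').symm

theorem TendstoCn.comp_fst {n : ℕ} {E : Type u} [AddCommGroup E] [Module ℝ E]
    [TopologicalSpace E] [IsTopologicalAddGroup E] [ContinuousSMul ℝ E]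
    {E' : Type w} [AddCommGroup E'] [Module ℝ E'] [TopologicalSpace E'] [IsTopologicalAddGroup E']
    [ContinuousSMul ℝ E'] [IsTopologicalAddGroup F] [ContinuousSMul ℝ F]
    {g : ι → E → F} {g₀ : E → F} {U : Set E} (hU : Accessible U) (hg : TendstoCn n g l g₀ U)
    (hgn : ∀ᶠ i in l, IsCn n (g i) U) (hg₀ : IsCn n g₀ U) :
    TendstoCn n (fun i (p : E × E') => g i p.1) l (fun p => g₀ p.1) (U ×ˢ univ) := by
  refine TendstoCn.comp_continuousLinearMap hU.prod_univ hU hg hgn hg₀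
    (ContinuousLinearMap.fst ℝ E E') (fun p hp => hp.1) ?_
  rw [interior_prod_univ]
  exact fun p hp => hp.1

/-- Continuity of the push-forward by a `C^n`-map. -/
theorem TendstoCn.comp_left {n : ℕ} {E : Type u} [AddCommGroup E] [Module ℝ E]
    [TopologicalSpace E] [IsTopologicalAddGroup E] [ContinuousSMul ℝ E]
    {H : Type w} [AddCommGroup H] [Module ℝ H] [TopologicalSpace H] [IsTopologicalAddGroup H]
    [ContinuousSMul ℝ H] [T2Space H]
    [IsTopologicalAddGroup F] [ContinuousSMul ℝ F] [LocallyConvexSpace ℝ F]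
    {g : ι → E → H} {g₀ : E → H} {U : Set E} {Ω : Set H} {k : H → F}
    (hU : Accessible U) (hΩ : Accessible Ω)
    (hg : ∀ m ≤ n, TendstoCn m g l g₀ U) (hk : IsCn n k Ω)
    (hgn : ∀ᶠ i in l, IsCn n (g i) U ∧ MapsTo (g i) U Ω ∧
      MapsTo (g i) (interior U) (interior Ω))
    (hg₀ : IsCn n g₀ U) (hm : MapsTo g₀ U Ω) (hm' : MapsTo g₀ (interior U) (interior Ω)) :
    TendstoCn n (fun i => k ∘ g i) l (k ∘ g₀) U := by
  induction n generalizing E H with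
  | zero => exact TendstoOnCompacts.comp_left (hg 0 le_rfl) hk (hgn.mono fun i hi => hi.2.1) hm
  | succ n ih =>
    have hn : ∀ m ≤ n, m ≤ n + 1 := fun m hm => hm.trans n.le_succ
    -- By the chain rule the differential of `k ∘ g i` is `dk` after this pair. Order `m` of the
    -- pair needs orders `m` and `m + 1` of `g`, so convergence is assumed for every order up to
    -- `n`.
    refine (ih (g := fun i (p : E × E) => (g i p.1, MappingGroup.differential (g i) U p))
      (g₀ := fun p : E × E => (g₀ p.1, MappingGroup.differential g₀ U p))
      hU.prod_univ hΩ.prod_univ ?_ (hk.differential hΩ) ?_ ?_ ?_ ?_).congr ?_ ?_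
    · intro m hmn
      refine TendstoCn.prodMk hU.prod_univ
        (TendstoCn.comp_fst hU (hg m (hn m hmn)) (hgn.mono fun i hi => hi.1.of_le (hn m hmn))
          (hg₀.of_le (hn m hmn))) (hg (m + 1) (Nat.succ_le_succ hmn)) ?_ ?_ ?_ ?_
      · exact hgn.mono fun i hi => (hi.1.of_le (hn m hmn)).comp_fst
      · exact hgn.mono fun i hi => (hi.1.differential hU).of_le hmn
      · exact (hg₀.of_le (hn m hmn)).comp_fst
      · exact (hg₀.differential hU).of_le hmn
    · filter_upwards [hgn] with i hi
      refine ⟨hi.1.of_succ.comp_fst.prodMk (hi.1.differential hU),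
        fun p hp => ⟨hi.2.1 hp.1, trivial⟩, ?_⟩
      rw [interior_prod_univ, interior_prod_univ]
      exact fun p hp => ⟨hi.2.2 hp.1, trivial⟩
    · exact hg₀.of_succ.comp_fst.prodMk (hg₀.differential hU)
    · exact fun p hp => ⟨hm hp.1, trivial⟩
    · rw [interior_prod_univ, interior_prod_univ]
      exact fun p hp => ⟨hm' hp.1, trivial⟩
    · filter_upwards [hgn] with i hi
      exact ((hk.hasDifferentialOn.comp hi.1.hasDifferentialOn hi.1.continuousOn hi.2.1
        hi.2.2).differential_eqOn hU).symm
    · exact ((hk.hasDifferentialOn.comp hg₀.hasDifferentialOn hg₀.continuousOn hm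
        hm').differential_eqOn hU).symm

/-- A curve of `C^n`-maps which is pointwise differentiable, with a velocity that is continuous
with respect to `C^n`-convergence, is differentiable with respect to `C^n`-convergence. -/
theorem tendstoCn_slope {n : ℕ} {E : Type u} [AddCommGroup E] [Module ℝ E]
    [TopologicalSpace E] [IsTopologicalAddGroup E] [ContinuousSMul ℝ E]
    [IsTopologicalAddGroup F] [ContinuousSMul ℝ F] [LocallyConvexSpace ℝ F]
    {c c' : ℝ → E → F} {U : Set E} (hU : Accessible U) {J : Set ℝ} (hJ : IsOpen J)
    (h0 : ∀ s ∈ J, ∀ x ∈ U, HasSlope (fun s => c s x) (c' s x) s)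
    (h1 : ∀ s ∈ J, IsCn n (c s) U) (h2 : ∀ s ∈ J, IsCn n (c' s) U)
    (h3 : ∀ m ≤ n, ∀ s ∈ J, TendstoCn m c' (𝓝 s) (c' s) U) {s₀ : ℝ} (hs : s₀ ∈ J) :
    TendstoCn n (fun (h : ℝ) x => h⁻¹ • (c (s₀ + h) x - c s₀ x)) (𝓝[≠] 0) (c' s₀) U := by
  have hJs : ∀ᶠ s in 𝓝 s₀, s ∈ J := hJ.mem_nhds hs
  induction n generalizing E with
  | zero =>
    intro K hK hKc x hx
    refine tendsto_of_forall_isClosed_convex fun C hC hC1 hC2 => ?_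
    have h4 : ∀ᶠ p in 𝓝 s₀ ×ˢ 𝓝[K] x, p.1 ∈ J ∧ p.2 ∈ K ∧ c' p.1 p.2 ∈ C :=
      (tendsto_fst.eventually hJs).and ((tendsto_snd.eventually self_mem_nhdsWithin).and
        ((h3 0 le_rfl s₀ hs K hK hKc x hx).eventually hC))
    obtain ⟨δ, hδ, hb⟩ := exists_nhds_ball_of_eventually
      ((tendsto_snd.prodMk tendsto_fst).eventually h4)
    have hsmall : ∀ᶠ t : ℝ in 𝓝[≠] 0, |t| < δ ∧ t ≠ 0 := by
      filter_upwards [nhdsWithin_le_nhds (Metric.ball_mem_nhds (0 : ℝ) hδ),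
        self_mem_nhdsWithin] with t ht ht'
      exact ⟨by simpa [Real.dist_eq] using ht, ht'⟩
    filter_upwards [hsmall.prod_mk hb] with ⟨t, y⟩ ⟨⟨ht, ht0⟩, hy⟩
    have hsub := uIcc_subset_ball (s₀ := s₀) ht
    exact slope_mem_of_forall_mem (α := fun s => c s y) (α' := fun s => c' s y) ht0 hC2 hC1
      (fun s hs => h0 s (hy s (hsub hs)).1 y (hK (hy s (hsub hs)).2.1))
      fun s hs => (hy s (hsub hs)).2.2
  | succ n ih =>
    -- The differentials form a curve of the same kind; its pointwise velocity comes from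
    -- `hasSlope_differential`.
    have key := ih (c := fun s => differential (c s) U) (c' := fun s => differential (c' s) U)
      hU.prod_univ ?_ (fun s hs => (h1 s hs).differential hU)
      (fun s hs => (h2 s hs).differential hU) (fun m hm => h3 (m + 1) (Nat.succ_le_succ hm))
    · refine key.congr ?_ fun _ _ => rfl
      have h5 : Tendsto (fun h : ℝ => s₀ + h) (𝓝[≠] 0) (𝓝 s₀) := by
        have : Continuous fun h : ℝ => s₀ + h := by fun_prop
        simpa using (this.tendsto 0).mono_left (nhdsWithin_le_nhds (s := {0}ᶜ))
      filter_upwards [h5.eventually hJs] with h hh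
      have h6 := ((h1 _ hh).hasDifferentialOn.add
        ((h1 _ hs).hasDifferentialOn.const_smul (-1 : ℝ))).const_smul h⁻¹
      refine fun z hz => Eq.trans ?_ ((h6.congr ?_).differential_eqOn hU hz).symm
      · simp [sub_eq_add_neg]
      · intro x _
        simp [sub_eq_add_neg]
    · intro s hs z hz
      exact hasSlope_differential hU hJ h0 (fun s hs => (h1 s hs).hasDifferentialOn)
        (fun s hs => (h2 s hs).hasDifferentialOn) (fun s hs => h3 1 (by omega) s hs) hs hz

end TendstoCn

/-! ### The topology defined by iterated differentials. -/

section DerivTopology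

variable {F : Type v} [AddCommGroup F] [Module ℝ F] [TopologicalSpace F]

theorem tendsto_derivTopology_iff [T2Space F] {n : ℕ} {E : Type u} [AddCommGroup E] [Module ℝ E]
    [TopologicalSpace E] [IsTopologicalAddGroup E] [ContinuousSMul ℝ E] [T2Space E]
    {I : Type w} {g : I → E → F} {U : Set E} (hU : Accessible U) {κ : Type*}
    {φ : κ → I} {l : Filter κ} {i₀ : I} (hg : ∀ i, IsCn n (g i) U) :
    Tendsto φ l (@nhds I (derivTopology n g U) i₀) ↔
      TendstoCn n (fun k => g (φ k)) l (g i₀) U := by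
  induction n generalizing E with
  | zero =>
    rw [derivTopology, TopologicalSpace.tendsto_nhds_generateFrom_iff]
    constructor
    · intro h K hK hKc x hx O hO
      obtain ⟨O', hO'O, hO', hxO'⟩ := mem_nhds_iff.1 hO
      have hc : ContinuousOn (g i₀) K := ContinuousOn.mono (hg i₀) hK
      have : CompactSpace K := isCompact_iff_compactSpace.1 hKc
      have h1 : (fun y : K => g i₀ y) ⁻¹' O' ∈ 𝓝 (⟨x, hx⟩ : K) :=
        (continuousOn_iff_continuous_domRestrict.1 hc).continuousAt.preimage_mem_nhds
          (hO'.mem_nhds hxO')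
      -- The compact Hausdorff space `K` is locally compact, so `x` has a compact neighbourhood in
      -- `K` which `g i₀` maps into `O'`; it yields a subbasic set.
      obtain ⟨C, hC, hCO, hCc⟩ := local_compact_nhds h1
      have h2 := h {i | MapsTo (g i) (Subtype.val '' C) O'} ⟨_, ?_, hCc.image continuous_subtype_val,
        O', hO', rfl⟩ ?_
      · have h3 : Subtype.val '' C ∈ 𝓝[K] x := by
          rw [nhdsWithin_eq_map_subtype_coe hx]
          exact image_mem_map hC
        rw [mem_map]
        filter_upwards [(show ∀ᶠ k in l, MapsTo (g (φ k)) (Subtype.val '' C) O' from h2).prod_mk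
          (show ∀ᶠ y in 𝓝[K] x, y ∈ Subtype.val '' C from h3)] with p hp
        exact hO'O (hp.1 hp.2)
      · rintro _ ⟨y, -, rfl⟩
        exact hK y.2
      · rintro _ ⟨y, hy, rfl⟩
        exact hCO hy
    · rintro h _ ⟨K, hK, hKc, O, hO, rfl⟩ hi
      have h1 : ∀ᶠ k in l, ∀ y ∈ K, g (φ k) y ∈ O := by
        refine hKc.induction_on (p := fun S => ∀ᶠ k in l, ∀ y ∈ S, g (φ k) y ∈ O) (by simp)
          (fun S T hST hT => hT.mono fun k hk y hy => hk y (hST hy))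
          (fun S T hS hT => (hS.and hT).mono fun k hk y hy => hy.elim (hk.1 y) (hk.2 y))
          fun x hx => ?_
        obtain ⟨pa, ha, pb, hb, hab⟩ := eventually_prod_iff.1
          ((h K hK hKc x hx).eventually (hO.mem_nhds (hi hx)))
        exact ⟨{y | pb y}, hb, ha.mono fun k hk y hy => hab hk hy⟩
      exact h1
  | succ n ih => exact ih hU.prod_univ fun i => (hg i).differential hU

/-- Differentials depend linearly on the function. Exhibiting each topology as induced by a linear
map into some `C(Z, F)` lets the vector space structure and local convexity be inherited through
`induced` and `⨅`. -/
theorem exists_derivTopology_eq_induced [T2Space F] [IsTopologicalAddGroup F] {R : Type*}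
    [Semiring R] [Module R F] [ContinuousConstSMul R F] [SMulCommClass ℝ R F] {n : ℕ} {E : Type u}
    [AddCommGroup E] [Module ℝ E]
    [TopologicalSpace E] [IsTopologicalAddGroup E] [ContinuousSMul ℝ E]
    {I : Type w} [AddCommGroup I] [Module R I] {g : I → E → F} {U : Set E} (hU : Accessible U)
    (hg : ∀ i, IsCn n (g i) U) (hadd : ∀ i j, EqOn (g (i + j)) (g i + g j) U)
    (hsmul : ∀ (c : R) i, EqOn (g (c • i)) (c • g i) U) :
    ∃ (Z : Type u) (_ : TopologicalSpace Z) (L : I →ₗ[R] C(Z, F)),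
      derivTopology n g U = TopologicalSpace.induced L inferInstance := by
  induction n generalizing E with
  | zero =>
    refine ⟨U, inferInstance,
      { toFun := fun i => ⟨U.domRestrict (g i), continuousOn_iff_continuous_domRestrict.1 (hg i)⟩
        map_add' := fun i j => ?_
        map_smul' := fun c i => ?_ }, ?_⟩
    · ext x
      exact hadd i j x.2
    · ext x
      exact hsmul c i x.2
    · rw [ContinuousMap.compactOpen_eq, induced_generateFrom_eq, derivTopology]
      congr 1
      ext S
      constructor
      · rintro ⟨K, hK, hKc, O, hO, rfl⟩
        refine ⟨_, ⟨Subtype.val ⁻¹' K, ?_, O, hO, rfl⟩, ?_⟩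
        · rw [mem_ofPred, Subtype.isCompact_iff, Subtype.image_preimage_coe, inter_eq_right.2 hK]
          exact hKc
        · ext i
          exact ⟨fun h x hx => h (x := ⟨x, hK hx⟩) hx, fun h x hx => h hx⟩
      · rintro ⟨_, ⟨K, hK, O, hO, rfl⟩, rfl⟩
        refine ⟨Subtype.val '' K, ?_, IsCompact.image hK continuous_subtype_val, O, hO, ?_⟩
        · rintro _ ⟨y, -, rfl⟩
          exact y.2
        · ext i
          constructor
          · rintro h _ ⟨y, hy, rfl⟩
            exact h hy
          · exact fun h x hx => h (mem_image_of_mem _ hx)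
  | succ n ih =>
    refine ih hU.prod_univ (fun i => (hg i).differential hU) (fun i j => ?_) fun c i => ?_
    · rw [differential_congr (hadd i j)]
      exact ((hg i).hasDifferentialOn.add (hg j).hasDifferentialOn).differential_eqOn hU
    · rw [differential_congr (hsmul c i)]
      exact ((hg i).hasDifferentialOn.const_smul c).differential_eqOn hU

end DerivTopology

/-! ### The locally convex space of smooth functions on `M`. -/

section SmoothFun

/-- `A` is a set of charts of `M` onto sets with accessible boundary, and covers `M`. -/
class IsAtlas {M : Type w} {E : Type u} [TopologicalSpace M] [AddCommGroup E] [Module ℝ E]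
    [TopologicalSpace E] (A : Set (PartialEquiv M E)) : Prop where
  accessible : ∀ φ ∈ A, Accessible φ.target
  isOpen_source : ∀ φ ∈ A, IsOpen φ.source
  continuousOn : ∀ φ ∈ A, ContinuousOn φ φ.source
  continuousOn_symm : ∀ φ ∈ A, ContinuousOn φ.symm φ.target
  cover : ∀ m : M, ∃ φ ∈ A, m ∈ φ.source

variable {𝕜 : Type*} [Semiring 𝕜] {M : Type w} [TopologicalSpace M] {E : Type u}
  [AddCommGroup E] [Module ℝ E] [Module 𝕜 E] [TopologicalSpace E]
  [IsTopologicalAddGroup E] [ContinuousSMul ℝ E]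
  {A : Set (PartialEquiv M E)} {F : Type v}
  [AddCommGroup F] [Module ℝ F] [Module 𝕜 F] [TopologicalSpace F]
  [IsTopologicalAddGroup F] [ContinuousSMul ℝ F] [LocallyConvexSpace ℝ F] [T2Space F]

@[simp] theorem SmoothFun.add_val (f g : SmoothFun 𝕜 A F) (m : M) : (f + g).1 m = f.1 m + g.1 m :=
  rfl

@[simp] theorem SmoothFun.sub_val (f g : SmoothFun 𝕜 A F) (m : M) : (f - g).1 m = f.1 m - g.1 m :=
  rfl

@[simp] theorem SmoothFun.smul_val {R : Type*} [Semiring R] [Module R F]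
    [SMulCommClass ℝ R F] [SMulCommClass 𝕜 R F] [ContinuousConstSMul R F] (c : R)
    (f : SmoothFun 𝕜 A F) (m : M) : (c • f).1 m = c • f.1 m :=
  rfl

variable [IsAtlas A]

theorem SmoothFun.exists_induced {R : Type*} [Semiring R] [Module R F]
    [SMulCommClass ℝ R F] [SMulCommClass 𝕜 R F] [ContinuousConstSMul R F]
    {φ : PartialEquiv M E} (hφ : φ ∈ A) (n : ℕ) :
    ∃ (Z : Type u) (_ : TopologicalSpace Z) (L : SmoothFun 𝕜 A F →ₗ[R] C(Z, F)),
      derivTopology n (fun (f : SmoothFun 𝕜 A F) (x : E) => f.1 (φ.symm x)) φ.target =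
        TopologicalSpace.induced L inferInstance :=
  exists_derivTopology_eq_induced (IsAtlas.accessible φ hφ) (fun f => (f.2 φ hφ).isCn n)
    (fun _ _ _ _ => rfl) fun _ _ _ _ => rfl

instance SmoothFun.continuousSMul {R : Type*} [Semiring R] [TopologicalSpace R] [Module R F]
    [SMulCommClass ℝ R F] [SMulCommClass 𝕜 R F] [ContinuousSMul R F] :
    ContinuousSMul R (SmoothFun 𝕜 A F) := by
  refine continuousSMul_iInf fun φ => continuousSMul_iInf fun hφ => continuousSMul_iInf fun n => ?_
  obtain ⟨Z, _, L, hL⟩ := SmoothFun.exists_induced (R := R) (F := F) (𝕜 := 𝕜) hφ n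
  rw [hL]
  exact continuousSMul_induced L

variable [SMulCommClass 𝕜 ℝ F]

instance SmoothFun.isTopologicalAddGroup : IsTopologicalAddGroup (SmoothFun 𝕜 A F) := by
  refine topologicalAddGroup_iInf fun φ => topologicalAddGroup_iInf fun hφ =>
    topologicalAddGroup_iInf fun n => ?_
  obtain ⟨Z, _, L, hL⟩ := SmoothFun.exists_induced (R := ℝ) (F := F) (𝕜 := 𝕜) hφ n
  rw [hL]
  exact topologicalAddGroup_induced L

instance SmoothFun.locallyConvexSpace : LocallyConvexSpace ℝ (SmoothFun 𝕜 A F) := by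
  refine LocallyConvexSpace.iInf fun φ => LocallyConvexSpace.iInf fun hφ =>
    LocallyConvexSpace.iInf fun n => ?_
  obtain ⟨Z, _, L, hL⟩ := SmoothFun.exists_induced (R := ℝ) (F := F) (𝕜 := 𝕜) hφ n
  rw [hL]
  exact LocallyConvexSpace.induced L

theorem SmoothFun.tendsto_iff [T2Space E] {κ : Type*} {l : Filter κ} {f : κ → SmoothFun 𝕜 A F}
    {f₀ : SmoothFun 𝕜 A F} : Tendsto f l (𝓝 f₀) ↔ ∀ φ ∈ A, ∀ n : ℕ,
      TendstoCn n (fun k x => (f k).1 (φ.symm x)) l (fun x => f₀.1 (φ.symm x)) φ.target := by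
  simp only [nhds_iInf, tendsto_iInf]
  refine forall₂_congr fun φ hφ => forall_congr' fun n => ?_
  exact tendsto_derivTopology_iff (IsAtlas.accessible φ hφ) fun f => (f.2 φ hφ).isCn n

omit [IsAtlas A] in
@[ext] theorem SmoothFun.ext {f g : SmoothFun 𝕜 A F} (h : ∀ m, f.1 m = g.1 m) : f = g :=
  Subtype.ext (funext h)

variable [T2Space E] [CompactSpace M] [T2Space M]

/-- Near `m` there is a compact neighbourhood inside a chart domain, and on its image the order-zero
condition is continuous convergence. -/
theorem SmoothFun.continuous_eval : Continuous fun p : SmoothFun 𝕜 A F × M => p.1.1 p.2 := by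
  refine continuous_iff_continuousAt.2 ?_
  rintro ⟨f, m⟩
  obtain ⟨φ, hφ, hm⟩ := IsAtlas.cover (A := A) m
  have hs := (IsAtlas.isOpen_source φ hφ).mem_nhds hm
  have hφc := IsAtlas.continuousOn φ hφ
  obtain ⟨C, hC, hCs, hCc⟩ := local_compact_nhds hs
  have h1 := SmoothFun.tendsto_iff.1 (tendsto_id (x := 𝓝 f)) φ hφ 0 (φ '' C)
    (by rintro _ ⟨x, hx, rfl⟩; exact φ.map_source (hCs hx))
    (hCc.image_of_continuousOn (hφc.mono hCs)) (φ m) (mem_image_of_mem _ (mem_of_mem_nhds hC))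
  have h2 : Tendsto φ (𝓝 m) (𝓝[φ '' C] (φ m)) := by
    refine tendsto_nhdsWithin_iff.2 ⟨(hφc.continuousAt hs), ?_⟩
    filter_upwards [hC] with x hx using mem_image_of_mem _ hx
  have h3 : Tendsto (fun p : SmoothFun 𝕜 A F × M => p.1.1 (φ.symm (φ p.2))) (𝓝 (f, m))
      (𝓝 (f.1 (φ.symm (φ m)))) := by
    rw [nhds_prod_eq]
    exact h1.comp (tendsto_id.prodMap h2)
  rw [φ.left_inv hm] at h3
  refine Tendsto.congr' ?_ h3
  filter_upwards [prod_mem_nhds (univ_mem (f := 𝓝 f)) hs] with p hp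
  simp [φ.left_inv hp.2]

theorem SmoothFun.continuous_eval_const (m : M) :
    Continuous fun f : SmoothFun 𝕜 A F => f.1 m :=
  SmoothFun.continuous_eval.comp (Continuous.prodMk_left m)

instance SmoothFun.t2Space : T2Space (SmoothFun 𝕜 A F) :=
  T2Space.of_injective_continuous (f := fun f : SmoothFun 𝕜 A F => f.1) Subtype.val_injective
    (continuous_pi fun m => SmoothFun.continuous_eval_const m)

/-- Joint continuity of evaluation keeps the condition near each `(f, m)`, and compactness of `M`
makes this uniform in `m`. This is where the domains of the charts become open. -/
theorem SmoothFun.isOpen_setOf_forall_mem {Ω : Set (M × F)} (hΩ : IsOpen Ω) :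
    IsOpen {f : SmoothFun 𝕜 A F | ∀ m, (m, f.1 m) ∈ Ω} := by
  refine isOpen_iff_mem_nhds.2 fun f hf => ?_
  have hc : Continuous fun p : SmoothFun 𝕜 A F × M => (p.2, p.1.1 p.2) :=
    continuous_snd.prodMk SmoothFun.continuous_eval
  have := isCompact_univ.eventually_forall_of_forall_eventually (x₀ := f)
    (P := fun (f : SmoothFun 𝕜 A F) (m : M) => (m, f.1 m) ∈ Ω)
    fun m _ => hc.continuousAt.eventually (hΩ.mem_nhds (hf m))
  filter_upwards [this] with g hg m using hg m trivial

end SmoothFun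

/-! ### Function spaces with values in a product. -/

section Pairing

variable {𝕜 : Type*} [Semiring 𝕜] {M : Type w} [TopologicalSpace M] {E : Type u}
  [AddCommGroup E] [Module ℝ E] [Module 𝕜 E] [TopologicalSpace E]
  [IsTopologicalAddGroup E] [ContinuousSMul ℝ E]
  {A : Set (PartialEquiv M E)} {F : Type v} {H : Type x}
  [AddCommGroup F] [Module ℝ F] [Module 𝕜 F] [TopologicalSpace F]
  [IsTopologicalAddGroup F] [ContinuousSMul ℝ F] [LocallyConvexSpace ℝ F] [T2Space F]
  [AddCommGroup H] [Module ℝ H] [Module 𝕜 H] [TopologicalSpace H]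
  [IsTopologicalAddGroup H] [ContinuousSMul ℝ H] [LocallyConvexSpace ℝ H] [T2Space H]

/-- The map with components `f` and `g`. -/
def SmoothFun.pair (f : SmoothFun 𝕜 A F) (g : SmoothFun 𝕜 A H) : SmoothFun 𝕜 A (F × H) :=
  ⟨fun m => (f.1 m, g.1 m), fun φ hφ => (f.2 φ hφ).prodMk (g.2 φ hφ)⟩

@[simp] theorem SmoothFun.pair_val (f : SmoothFun 𝕜 A F) (g : SmoothFun 𝕜 A H) (m : M) :
    (SmoothFun.pair f g).1 m = (f.1 m, g.1 m) := rfl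

variable [IsAtlas A] [SMulCommClass 𝕜 ℝ F] [SMulCommClass 𝕜 ℝ H] [T2Space E]

/-- Pairing of two continuous linear maps into function spaces. -/
noncomputable def SmoothFun.pairCLM {X Y : Type*} [AddCommGroup X] [Module ℝ X] [TopologicalSpace X]
    [AddCommGroup Y] [Module ℝ Y] [TopologicalSpace Y] (j : X →L[ℝ] SmoothFun 𝕜 A F)
    (k : Y →L[ℝ] SmoothFun 𝕜 A H) : X × Y →L[ℝ] SmoothFun 𝕜 A (F × H) where
  toFun p := SmoothFun.pair (j p.1) (k p.2)
  map_add' p q := SmoothFun.ext fun m => by simp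
  map_smul' c p := SmoothFun.ext fun m => by simp
  cont := by
    refine continuous_iff_continuousAt.2 fun p => SmoothFun.tendsto_iff.2 fun φ hφ n => ?_
    have h1 := SmoothFun.tendsto_iff.1 ((j.continuous.comp continuous_fst).tendsto p) φ hφ n
    have h2 := SmoothFun.tendsto_iff.1 ((k.continuous.comp continuous_snd).tendsto p) φ hφ n
    exact h1.prodMk (IsAtlas.accessible φ hφ) h2
      (Eventually.of_forall fun q => ((j q.1).2 φ hφ).isCn n)
      (Eventually.of_forall fun q => ((k q.2).2 φ hφ).isCn n)
      (((j p.1).2 φ hφ).isCn n) (((k p.2).2 φ hφ).isCn n)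

@[simp] theorem SmoothFun.pairCLM_apply {X Y : Type*} [AddCommGroup X] [Module ℝ X]
    [TopologicalSpace X] [AddCommGroup Y] [Module ℝ Y] [TopologicalSpace Y]
    (j : X →L[ℝ] SmoothFun 𝕜 A F) (k : Y →L[ℝ] SmoothFun 𝕜 A H) (p : X × Y) :
    SmoothFun.pairCLM j k p = SmoothFun.pair (j p.1) (k p.2) := rfl

end Pairing

/-! ### Open subsets of `M × F` in charts of `M`. -/

section Family

variable {M : Type w} [TopologicalSpace M] {E : Type u}
  [AddCommGroup E] [Module ℝ E] [TopologicalSpace E]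
  {A : Set (PartialEquiv M E)} {F : Type v} [TopologicalSpace F] [AddCommGroup F] [Module ℝ F]

/-- The part of `E × F` which corresponds to `Ω ⊆ M × F` in the chart `φ` of `M`. -/
def chartDomain (φ : PartialEquiv M E) (Ω : Set (M × F)) : Set (E × F) :=
  {p | p.1 ∈ φ.target ∧ (φ.symm p.1, p.2) ∈ Ω}

theorem exists_chartDomain_eq {φ : PartialEquiv M E} (hφ : ContinuousOn φ.symm φ.target)
    {Ω : Set (M × F)} (hΩ : IsOpen Ω) :
    ∃ O : Set (E × F), IsOpen O ∧ chartDomain φ Ω = φ.target ×ˢ univ ∩ O := by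
  have hc : ContinuousOn (fun p : E × F => (φ.symm p.1, p.2)) (φ.target ×ˢ univ) :=
    (hφ.comp continuousOn_fst fun p hp => hp.1).prodMk continuousOn_snd
  obtain ⟨O, hO, hOeq⟩ := continuousOn_iff'.1 hc Ω hΩ
  refine ⟨O, hO, ?_⟩
  rw [inter_comm _ O, ← hOeq]
  ext p
  exact ⟨fun h => ⟨h.2, h.1, trivial⟩, fun h => ⟨h.2.1, h.1⟩⟩

theorem chartDomain_accessible [IsTopologicalAddGroup F]
    [ContinuousSMul ℝ F] [IsTopologicalAddGroup E] [ContinuousSMul ℝ E]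
    [IsAtlas A] {φ : PartialEquiv M E} (hφ : φ ∈ A) {Ω : Set (M × F)} (hΩ : IsOpen Ω) :
    Accessible (chartDomain φ Ω) := by
  obtain ⟨O, hO, h⟩ := exists_chartDomain_eq (IsAtlas.continuousOn_symm φ hφ) hΩ
  rw [h]
  exact (IsAtlas.accessible φ hφ).prod_univ.inter_isOpen hO

theorem mem_interior_chartDomain {φ : PartialEquiv M E} (hφ : ContinuousOn φ.symm φ.target)
    {Ω : Set (M × F)} (hΩ : IsOpen Ω) {p : E × F} (h1 : p.1 ∈ interior φ.target)
    (h2 : (φ.symm p.1, p.2) ∈ Ω) : p ∈ interior (chartDomain φ Ω) := by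
  obtain ⟨O, hO, h⟩ := exists_chartDomain_eq hφ hΩ
  have h3 : p ∈ chartDomain φ Ω := ⟨interior_subset h1, h2⟩
  rw [h] at h3
  rw [h, interior_inter, hO.interior_eq, interior_prod_univ]
  exact ⟨⟨h1, trivial⟩, h3.2⟩

end Family

/-! ### Smooth families of maps and their partial differentials. -/

section SmoothFamily

/-- A family of maps `f m : F → H`, defined for `(m, y)` in the open set `Ω ⊆ M × F`, which is
jointly smooth over `𝕜` and smooth over `𝕝` for fixed `m`. -/
structure SmoothFamily (𝕜 𝕝 : Type*) [Semiring 𝕜] [Semiring 𝕝] {M : Type w} [TopologicalSpace M]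
    {E : Type u} [AddCommGroup E] [Module ℝ E] [Module 𝕜 E] [TopologicalSpace E]
    (A : Set (PartialEquiv M E)) {F : Type v} {H : Type x}
    [AddCommGroup F] [Module ℝ F] [Module 𝕜 F] [Module 𝕝 F] [TopologicalSpace F]
    [AddCommGroup H] [Module ℝ H] [Module 𝕜 H] [Module 𝕝 H] [TopologicalSpace H]
    (f : M → F → H) (Ω : Set (M × F)) : Prop where
  isOpen : IsOpen Ω
  joint : ∀ φ ∈ A, IsSmoothOn 𝕜 (fun p : E × F => f (φ.symm p.1) p.2) (chartDomain φ Ω)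
  slice : ∀ m, IsSmoothOn 𝕝 (f m) {y | (m, y) ∈ Ω}

variable {𝕜 𝕝 : Type*} [Semiring 𝕜] [Semiring 𝕝] {M : Type w} [TopologicalSpace M]
  {E : Type u} [AddCommGroup E] [Module ℝ E] [Module 𝕜 E] [TopologicalSpace E]
  [IsTopologicalAddGroup E] [ContinuousSMul ℝ E] [LocallyConvexSpace ℝ E] [T2Space E]
  {A : Set (PartialEquiv M E)} [IsAtlas A] {F : Type v} {H : Type x}
  [AddCommGroup F] [Module ℝ F] [Module 𝕜 F] [Module 𝕝 F] [TopologicalSpace F]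
  [IsTopologicalAddGroup F] [ContinuousSMul ℝ F] [LocallyConvexSpace ℝ F] [T2Space F]
  [AddCommGroup H] [Module ℝ H] [Module 𝕜 H] [Module 𝕝 H] [TopologicalSpace H]
  [IsTopologicalAddGroup H] [ContinuousSMul ℝ H] [LocallyConvexSpace ℝ H] [T2Space H]
  {f : M → F → H} {Ω : Set (M × F)}

theorem SmoothFamily.isOpen_slice (hf : SmoothFamily 𝕜 𝕝 A f Ω) (m : M) :
    IsOpen {y | (m, y) ∈ Ω} := hf.isOpen.preimage (Continuous.prodMk_right m)

theorem isSmoothOn_id_prodMk (f : SmoothFun 𝕜 A F) {φ : PartialEquiv M E} (hφ : φ ∈ A) :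
    IsSmoothOn 𝕜 (fun x => (x, f.1 (φ.symm x))) φ.target :=
  ((ContinuousLinearMap.id ℝ E).isSmoothOn (LinearMap.id : E →ₗ[𝕜] E).isLinear _).prodMk
    (f.2 φ hφ)

theorem SmoothFamily.isSmoothOn_comp (hf : SmoothFamily 𝕜 𝕝 A f Ω) (ξ : SmoothFun 𝕜 A F)
    (hξ : ∀ m, (m, ξ.1 m) ∈ Ω) (φ : PartialEquiv M E) (hφ : φ ∈ A) :
    IsSmoothOn 𝕜 (fun x => f (φ.symm x) (ξ.1 (φ.symm x))) φ.target :=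
  (hf.joint φ hφ).comp (isSmoothOn_id_prodMk ξ hφ) (fun _ hx => ⟨hx, hξ _⟩)
    fun x hx => mem_interior_chartDomain (p := (x, ξ.1 (φ.symm x)))
      (IsAtlas.continuousOn_symm φ hφ) hf.isOpen hx (hξ _)

open Classical in
/-- The push-forward `ξ ↦ (m ↦ f m (ξ m))`. -/
noncomputable def SmoothFamily.push (hf : SmoothFamily 𝕜 𝕝 A f Ω) (ξ : SmoothFun 𝕜 A F) :
    SmoothFun 𝕜 A H :=
  if h : ∀ m, (m, ξ.1 m) ∈ Ω then ⟨fun m => f m (ξ.1 m), hf.isSmoothOn_comp ξ h⟩ else 0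

theorem SmoothFamily.push_val (hf : SmoothFamily 𝕜 𝕝 A f Ω) {ξ : SmoothFun 𝕜 A F}
    (hξ : ∀ m, (m, ξ.1 m) ∈ Ω) (m : M) : (hf.push ξ).1 m = f m (ξ.1 m) := by
  have h : hf.push ξ = ⟨fun m => f m (ξ.1 m), hf.isSmoothOn_comp ξ hξ⟩ := dif_pos hξ
  rw [h]

/-- The differential with respect to the second variable. -/
theorem SmoothFamily.differential [ContinuousConstSMul 𝕜 H] [SMulCommClass ℝ 𝕜 H]
    [ContinuousConstSMul 𝕝 H] [SMulCommClass ℝ 𝕝 H] (hf : SmoothFamily 𝕜 𝕝 A f Ω) :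
    SmoothFamily 𝕜 𝕝 A (fun m => differential (f m) {y | (m, y) ∈ Ω})
      {p : M × (F × F) | (p.1, p.2.1) ∈ Ω} where
  isOpen := hf.isOpen.preimage (by fun_prop)
  slice m := by
    convert (hf.slice m).differential (hf.isOpen_slice m).accessible using 1
    ext p
    simp
  joint φ hφ := by
    have hsymm := IsAtlas.continuousOn_symm φ hφ
    set k : E × F → H := fun p => f (φ.symm p.1) p.2 with hk
    have hacc := chartDomain_accessible hφ hf.isOpen (A := A)
    have hd := (hf.joint φ hφ).hasDifferentialOn
    -- The map `(x, (y, v)) ↦ ((x, y), (0, v))`: after it, the joint differential is the partial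
    -- one, so joint smoothness is inherited.
    let L : E × (F × F) →L[ℝ] (E × F) × (E × F) :=
      ((ContinuousLinearMap.fst ℝ E (F × F)).prod
        ((ContinuousLinearMap.fst ℝ F F).comp (ContinuousLinearMap.snd ℝ E (F × F)))).prod
      ((0 : E × (F × F) →L[ℝ] E).prod
        ((ContinuousLinearMap.snd ℝ F F).comp (ContinuousLinearMap.snd ℝ E (F × F))))
    have hL : IsLinearMap 𝕜 L := ⟨fun _ _ => by simp [L], fun _ _ => by simp [L]⟩
    have h1 : IsSmoothOn 𝕜 (MappingGroup.differential k (chartDomain φ Ω) ∘ L)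
        (chartDomain φ {p : M × (F × F) | (p.1, p.2.1) ∈ Ω}) := by
      refine ((hf.joint φ hφ).differential hacc).comp_continuousLinearMap L hL
        (fun p hp => ⟨⟨hp.1, hp.2⟩, trivial⟩) fun p hp => ?_
      rw [interior_prod_univ]
      obtain ⟨O, hO, hOeq⟩ := exists_chartDomain_eq hsymm
        (Ω := {p : M × (F × F) | (p.1, p.2.1) ∈ Ω}) (hf.isOpen.preimage (by fun_prop))
      have hp' := hp
      rw [hOeq, interior_inter, interior_prod_univ] at hp'
      exact ⟨mem_interior_chartDomain hsymm hf.isOpen hp'.1.1 (interior_subset hp).2, trivial⟩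
    refine h1.congr ?_
    rintro ⟨x, y, v⟩ ⟨hx, hxy⟩
    have hsl := (hf.slice (φ.symm x)).hasDifferentialOn
    have hy : y ∈ interior {y | (φ.symm x, y) ∈ Ω} := by
      rw [(hf.isOpen_slice _).interior_eq]
      exact hxy
    -- At a boundary point `x` the joint differential is only a continuous extension. The identity
    -- is obtained from the interior points `x + t • u` as `t → 0`, again by `hasSlope_of_tendsto`.
    refine tendsto_nhds_unique ?_ (hsl.tendsto y hy v)
    obtain ⟨O, hO, hOeq⟩ := exists_chartDomain_eq hsymm hf.isOpen
    obtain ⟨u, hu⟩ := IsAtlas.accessible φ hφ x hx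
    have hxyO : (x, y) ∈ O := by
      have : (x, y) ∈ chartDomain φ Ω := ⟨hx, hxy⟩
      rw [hOeq] at this
      exact this.2
    have hcont : Continuous fun p : ℝ × ℝ => ((x + p.1 • u, y) + p.2 • ((0, v) : E × F)) := by
      fun_prop
    have ht0 := hcont.tendsto (0, 0)
    rw [nhds_prod_eq] at ht0
    simp only [zero_smul, add_zero] at ht0
    have hint : ∀ᶠ p : ℝ × ℝ in 𝓝[>] 0 ×ˢ 𝓝 0,
        (x + p.1 • u, y) + p.2 • ((0, v) : E × F) ∈ interior (chartDomain φ Ω) := by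
      have h2 := (ht0.eventually (hO.mem_nhds hxyO)).filter_mono
        (prod_mono (nhdsWithin_le_nhds (s := Ioi 0)) le_rfl)
      filter_upwards [h2, hu.prod_inl (𝓝 0)] with p hp hp'
      rw [hOeq, interior_inter, hO.interior_eq, interior_prod_univ]
      exact ⟨⟨by simpa using hp', trivial⟩, hp⟩
    have key : HasSlope (fun s : ℝ => k (x, y + s • v))
        (MappingGroup.differential k (chartDomain φ Ω) ((x, y), (0, v))) 0 := by
      refine hasSlope_of_tendsto (l := 𝓝[>] (0 : ℝ))
        (a := fun t s => k ((x + t • u, y) + s • ((0, v) : E × F)))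
        (b := fun t s => MappingGroup.differential k (chartDomain φ Ω)
          ((x + t • u, y) + s • ((0, v) : E × F), (0, v))) ?_ ?_ ?_
      · exact hint.mono fun p hp => hd.hasSlope hp
      · refine (hd.continuousOn ((x, y), (0, v)) ⟨⟨hx, hxy⟩, trivial⟩).tendsto.comp
          (tendsto_nhdsWithin_iff.2 ⟨?_, ?_⟩)
        · exact (ht0.mono_left (prod_mono nhdsWithin_le_nhds le_rfl)).prodMk_nhds
            tendsto_const_nhds
        · exact hint.mono fun p hp => ⟨interior_subset hp, trivial⟩
      · have h3 : ∀ᶠ s : ℝ in 𝓝 0, (x, y + s • v) ∈ chartDomain φ Ω := by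
          have := (eventually_add_smul_mem hy v).mono fun s hs => interior_subset hs
          exact this.mono fun s hs => ⟨hx, hs⟩
        obtain ⟨δ, hδ, hball⟩ := exists_nhds_ball_of_eventually
          (hint : ∀ᶠ p : ℝ × ℝ in 𝓝[>] 0 ×ˢ 𝓝 0, _)
        filter_upwards [h3, Metric.ball_mem_nhds (0 : ℝ) hδ] with s hs hsb
        refine ((hf.joint φ hφ).continuousOn _ hs).tendsto.comp
          (tendsto_nhdsWithin_iff.2 ⟨?_, ?_⟩)
        · have h4 : Continuous fun t : ℝ => (x + t • u, y) + s • ((0, v) : E × F) := by fun_prop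
          have := (h4.tendsto 0).mono_left (nhdsWithin_le_nhds (s := Ioi 0))
          simpa using this
        · exact hball.mono fun t ht => interior_subset (ht s hsb)
    have hLeq : L (x, y, v) = ((x, y), (0, v)) := by simp [L]
    rw [Function.comp_apply, hLeq]
    simpa [HasSlope, hk] using key

end SmoothFamily

/-! ### Smoothness of push-forwards between function spaces. -/

section Push

variable {𝕜 𝕝 : Type*} [Semiring 𝕜] [Semiring 𝕝] {M : Type w} [TopologicalSpace M]
  [CompactSpace M] [T2Space M]
  {E : Type u} [AddCommGroup E] [Module ℝ E] [Module 𝕜 E] [TopologicalSpace E]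
  [IsTopologicalAddGroup E] [ContinuousSMul ℝ E] [LocallyConvexSpace ℝ E] [T2Space E]
  {A : Set (PartialEquiv M E)} [IsAtlas A] {F : Type v} {H : Type x}
  [AddCommGroup F] [Module ℝ F] [Module 𝕜 F] [Module 𝕝 F] [TopologicalSpace F]
  [IsTopologicalAddGroup F] [ContinuousSMul ℝ F] [LocallyConvexSpace ℝ F] [T2Space F]
  [AddCommGroup H] [Module ℝ H] [Module 𝕜 H] [Module 𝕝 H] [TopologicalSpace H]
  [IsTopologicalAddGroup H] [ContinuousSMul ℝ H] [LocallyConvexSpace ℝ H] [T2Space H]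
  [SMulCommClass 𝕜 ℝ F] [SMulCommClass 𝕜 ℝ H] [ContinuousConstSMul 𝕜 H] [SMulCommClass ℝ 𝕜 H]
  [ContinuousConstSMul 𝕝 H] [SMulCommClass ℝ 𝕝 H] [SMulCommClass 𝕜 𝕝 H]
  {X : Type y} [AddCommGroup X] [Module ℝ X] [TopologicalSpace X]
  [IsTopologicalAddGroup X] [ContinuousSMul ℝ X]
  {f : M → F → H} {Ω : Set (M × F)} (hf : SmoothFamily 𝕜 𝕝 A f Ω)
  (j : X →L[ℝ] SmoothFun 𝕜 A F)

include hf in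
theorem SmoothFamily.isOpen_setOf_forall_mem :
    IsOpen {x : X | ∀ m, (m, (j x).1 m) ∈ Ω} :=
  (SmoothFun.isOpen_setOf_forall_mem hf.isOpen).preimage j.continuous

/-- In a chart this is composition of the fixed map `(y, z) ↦ f (φ.symm y) z` with `y ↦ (y, j x
(φ.symm y))`, a case of `TendstoCn.comp_left`. -/
theorem SmoothFamily.continuousOn_push :
    ContinuousOn (fun x => hf.push (j x)) {x : X | ∀ m, (m, (j x).1 m) ∈ Ω} := by
  intro x₀ hx₀
  refine SmoothFun.tendsto_iff.2 fun φ hφ n => ?_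
  have hsymm := IsAtlas.continuousOn_symm φ hφ
  have hU := IsAtlas.accessible φ hφ
  have hgood : ∀ x : X, (∀ m, (m, (j x).1 m) ∈ Ω) →
      IsCn n (fun y => (y, (j x).1 (φ.symm y))) φ.target ∧
      MapsTo (fun y => (y, (j x).1 (φ.symm y))) φ.target (chartDomain φ Ω) ∧
      MapsTo (fun y => (y, (j x).1 (φ.symm y))) (interior φ.target)
        (interior (chartDomain φ Ω)) := fun x hx =>
    ⟨(isSmoothOn_id_prodMk (j x) hφ).isCn n, fun y hy => ⟨hy, hx _⟩,
      fun y hy => mem_interior_chartDomain hsymm hf.isOpen hy (hx _)⟩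
  have hid : ∀ n, IsCn n (fun y : E => y) φ.target :=
    fun n => (ContinuousLinearMap.id ℝ E).isCn φ.target
  have h1 := TendstoCn.comp_left (n := n) (l := 𝓝[{x : X | ∀ m, (m, (j x).1 m) ∈ Ω}] x₀)
    (g := fun x y => (y, (j x).1 (φ.symm y))) (g₀ := fun y => (y, (j x₀).1 (φ.symm y)))
    hU (chartDomain_accessible hφ hf.isOpen) (fun m _ => ?_) ((hf.joint φ hφ).isCn n)
    (by filter_upwards [self_mem_nhdsWithin] with x hx using hgood x hx)
    (hgood x₀ hx₀).1 (hgood x₀ hx₀).2.1 (hgood x₀ hx₀).2.2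
  · refine h1.congr ?_ ?_
    · filter_upwards [self_mem_nhdsWithin] with x hx y _
      exact (hf.push_val hx _).symm
    · intro y _
      exact (hf.push_val hx₀ _).symm
  · refine TendstoCn.prodMk hU (tendstoCn_const hU (hid m)) ?_
      (Eventually.of_forall fun _ => hid m)
      (Eventually.of_forall fun x => ((j x).2 φ hφ).isCn m) (hid m) (((j x₀).2 φ hφ).isCn m)
    exact SmoothFun.tendsto_iff.1 ((j.continuous.tendsto x₀).mono_left nhdsWithin_le_nhds) φ hφ m

/-- Pointwise, the velocity along a line is the partial differential of `f`. Its `C^n`-continuity is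
`continuousOn_push` for the differentiated family, so `tendstoCn_slope` upgrades pointwise
differentiability. -/
theorem SmoothFamily.hasDifferentialOn_push :
    HasDifferentialOn (fun x => hf.push (j x))
      (fun p : X × X => hf.differential.push (SmoothFun.pairCLM j j p))
      {x : X | ∀ m, (m, (j x).1 m) ∈ Ω} where
  continuousOn := (hf.differential.continuousOn_push (SmoothFun.pairCLM j j)).mono
    fun p hp m => hp.1 m
  tendsto x hx v := by
    have hO := hf.isOpen_setOf_forall_mem j
    have hx0 := interior_subset hx
    have hc : Continuous fun s : ℝ => x + s • v := by fun_prop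
    refine SmoothFun.tendsto_iff.2 fun φ hφ n => ?_
    have hU := IsAtlas.accessible φ hφ
    have key := tendstoCn_slope (n := n) (U := φ.target) (s₀ := 0)
      (J := {s : ℝ | ∀ m, (m, (j (x + s • v)).1 m) ∈ Ω})
      (c := fun s y => (hf.push (j (x + s • v))).1 (φ.symm y))
      (c' := fun s y => (hf.differential.push (SmoothFun.pairCLM j j (x + s • v, v))).1 (φ.symm y))
      hU (hO.preimage hc) ?_ (fun s _ => ((hf.push (j (x + s • v))).2 φ hφ).isCn n)
      (fun s _ => ((hf.differential.push (SmoothFun.pairCLM j j (x + s • v, v))).2 φ hφ).isCn n)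
      ?_ (by simpa using hx0)
    · refine key.congr (Eventually.of_forall fun h y _ => ?_) fun y _ => ?_
      · simp
      · simp
    · intro s hs y hy
      set m := φ.symm y
      have h1 := (hf.slice m).hasDifferentialOn.hasSlope (x := (j x).1 m) (v := (j v).1 m) (t := s)
        (by rw [(hf.isOpen_slice m).interior_eq]; simpa using hs m)
      have h2 : (hf.differential.push (SmoothFun.pairCLM j j (x + s • v, v))).1 m =
          MappingGroup.differential (f m) {y | (m, y) ∈ Ω} ((j x).1 m + s • (j v).1 m, (j v).1 m) := by
        rw [hf.differential.push_val (ξ := SmoothFun.pairCLM j j (x + s • v, v)) fun m => hs m]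
        simp
      rw [h2]
      refine h1.congr' ?_
      have hev : ∀ᶠ h : ℝ in 𝓝[≠] 0, s + h ∈ {s : ℝ | ∀ m, (m, (j (x + s • v)).1 m) ∈ Ω} := by
        have h3 : Continuous fun h : ℝ => s + h := by fun_prop
        have h4 := (h3.tendsto 0).mono_left (nhdsWithin_le_nhds (s := {0}ᶜ))
        rw [add_zero] at h4
        exact h4.eventually ((hO.preimage hc).mem_nhds hs)
      filter_upwards [hev] with h hh
      rw [hf.push_val hh, hf.push_val hs]
      simp
    · intro m _ s hs
      have h3 : Continuous fun s : ℝ => (x + s • v, v) := by fun_prop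
      have h4 := ((hf.differential.continuousOn_push (SmoothFun.pairCLM j j)).continuousAt
        ((hf.differential.isOpen_setOf_forall_mem (SmoothFun.pairCLM j j)).mem_nhds
          (x := (x + s • v, v)) fun m => hs m)).tendsto.comp (h3.tendsto s)
      exact SmoothFun.tendsto_iff.1 h4 φ hφ m

include hf in
theorem SmoothFamily.isCn_push (n : ℕ) :
    IsCn n (fun x => hf.push (j x)) {x : X | ∀ m, (m, (j x).1 m) ∈ Ω} := by
  induction n generalizing F X with
  | zero => exact hf.continuousOn_push j
  | succ n ih =>
    refine ⟨hf.continuousOn_push j, _, hf.hasDifferentialOn_push j, ?_⟩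
    -- The parameter space `X` and the map `j` are arbitrary so that the induction can pass to `X ×
    -- X` without identifying pairs of functions with functions into a product.
    have h := ih hf.differential (SmoothFun.pairCLM j j)
    convert h using 1
    ext p
    simp

/-- Push-forwards are smooth. -/
theorem SmoothFamily.isSmoothOn_push [Module 𝕝 X] [SMulCommClass 𝕜 𝕝 F] [SMulCommClass ℝ 𝕝 F]
    [ContinuousConstSMul 𝕝 F] (hj : IsLinearMap 𝕝 j) :
    IsSmoothOn 𝕝 (fun x => hf.push (j x)) {x : X | ∀ m, (m, (j x).1 m) ∈ Ω} := by
  refine ⟨hf.isCn_push j, _, hf.hasDifferentialOn_push j, fun x hx => ?_⟩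
  have hx' := interior_subset hx
  have hval : ∀ v m, (hf.differential.push (SmoothFun.pairCLM j j (x, v))).1 m =
      MappingGroup.differential (f m) {y | (m, y) ∈ Ω} ((j x).1 m, (j v).1 m) := fun v m =>
    hf.differential.push_val (ξ := SmoothFun.pairCLM j j (x, v)) (fun m => hx' m) m
  -- Linearity over `𝕝` comes from the slices alone; thus a mapping group can be complex over a
  -- merely real `M`.
  have hlin : ∀ m, IsLinearMap 𝕝 fun w =>
      MappingGroup.differential (f m) {y | (m, y) ∈ Ω} ((j x).1 m, w) := fun m =>
    (hf.slice m).isLinearMap ((hf.isOpen_slice m).interior_eq.symm ▸ hx' m)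
  constructor
  · intro a b
    ext m
    rw [SmoothFun.add_val, hval, hval, hval, map_add, SmoothFun.add_val, (hlin m).map_add]
  · intro c a
    ext m
    rw [SmoothFun.smul_val, hval, hval, hj.map_smul, SmoothFun.smul_val, (hlin m).map_smul]

end Push

/-! ### Atlases of manifolds without boundary. -/

section OpenAtlas

/-- `B` is a set of charts of `Y` onto open sets, and covers `Y`. -/
class IsOpenAtlas {Y : Type w} {F : Type v} [TopologicalSpace Y] [TopologicalSpace F]
    (B : Set (PartialEquiv Y F)) : Prop where
  isOpen_source : ∀ φ ∈ B, IsOpen φ.source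
  isOpen_target : ∀ φ ∈ B, IsOpen φ.target
  continuousOn : ∀ φ ∈ B, ContinuousOn φ φ.source
  continuousOn_symm : ∀ φ ∈ B, ContinuousOn φ.symm φ.target
  cover : ∀ m : Y, ∃ φ ∈ B, m ∈ φ.source

theorem IsChart.isOpen_target {Y : Type w} {F : Type v} [TopologicalSpace F]
    {tY : TopologicalSpace Y} {φ : PartialEquiv Y F} (h : IsChart tY univ φ) :
    IsOpen φ.target := by
  obtain ⟨O, hO, h⟩ := h.target_eq
  rw [h, inter_univ]
  exact hO

theorem ManifoldStructure.isOpenAtlas {𝕝 : Type*} [Semiring 𝕝] {Y : Type w} {F : Type v}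
    [AddCommGroup F] [Module ℝ F] [Module 𝕝 F] [TopologicalSpace F]
    (S : ManifoldStructure 𝕝 Y F univ) :
    letI := S.top
    IsOpenAtlas S.atlas :=
  letI := S.top
  { isOpen_source := fun φ hφ => (S.isChart φ hφ).isOpen_source
    isOpen_target := fun φ hφ => (S.isChart φ hφ).isOpen_target
    continuousOn := fun φ hφ => (S.isChart φ hφ).continuousOn
    continuousOn_symm := fun φ hφ => (S.isChart φ hφ).continuousOn_symm
    cover := S.cover }

instance {Y : Type w} {F : Type v} {Y' : Type x} {F' : Type y} [TopologicalSpace Y]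
    [TopologicalSpace F] [TopologicalSpace Y'] [TopologicalSpace F']
    (B : Set (PartialEquiv Y F)) (B' : Set (PartialEquiv Y' F')) [IsOpenAtlas B]
    [IsOpenAtlas B'] : IsOpenAtlas (Set.image2 (fun φ ψ => φ.prod ψ) B B') where
  isOpen_source := by
    rintro _ ⟨φ, hφ, ψ, hψ, rfl⟩
    exact (IsOpenAtlas.isOpen_source φ hφ).prod (IsOpenAtlas.isOpen_source ψ hψ)
  isOpen_target := by
    rintro _ ⟨φ, hφ, ψ, hψ, rfl⟩
    exact (IsOpenAtlas.isOpen_target φ hφ).prod (IsOpenAtlas.isOpen_target ψ hψ)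
  continuousOn := by
    rintro _ ⟨φ, hφ, ψ, hψ, rfl⟩
    exact (IsOpenAtlas.continuousOn φ hφ).prodMap (IsOpenAtlas.continuousOn ψ hψ)
  continuousOn_symm := by
    rintro _ ⟨φ, hφ, ψ, hψ, rfl⟩
    exact (IsOpenAtlas.continuousOn_symm φ hφ).prodMap (IsOpenAtlas.continuousOn_symm ψ hψ)
  cover := by
    rintro ⟨a, b⟩
    obtain ⟨φ, hφ, ha⟩ := IsOpenAtlas.cover (B := B) a
    obtain ⟨ψ, hψ, hb⟩ := IsOpenAtlas.cover (B := B') b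
    exact ⟨_, mem_image2_of_mem hφ hψ, ha, hb⟩

end OpenAtlas

/-! ### Smooth maps from subsets of a vector space into a manifold. -/

section SmoothInto

/-- `g : U → Y` is smooth (locally in `U`) with respect to the charts in `B`. -/
def SmoothInto (𝕜 : Type*) [Semiring 𝕜] {E : Type u} {Y : Type w} {F : Type v}
    [AddCommGroup E] [Module ℝ E] [Module 𝕜 E] [TopologicalSpace E]
    [AddCommGroup F] [Module ℝ F] [Module 𝕜 F] [TopologicalSpace F]
    (B : Set (PartialEquiv Y F)) (g : E → Y) (U : Set E) : Prop :=
  ∀ x ∈ U, ∃ O, IsOpen O ∧ x ∈ O ∧ ∃ ψ ∈ B, MapsTo g (U ∩ O) ψ.source ∧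
    IsSmoothOn 𝕜 (fun x => ψ (g x)) (U ∩ O)

variable {𝕜 : Type*} [CommSemiring 𝕜] {E : Type u} {E' : Type v} {Y : Type w} {F : Type x}
  [AddCommGroup E] [Module ℝ E] [Module 𝕜 E] [TopologicalSpace E]
  [IsTopologicalAddGroup E] [ContinuousSMul ℝ E]
  [AddCommGroup E'] [Module ℝ E'] [Module 𝕜 E'] [TopologicalSpace E']
  [IsTopologicalAddGroup E'] [ContinuousSMul ℝ E']
  [AddCommGroup F] [Module ℝ F] [Module 𝕜 F] [TopologicalSpace F]
  [IsTopologicalAddGroup F] [ContinuousSMul ℝ F] [LocallyConvexSpace ℝ F] [T2Space F]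
  [tY : TopologicalSpace Y] {B : Set (PartialEquiv Y F)} {g g' : E → Y} {U O : Set E}

theorem SmoothInto.inter_isOpen (hg : SmoothInto 𝕜 B g U) (hO : IsOpen O) :
    SmoothInto 𝕜 B g (U ∩ O) := by
  rintro x ⟨hx, -⟩
  obtain ⟨O', hO', hxO', ψ, hψ, hm, hs⟩ := hg x hx
  refine ⟨O', hO', hxO', ψ, hψ, ?_, ?_⟩
  · rw [inter_right_comm]
    exact hm.mono_left inter_subset_left
  · rw [inter_right_comm]
    exact hs.inter_isOpen hO

theorem SmoothInto.of_isSmoothOn {ψ : PartialEquiv Y F} (hψ : ψ ∈ B) (hm : MapsTo g U ψ.source)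
    (hs : IsSmoothOn 𝕜 (fun x => ψ (g x)) U) : SmoothInto 𝕜 B g U := fun x _ =>
  ⟨univ, isOpen_univ, trivial, ψ, hψ, by rwa [inter_univ], by rwa [inter_univ]⟩

theorem IsSmoothOn.comp_isOpen {k : F → E'} {Ω : Set F} {g : E → F} [LocallyConvexSpace ℝ E']
    [T2Space E'] (hk : IsSmoothOn 𝕜 k Ω) (hΩ : IsOpen Ω)
    (hg : IsSmoothOn 𝕜 g U) (hm : MapsTo g U Ω) : IsSmoothOn 𝕜 (k ∘ g) U :=
  hk.comp hg hm (by rw [hΩ.interior_eq]; exact hm.mono_left interior_subset)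

variable [IsOpenAtlas B]

theorem SmoothInto.continuousOn (hg : SmoothInto 𝕜 B g U) : ContinuousOn g U := by
  intro x hx
  obtain ⟨O, hO, hxO, ψ, hψ, hm, hs⟩ := hg x hx
  have h1 : ContinuousOn g (U ∩ O) :=
    ((IsOpenAtlas.continuousOn_symm ψ hψ).comp hs.continuousOn
      fun y hy => ψ.map_source (hm hy)).congr fun y hy => (ψ.left_inv (hm hy)).symm
  exact (continuousWithinAt_inter (hO.mem_nhds hxO)).1 (h1 x ⟨hx, hxO⟩)

theorem SmoothInto.exists_preimage (hg : SmoothInto 𝕜 B g U) {V : Set Y} (hV : IsOpen V) :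
    ∃ O, IsOpen O ∧ {x | x ∈ U ∧ g x ∈ V} = U ∩ O := by
  obtain ⟨O, hO, h⟩ := continuousOn_iff'.1 hg.continuousOn V hV
  refine ⟨O, hO, ?_⟩
  rw [inter_comm U O, ← h]
  ext x
  exact and_comm

theorem SmoothInto.const (c : Y) (U : Set E) : SmoothInto 𝕜 B (fun _ => c) U := by
  obtain ⟨ψ, hψ, hc⟩ := IsOpenAtlas.cover (B := B) c
  exact SmoothInto.of_isSmoothOn hψ (fun _ _ => hc) (IsSmoothOn.const _ _)

theorem smoothInto_symm {ψ : PartialEquiv Y F} (hψ : ψ ∈ B) :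
    SmoothInto 𝕜 B ψ.symm ψ.target := by
  refine SmoothInto.of_isSmoothOn hψ (fun x hx => ψ.map_target hx) ?_
  exact ((ContinuousLinearMap.id ℝ F).isSmoothOn (LinearMap.id : F →ₗ[𝕜] F).isLinear _).congr
    fun x hx => (ψ.right_inv hx).symm

theorem SmoothInto.comp_isSmoothOn [LocallyConvexSpace ℝ E] [T2Space E]
    (hg : SmoothInto 𝕜 B g U) {h : E' → E} {U' : Set E'}
    (hh : IsSmoothOn 𝕜 h U') (hm : MapsTo h U' U)
    (hm' : MapsTo h (interior U') (interior U)) : SmoothInto 𝕜 B (fun x => g (h x)) U' := by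
  intro x hx
  obtain ⟨O, hO, hxO, ψ, hψ, hgm, hs⟩ := hg (h x) (hm hx)
  obtain ⟨O', hO', hOO'⟩ := continuousOn_iff'.1 hh.continuousOn O hO
  have hmem : ∀ y ∈ U' ∩ O', h y ∈ O := fun y hy => by
    have : y ∈ O' ∩ U' := ⟨hy.2, hy.1⟩
    rw [← hOO'] at this
    exact this.1
  have hxO' : x ∈ O' := by
    have : x ∈ h ⁻¹' O ∩ U' := ⟨hxO, hx⟩
    rw [hOO'] at this
    exact this.1
  refine ⟨O', hO', hxO', ψ, hψ, fun y hy => hgm ⟨hm hy.1, hmem y hy⟩, ?_⟩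
  refine hs.comp (hh.inter_isOpen hO') (fun y hy => ⟨hm hy.1, hmem y hy⟩) fun y hy => ?_
  have hy' := interior_subset hy
  rw [interior_inter] at hy
  rw [interior_inter, hO.interior_eq]
  exact ⟨hm' hy.1, hmem y hy'⟩

theorem SmoothInto.comp_continuousLinearMap
    (hg : SmoothInto 𝕜 B g U) (L : E' →L[ℝ] E) (hL : IsLinearMap 𝕜 L) {U' : Set E'}
    (hm : MapsTo L U' U) (hm' : MapsTo L (interior U') (interior U)) :
    SmoothInto 𝕜 B (fun x => g (L x)) U' := by
  intro x hx
  obtain ⟨O, hO, hxO, ψ, hψ, hgm, hs⟩ := hg (L x) (hm hx)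
  refine ⟨L ⁻¹' O, hO.preimage L.continuous, hxO, ψ, hψ, fun y hy => hgm ⟨hm hy.1, hy.2⟩, ?_⟩
  refine hs.comp_continuousLinearMap L hL (fun y hy => ⟨hm hy.1, hy.2⟩) fun y hy => ?_
  rw [interior_inter] at hy ⊢
  rw [hO.interior_eq]
  exact ⟨hm' hy.1, (interior_subset hy.2 : y ∈ L ⁻¹' O)⟩

theorem SmoothInto.prodMk {Y' : Type*} {F' : Type*} [TopologicalSpace Y']
    [AddCommGroup F'] [Module ℝ F'] [Module 𝕜 F'] [TopologicalSpace F']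
    [IsTopologicalAddGroup F'] [ContinuousSMul ℝ F'] [LocallyConvexSpace ℝ F'] [T2Space F']
    {B' : Set (PartialEquiv Y' F')} {k : E → Y'} (hg : SmoothInto 𝕜 B g U)
    (hk : SmoothInto 𝕜 B' k U) :
    SmoothInto 𝕜 (Set.image2 (fun φ ψ => φ.prod ψ) B B') (fun x => (g x, k x)) U := by
  intro x hx
  obtain ⟨O, hO, hxO, ψ, hψ, hgm, hs⟩ := hg x hx
  obtain ⟨O', hO', hxO', χ, hχ, hkm, hs'⟩ := hk x hx
  refine ⟨O ∩ O', hO.inter hO', ⟨hxO, hxO'⟩, _, mem_image2_of_mem hψ hχ,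
    fun y hy => ⟨hgm ⟨hy.1, hy.2.1⟩, hkm ⟨hy.1, hy.2.2⟩⟩, ?_⟩
  have h1 := hs.inter_isOpen hO'
  have h2 := hs'.inter_isOpen hO
  rw [inter_right_comm] at h2
  have h3 := h1.prodMk h2
  rw [inter_assoc] at h3
  exact h3

section ChangeOfScalars

variable {𝕝 : Type*} [CommSemiring 𝕝] [Algebra 𝕜 𝕝] [Module 𝕝 F] [IsScalarTower 𝕜 𝕝 F]
  {Z : Type*} {H : Type*} [tZ : TopologicalSpace Z]
  [AddCommGroup H] [Module ℝ H] [Module 𝕜 H] [Module 𝕝 H] [IsScalarTower 𝕜 𝕝 H]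
  [TopologicalSpace H] [IsTopologicalAddGroup H] [ContinuousSMul ℝ H] [LocallyConvexSpace ℝ H]
  [T2Space H] {C : Set (PartialEquiv Z H)}

/-- Locally this is the coordinate change `ψ ∘ e.symm` after `e ∘ g`, with scalars restricted from
`𝕝` to `𝕜`. The chart `ψ` need only be compatible with `B`. -/
theorem SmoothInto.isSmoothOn (hg : SmoothInto 𝕜 B g U) (hU : Accessible U) {ψ : PartialEquiv Y H}
    (hψ : IsOpen ψ.source) (hc : ∀ e ∈ B, IsSmoothOn 𝕝 (fun x => ψ (e.symm x))
      {x | x ∈ e.target ∧ e.symm x ∈ ψ.source}) (hm : MapsTo g U ψ.source) :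
    IsSmoothOn 𝕜 (fun x => ψ (g x)) U := by
  refine IsSmoothOn.of_local hU fun x hx => ?_
  obtain ⟨O, hO, hxO, e, he, hgm, hs⟩ := hg x hx
  refine ⟨O, hO, hxO, ?_⟩
  have hΩ : IsOpen {x | x ∈ e.target ∧ e.symm x ∈ ψ.source} :=
    (IsOpenAtlas.continuousOn_symm e he).isOpen_inter_preimage (IsOpenAtlas.isOpen_target e he) hψ
  have h1 : IsSmoothOn 𝕜 (fun x => ψ (e.symm x)) {x | x ∈ e.target ∧ e.symm x ∈ ψ.source} :=
    (hc e he).restrictScalars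
  refine (h1.comp_isOpen hΩ hs fun y hy => ⟨e.map_source (hgm hy), ?_⟩).congr fun y hy => ?_
  · rw [e.left_inv (hgm hy)]
    exact hm hy.1
  · simp [e.left_inv (hgm hy)]

theorem SmoothInto.comp_isSmoothMap [IsOpenAtlas C] (hg : SmoothInto 𝕜 B g U)
    {f : Y → Z} (hf : IsSmoothMap 𝕝 tY B tZ C f) :
    SmoothInto 𝕜 C (fun x => f (g x)) U := by
  intro x hx
  obtain ⟨O, hO, hxO, e, he, hgm, hs⟩ := hg x hx
  obtain ⟨ψ, hψ, hxψ⟩ := IsOpenAtlas.cover (B := C) (f (g x))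
  have hsrc : IsOpen (f ⁻¹' ψ.source) := (IsOpenAtlas.isOpen_source ψ hψ).preimage hf.continuous
  obtain ⟨O', hO', hOO'⟩ := hg.exists_preimage hsrc
  have hxO' : x ∈ O' := by
    have : x ∈ {x | x ∈ U ∧ g x ∈ f ⁻¹' ψ.source} := ⟨hx, hxψ⟩
    rw [hOO'] at this
    exact this.2
  have hmem : ∀ y ∈ U ∩ O', f (g y) ∈ ψ.source := fun y hy => by
    rw [← hOO'] at hy
    exact hy.2
  refine ⟨O ∩ O', hO.inter hO', ⟨hxO, hxO'⟩, ψ, hψ, fun y hy => hmem y ⟨hy.1, hy.2.2⟩, ?_⟩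
  have h1 : IsSmoothOn 𝕜 (fun x => ψ (f (e.symm x)))
      {x | x ∈ e.target ∧ f (e.symm x) ∈ ψ.source} := (hf.smooth e he ψ hψ).restrictScalars
  have hΩ : IsOpen {x | x ∈ e.target ∧ f (e.symm x) ∈ ψ.source} :=
    (IsOpenAtlas.continuousOn_symm e he).isOpen_inter_preimage
      (IsOpenAtlas.isOpen_target e he) hsrc
  have hs' := hs.inter_isOpen hO'
  rw [inter_assoc] at hs'
  have hinv : ∀ y ∈ U ∩ (O ∩ O'), e.symm (e (g y)) = g y := fun y hy =>
    e.left_inv (hgm ⟨hy.1, hy.2.1⟩)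
  refine (h1.comp_isOpen hΩ hs' fun y hy => ⟨e.map_source (hgm ⟨hy.1, hy.2.1⟩), ?_⟩).congr
    fun y hy => ?_
  · rw [hinv y hy]
    exact hmem y ⟨hy.1, hy.2.2⟩
  · simp [hinv y hy]

end ChangeOfScalars

end SmoothInto

/-! ### Smooth maps between manifolds, described locally. -/

section MapsOfManifolds

variable {𝕜 𝕝 : Type*} [CommSemiring 𝕜] [CommSemiring 𝕝] [Algebra 𝕜 𝕝]
  {M : Type w} [tM : TopologicalSpace M]
  {E : Type u} [AddCommGroup E] [Module ℝ E] [Module 𝕜 E] [TopologicalSpace E]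
  [IsTopologicalAddGroup E] [ContinuousSMul ℝ E]
  {A : Set (PartialEquiv M E)} [IsAtlas A]
  {Y : Type x} [tY : TopologicalSpace Y] {F : Type v}
  [AddCommGroup F] [Module ℝ F] [Module 𝕜 F] [Module 𝕝 F] [IsScalarTower 𝕜 𝕝 F]
  [TopologicalSpace F] [IsTopologicalAddGroup F] [ContinuousSMul ℝ F] [LocallyConvexSpace ℝ F]
  [T2Space F] {B : Set (PartialEquiv Y F)} [IsOpenAtlas B]

theorem continuous_of_charts {f : M → Y}
    (h : ∀ φ ∈ A, ContinuousOn (fun x => f (φ.symm x)) φ.target) : Continuous f := by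
  refine continuous_iff_continuousAt.2 fun m => ?_
  obtain ⟨φ, hφ, hm⟩ := IsAtlas.cover (A := A) m
  have hs := (IsAtlas.isOpen_source φ hφ).mem_nhds hm
  have h1 := ((h φ hφ).comp (IsAtlas.continuousOn φ hφ) φ.mapsTo).continuousAt hs
  refine h1.congr ?_
  filter_upwards [hs] with x hx
  simp [φ.left_inv hx]

theorem isSmoothMap_iff_smoothInto (hB : ∀ e ∈ B, ∀ ψ ∈ B, SmoothChange 𝕝 e ψ) {f : M → Y} :
    IsSmoothMap 𝕜 tM A tY B f ↔ ∀ φ ∈ A, SmoothInto 𝕜 B (fun x => f (φ.symm x)) φ.target := by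
  constructor
  · intro hf φ hφ x hx
    obtain ⟨ψ, hψ, hxψ⟩ := IsOpenAtlas.cover (B := B) (f (φ.symm x))
    have hc : ContinuousOn (fun x => f (φ.symm x)) φ.target :=
      hf.continuous.comp_continuousOn (IsAtlas.continuousOn_symm φ hφ)
    obtain ⟨O, hO, hOeq⟩ := continuousOn_iff'.1 hc _ (IsOpenAtlas.isOpen_source ψ hψ)
    have hset : {x | x ∈ φ.target ∧ f (φ.symm x) ∈ ψ.source} = φ.target ∩ O := by
      rw [inter_comm _ O, ← hOeq]
      ext y
      exact and_comm
    have hx' : x ∈ φ.target ∩ O := hset ▸ ⟨hx, hxψ⟩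
    refine ⟨O, hO, hx'.2, ψ, hψ, fun y hy => ?_, ?_⟩
    · rw [← hset] at hy
      exact hy.2
    · rw [← hset]
      exact hf.smooth φ hφ ψ hψ
  · intro h
    refine ⟨continuous_of_charts fun φ hφ => (h φ hφ).continuousOn, fun φ hφ ψ hψ => ?_⟩
    obtain ⟨O, hO, hOeq⟩ := (h φ hφ).exists_preimage (IsOpenAtlas.isOpen_source ψ hψ)
    have hm : MapsTo (fun x => f (φ.symm x)) (φ.target ∩ O) ψ.source := fun y hy => by
      rw [← hOeq] at hy
      exact hy.2
    rw [hOeq]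
    exact ((h φ hφ).inter_isOpen hO).isSmoothOn (𝕝 := 𝕝)
      ((IsAtlas.accessible φ hφ).inter_isOpen hO)
      (IsOpenAtlas.isOpen_source ψ hψ) (fun e he => hB e he ψ hψ) hm

end MapsOfManifolds

/-! ### Pointwise operations on Lie group valued maps. -/

section LieGroup

variable {𝕜 𝕝 : Type*} [CommSemiring 𝕜] [CommSemiring 𝕝] [Algebra 𝕜 𝕝]
  {E : Type u} [AddCommGroup E] [Module ℝ E] [Module 𝕜 E] [TopologicalSpace E]
  [IsTopologicalAddGroup E] [ContinuousSMul ℝ E]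
  {K : Type x} [Group K] {F : Type v}
  [AddCommGroup F] [Module ℝ F] [Module 𝕜 F] [Module 𝕝 F] [IsScalarTower 𝕜 𝕝 F]
  [TopologicalSpace F] [IsTopologicalAddGroup F] [ContinuousSMul ℝ F] [LocallyConvexSpace ℝ F]
  [T2Space F] (S : LieGroupStructure 𝕝 K F) {g h : E → K} {U : Set E}

theorem LieGroupStructure.smoothInto_mul (hg : SmoothInto 𝕜 S.atlas g U)
    (hh : SmoothInto 𝕜 S.atlas h U) : SmoothInto 𝕜 S.atlas (fun x => g x * h x) U :=
  letI := S.top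
  have := S.isOpenAtlas
  (hg.prodMk hh).comp_isSmoothMap S.smooth_mul

theorem LieGroupStructure.smoothInto_inv (hg : SmoothInto 𝕜 S.atlas g U) :
    SmoothInto 𝕜 S.atlas (fun x => (g x)⁻¹) U :=
  letI := S.top
  have := S.isOpenAtlas
  hg.comp_isSmoothMap S.smooth_inv

variable {M : Type w} [tM : TopologicalSpace M] (A : Set (PartialEquiv M E)) [IsAtlas A]

theorem LieGroupStructure.isSmoothMap_iff {f : M → K} :
    IsSmoothMap 𝕜 tM A S.top S.atlas f ↔
      ∀ φ ∈ A, SmoothInto 𝕜 S.atlas (fun x => f (φ.symm x)) φ.target :=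
  letI := S.top
  have := S.isOpenAtlas
  isSmoothMap_iff_smoothInto S.compatible

variable (𝕜) in
/-- The group of smooth maps from `M` to the Lie group `K`. -/
def LieGroupStructure.mapSubgroup : Subgroup (M → K) where
  carrier := {f | IsSmoothMap 𝕜 tM A S.top S.atlas f}
  mul_mem' hf hg := (S.isSmoothMap_iff A).2 fun φ hφ =>
    S.smoothInto_mul ((S.isSmoothMap_iff A).1 hf φ hφ) ((S.isSmoothMap_iff A).1 hg φ hφ)
  one_mem' := (S.isSmoothMap_iff A).2 fun φ _ =>
    letI := S.top
    have := S.isOpenAtlas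
    SmoothInto.const 1 φ.target
  inv_mem' hf := (S.isSmoothMap_iff A).2 fun φ hφ =>
    S.smoothInto_inv ((S.isSmoothMap_iff A).1 hf φ hφ)

theorem LieGroupStructure.mem_mapSubgroup {f : M → K} : f ∈ S.mapSubgroup 𝕜 A ↔
    IsSmoothMap 𝕜 tM A S.top S.atlas f := Iff.rfl

end LieGroup

/-! ### Smooth families with values in a Lie group. -/

section GroupFamily

/-- A family of maps `g m : F → K`, defined for `(m, y) ∈ D ⊆ M × F`, which is jointly smooth over
`𝕜` and smooth over `𝕝` for fixed `m`, with respect to the charts in `B`. -/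
structure SmoothGroupFamily (𝕜 𝕝 : Type*) [Semiring 𝕜] [Semiring 𝕝] {M : Type w}
    [TopologicalSpace M]
    {E : Type u} [AddCommGroup E] [Module ℝ E] [Module 𝕜 E] [TopologicalSpace E]
    (A : Set (PartialEquiv M E)) {F : Type v} {H : Type y} {K : Type x}
    [AddCommGroup F] [Module ℝ F] [Module 𝕜 F] [Module 𝕝 F] [TopologicalSpace F]
    [AddCommGroup H] [Module ℝ H] [Module 𝕜 H] [Module 𝕝 H] [TopologicalSpace H]
    (B : Set (PartialEquiv K H)) (g : M → F → K) (D : Set (M × F)) : Prop where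
  isOpen : IsOpen D
  joint : ∀ φ ∈ A, SmoothInto 𝕜 B (fun p : E × F => g (φ.symm p.1) p.2) (chartDomain φ D)
  slice : ∀ m, SmoothInto 𝕝 B (g m) {y | (m, y) ∈ D}

variable {𝕜 𝕝 : Type*} [CommSemiring 𝕜] [CommSemiring 𝕝] [Algebra 𝕜 𝕝]
  {M : Type w} [tM : TopologicalSpace M]
  {E : Type u} [AddCommGroup E] [Module ℝ E] [Module 𝕜 E] [TopologicalSpace E]
  [IsTopologicalAddGroup E] [ContinuousSMul ℝ E]
  {A : Set (PartialEquiv M E)} [IsAtlas A]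
  {F : Type v} [AddCommGroup F] [Module ℝ F] [Module 𝕜 F] [Module 𝕝 F]
  [TopologicalSpace F] [IsTopologicalAddGroup F] [ContinuousSMul ℝ F]
  {H : Type y} [AddCommGroup H] [Module ℝ H] [Module 𝕜 H] [Module 𝕝 H] [IsScalarTower 𝕜 𝕝 H]
  [TopologicalSpace H] [IsTopologicalAddGroup H] [ContinuousSMul ℝ H] [LocallyConvexSpace ℝ H]
  [T2Space H]

theorem SmoothGroupFamily.continuousOn {Y : Type x} [TopologicalSpace Y]
    {B : Set (PartialEquiv Y H)} [IsOpenAtlas B] {g : M → F → Y} {D : Set (M × F)}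
    (hg : SmoothGroupFamily 𝕜 𝕝 A B g D) : ContinuousOn (fun p : M × F => g p.1 p.2) D := by
  rintro ⟨m, y⟩ hmy
  refine ContinuousAt.continuousWithinAt ?_
  obtain ⟨φ, hφ, hm⟩ := IsAtlas.cover (A := A) m
  have hs := (IsAtlas.isOpen_source φ hφ)
  have hc : ContinuousOn (fun p : M × F => (φ p.1, p.2)) (D ∩ φ.source ×ˢ univ) :=
    (((IsAtlas.continuousOn φ hφ).comp continuousOn_fst fun p hp => hp.2.1)).prodMk continuousOn_snd
  have hN : D ∩ φ.source ×ˢ univ ∈ 𝓝 (m, y) :=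
    (hg.isOpen.inter (hs.prod isOpen_univ)).mem_nhds ⟨hmy, hm, trivial⟩
  have h1 := ((hg.joint φ hφ).continuousOn.comp hc fun p hp =>
    ⟨φ.map_source hp.2.1, by simpa [φ.left_inv hp.2.1] using hp.1⟩).continuousAt hN
  refine h1.congr ?_
  filter_upwards [hN] with p hp
  simp [φ.left_inv hp.2.1]

/-- The bridge to push-forwards: reading the family in `ψ` cuts its domain down to the points sent
into `ψ.source`, an open set by joint continuity. -/
theorem SmoothGroupFamily.smoothFamily {Y : Type x} [TopologicalSpace Y]
    {B : Set (PartialEquiv Y H)} [IsOpenAtlas B] {g : M → F → Y} {D : Set (M × F)}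
    (hg : SmoothGroupFamily 𝕜 𝕝 A B g D) {ψ : PartialEquiv Y H} (hψ : IsOpen ψ.source)
    (hc : ∀ e ∈ B, IsSmoothOn 𝕝 (fun x => ψ (e.symm x)) {x | x ∈ e.target ∧ e.symm x ∈ ψ.source}) :
    SmoothFamily 𝕜 𝕝 A (fun m y => ψ (g m y)) {p | p ∈ D ∧ g p.1 p.2 ∈ ψ.source} where
  isOpen := hg.continuousOn.isOpen_inter_preimage hg.isOpen hψ
  joint φ hφ := by
    obtain ⟨O, hO, hOeq⟩ := (hg.joint φ hφ).exists_preimage hψ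
    have hset : chartDomain φ {p : M × F | p ∈ D ∧ g p.1 p.2 ∈ ψ.source} =
        chartDomain φ D ∩ O := by
      rw [← hOeq]
      ext p
      simp [chartDomain, and_assoc]
    rw [hset]
    refine ((hg.joint φ hφ).inter_isOpen hO).isSmoothOn (𝕝 := 𝕝)
      ((chartDomain_accessible hφ hg.isOpen).inter_isOpen hO) hψ hc fun p hp => ?_
    rw [← hOeq] at hp
    exact hp.2
  slice m := by
    obtain ⟨O, hO, hOeq⟩ := (hg.slice m).exists_preimage hψ
    have hset : {y | (m, y) ∈ {p : M × F | p ∈ D ∧ g p.1 p.2 ∈ ψ.source}} =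
        {y | (m, y) ∈ D} ∩ O := by
      rw [← hOeq]
      rfl
    rw [hset]
    refine ((hg.slice m).inter_isOpen hO).isSmoothOn (𝕝 := 𝕝)
      ((hg.isOpen.preimage (Continuous.prodMk_right m)).accessible.inter_isOpen hO) hψ hc
      fun p hp => ?_
    rw [← hOeq] at hp
    exact hp.2

/-- With `L` the identity this describes the inverse of a pushed-forward chart; with `L` a
projection of a product, it gives the two factors of the multiplication. -/
theorem SmoothGroupFamily.chart {Y : Type x} [TopologicalSpace Y]
    {B : Set (PartialEquiv Y H)} [IsOpenAtlas B] {φ : PartialEquiv Y H} (hφ : φ ∈ B)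
    (L : F →L[ℝ] H) (hL : IsLinearMap 𝕜 L) (hL' : IsLinearMap 𝕝 L) :
    SmoothGroupFamily 𝕜 𝕝 A B (fun (_ : M) y => φ.symm (L y)) {p | L p.2 ∈ φ.target} := by
  have hop := IsOpenAtlas.isOpen_target φ hφ
  refine ⟨hop.preimage (L.continuous.comp continuous_snd), fun χ _ => ?_, fun m => ?_⟩
  · refine (smoothInto_symm hφ).comp_continuousLinearMap (L.comp (ContinuousLinearMap.snd ℝ E F))
      (hL.comp (LinearMap.snd 𝕜 E F).isLinear) (fun p hp => hp.2) fun p hp => ?_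
    rw [hop.interior_eq]
    exact (interior_subset hp).2
  · refine (smoothInto_symm hφ).comp_continuousLinearMap L hL' (fun p hp => hp) fun p hp => ?_
    rw [hop.interior_eq]
    exact (interior_subset hp : p ∈ {y : F | L y ∈ φ.target})

variable {K : Type x} [Group K] (S : LieGroupStructure 𝕝 K H) {g h : M → F → K} {D : Set (M × F)}

theorem SmoothGroupFamily.inter {Y : Type x} [TopologicalSpace Y] {B : Set (PartialEquiv Y H)}
    {g : M → F → Y} {D D' : Set (M × F)} (hg : SmoothGroupFamily 𝕜 𝕝 A B g D) (hD' : IsOpen D') :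
    SmoothGroupFamily 𝕜 𝕝 A B g (D ∩ D') := by
  refine ⟨hg.isOpen.inter hD', fun φ hφ => ?_, fun m => ?_⟩
  · obtain ⟨O, hO, hOeq⟩ := exists_chartDomain_eq (IsAtlas.continuousOn_symm φ hφ) hD'
    have : chartDomain φ (D ∩ D') = chartDomain φ D ∩ O := by
      ext p
      have h1 : p ∈ chartDomain φ D' ↔ p ∈ φ.target ×ˢ univ ∩ O := by rw [hOeq]
      simp only [chartDomain, mem_ofPred_eq, mem_inter_iff, mem_prod, mem_univ, and_true] at h1 ⊢
      tauto
    rw [this]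
    exact (hg.joint φ hφ).inter_isOpen hO
  · exact (hg.slice m).inter_isOpen (hD'.preimage (Continuous.prodMk_right m))

theorem SmoothGroupFamily.mul (hg : SmoothGroupFamily 𝕜 𝕝 A S.atlas g D)
    (hh : SmoothGroupFamily 𝕜 𝕝 A S.atlas h D) :
    SmoothGroupFamily 𝕜 𝕝 A S.atlas (fun m y => g m y * h m y) D :=
  ⟨hg.isOpen, fun φ hφ => S.smoothInto_mul (hg.joint φ hφ) (hh.joint φ hφ),
    fun m => S.smoothInto_mul (hg.slice m) (hh.slice m)⟩

theorem SmoothGroupFamily.inv (hg : SmoothGroupFamily 𝕜 𝕝 A S.atlas g D) :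
    SmoothGroupFamily 𝕜 𝕝 A S.atlas (fun m y => (g m y)⁻¹) D :=
  ⟨hg.isOpen, fun φ hφ => S.smoothInto_inv (hg.joint φ hφ),
    fun m => S.smoothInto_inv (hg.slice m)⟩

theorem SmoothGroupFamily.const {a : M → K} (ha : a ∈ S.mapSubgroup 𝕜 A) (hD : IsOpen D) :
    SmoothGroupFamily 𝕜 𝕝 A S.atlas (fun m (_ : F) => a m) D := by
  let := S.top
  have := S.isOpenAtlas
  refine ⟨hD, fun φ hφ => ?_, fun m => SmoothInto.const (a m) _⟩
  refine ((S.isSmoothMap_iff A).1 ha φ hφ).comp_continuousLinearMap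
    (ContinuousLinearMap.fst ℝ E F) (LinearMap.fst 𝕜 E F).isLinear (fun p hp => hp.1)
    fun p hp => ?_
  have h1 : interior (chartDomain φ D) ⊆ interior (φ.target ×ˢ (univ : Set F)) :=
    interior_mono fun p hp => ⟨hp.1, trivial⟩
  rw [interior_prod_univ] at h1
  exact (h1 hp).1

end GroupFamily

/-! ### The maximal atlas generated by an atlas. -/

section OfAtlas

variable {𝕝 : Type*} [CommSemiring 𝕝] {Y : Type w} [tY : TopologicalSpace Y] {F : Type v}
  [AddCommGroup F] [Module ℝ F] [Module 𝕝 F]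
  [TopologicalSpace F] [IsTopologicalAddGroup F] [ContinuousSMul ℝ F] [LocallyConvexSpace ℝ F]
  [T2Space F] {B : Set (PartialEquiv Y F)} [IsOpenAtlas B]

instance IsOpenAtlas.isAtlas : IsAtlas B where
  accessible φ hφ := (IsOpenAtlas.isOpen_target φ hφ).accessible
  isOpen_source := IsOpenAtlas.isOpen_source
  continuousOn := IsOpenAtlas.continuousOn
  continuousOn_symm := IsOpenAtlas.continuousOn_symm
  cover := IsOpenAtlas.cover

theorem IsOpenAtlas.isChart {e : PartialEquiv Y F} (he : e ∈ B) : IsChart tY univ e where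
  isOpen_source := IsOpenAtlas.isOpen_source e he
  target_eq := ⟨e.target, IsOpenAtlas.isOpen_target e he, (inter_univ _).symm⟩
  continuousOn := IsOpenAtlas.continuousOn e he
  continuousOn_symm := IsOpenAtlas.continuousOn_symm e he

/-- Two charts compatible with the generating atlas are compared by passing through it; this is the
first half of that passage and `SmoothInto.isSmoothOn_preimage` the second. -/
theorem smoothInto_symm_of_smoothChange {ρ : PartialEquiv Y F} (hρ : IsChart tY univ ρ)
    (h : ∀ e ∈ B, SmoothChange 𝕝 ρ e) : SmoothInto 𝕝 B ρ.symm ρ.target := by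
  intro x hx
  obtain ⟨e, he, hxe⟩ := IsOpenAtlas.cover (B := B) (ρ.symm x)
  have hO : IsOpen (ρ.target ∩ ρ.symm ⁻¹' e.source) :=
    hρ.continuousOn_symm.isOpen_inter_preimage hρ.isOpen_target (IsOpenAtlas.isOpen_source e he)
  refine ⟨_, hO, ⟨hx, hxe⟩, e, he, fun y hy => hy.2.2, ?_⟩
  rw [← inter_assoc, inter_self]
  exact h e he

theorem SmoothInto.isSmoothOn_preimage {E : Type u} [AddCommGroup E] [Module ℝ E] [Module 𝕝 E]
    [TopologicalSpace E] [IsTopologicalAddGroup E] [ContinuousSMul ℝ E] {g : E → Y} {U : Set E}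
    (hg : SmoothInto 𝕝 B g U) (hU : Accessible U) {σ : PartialEquiv Y F} (hσ : IsOpen σ.source)
    (h : ∀ e ∈ B, SmoothChange 𝕝 e σ) :
    IsSmoothOn 𝕝 (fun x => σ (g x)) {x | x ∈ U ∧ g x ∈ σ.source} := by
  obtain ⟨O, hO, hOeq⟩ := hg.exists_preimage hσ
  rw [hOeq]
  refine (hg.inter_isOpen hO).isSmoothOn (𝕝 := 𝕝) (hU.inter_isOpen hO) hσ h fun y hy => ?_
  rw [← hOeq] at hy
  exact hy.2

/-- The maximal atlas generated by a smooth atlas. -/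
def ManifoldStructure.ofAtlas [T2Space Y] (B : Set (PartialEquiv Y F)) [IsOpenAtlas B]
    (hB : ∀ e ∈ B, ∀ e' ∈ B, SmoothChange 𝕝 e e') : ManifoldStructure 𝕝 Y F univ where
  top := tY
  t2 := inferInstance
  atlas := {ρ | IsChart tY univ ρ ∧ ∀ e ∈ B, SmoothChange 𝕝 e ρ ∧ SmoothChange 𝕝 ρ e}
  isChart ρ hρ := hρ.1
  cover m := by
    obtain ⟨e, he, hm⟩ := IsOpenAtlas.cover (B := B) m
    exact ⟨e, ⟨IsOpenAtlas.isChart he, fun e' he' => ⟨hB e' he' e he, hB e he e' he'⟩⟩, hm⟩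
  compatible ρ hρ σ hσ :=
    (smoothInto_symm_of_smoothChange hρ.1 fun e he => (hρ.2 e he).2).isSmoothOn_preimage
      hρ.1.isOpen_target.accessible hσ.1.isOpen_source fun e he => (hσ.2 e he).1
  maximal ρ hρ h := ⟨hρ, fun e he =>
    h e ⟨IsOpenAtlas.isChart he, fun e' he' => ⟨hB e' he' e he, hB e he e' he'⟩⟩⟩

theorem ManifoldStructure.subset_ofAtlas [T2Space Y]
    (hB : ∀ e ∈ B, ∀ e' ∈ B, SmoothChange 𝕝 e e') :
    B ⊆ (ManifoldStructure.ofAtlas B hB).atlas := fun e he =>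
  ⟨IsOpenAtlas.isChart he, fun e' he' => ⟨hB e' he' e he, hB e he e' he'⟩⟩

theorem IsSmoothMap.of_base {Z : Type x} [tZ : TopologicalSpace Z] {H : Type y}
    [AddCommGroup H] [Module ℝ H] [Module 𝕝 H] [TopologicalSpace H] [IsTopologicalAddGroup H]
    [ContinuousSMul ℝ H] [LocallyConvexSpace ℝ H] [T2Space H]
    {C : Set (PartialEquiv Z H)} [IsOpenAtlas C] {f : Y → Z} (hf : IsSmoothMap 𝕝 tY B tZ C f)
    {B' : Set (PartialEquiv Y F)} {C' : Set (PartialEquiv Z H)}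
    (hB' : ∀ ρ ∈ B', IsOpen ρ.target ∧ SmoothInto 𝕝 B ρ.symm ρ.target)
    (hC' : ∀ σ ∈ C', IsOpen σ.source ∧ ∀ e ∈ C, SmoothChange 𝕝 e σ) :
    IsSmoothMap 𝕝 tY B' tZ C' f :=
  ⟨hf.continuous, fun ρ hρ σ hσ => ((hB' ρ hρ).2.comp_isSmoothMap hf).isSmoothOn_preimage
    (hB' ρ hρ).1.accessible (hC' σ hσ).1 (hC' σ hσ).2⟩

end OfAtlas

/-! ### Manifold structures are determined by covering charts. -/

section Uniqueness

variable {𝕝 : Type*} [CommSemiring 𝕝] {Y : Type w} {F : Type v}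
  [AddCommGroup F] [Module ℝ F] [Module 𝕝 F]
  [TopologicalSpace F] [IsTopologicalAddGroup F] [ContinuousSMul ℝ F] [LocallyConvexSpace ℝ F]
  [T2Space F]

/-- A chart carries a `t₁`-open set to an open set of the model space, and the same chart pulls it
back to a `t₂`-open set. -/
theorem isOpen_of_common_charts {t₁ t₂ : TopologicalSpace Y} {B : Set (PartialEquiv Y F)}
    (h₁ : ∀ e ∈ B, IsChart t₁ univ e) (h₂ : ∀ e ∈ B, IsChart t₂ univ e)
    (hc : ∀ y : Y, ∃ e ∈ B, y ∈ e.source) : t₂ ≤ t₁ := by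
  intro s hs
  refine (@isOpen_iff_mem_nhds Y t₂ s).2 fun y hy => ?_
  obtain ⟨e, he, hye⟩ := hc y
  have h3 : IsOpen (e.target ∩ e.symm ⁻¹' s) :=
    @ContinuousOn.isOpen_inter_preimage F Y _ t₁ _ _ _ (h₁ e he).continuousOn_symm
      (h₁ e he).isOpen_target hs
  let := t₂
  have h4 : IsOpen (e.source ∩ e ⁻¹' (e.target ∩ e.symm ⁻¹' s)) :=
    @ContinuousOn.isOpen_inter_preimage Y F t₂ _ _ _ _ (h₂ e he).continuousOn
      (h₂ e he).isOpen_source h3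
  refine mem_of_superset (IsOpen.mem_nhds h4
    ⟨hye, e.map_source hye, by simpa [e.left_inv hye] using hy⟩) ?_
  rintro z ⟨hz, -, hz'⟩
  simpa [e.left_inv hz] using hz'

/-- A chart of `S₁` and a chart of `S₂` are compatible through the common charts `B`, so maximality
of `S₂` absorbs the former. -/
theorem ManifoldStructure.atlas_subset {S₁ S₂ : ManifoldStructure 𝕝 Y F univ}
    (ht : S₁.top = S₂.top)
    {B : Set (PartialEquiv Y F)} (h₁ : B ⊆ S₁.atlas) (h₂ : B ⊆ S₂.atlas)
    (hc : ∀ y : Y, ∃ e ∈ B, y ∈ e.source) : S₁.atlas ⊆ S₂.atlas := by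
  let := S₁.top
  have hB : IsOpenAtlas B :=
    { isOpen_source := fun φ hφ => (S₁.isChart φ (h₁ hφ)).isOpen_source
      isOpen_target := fun φ hφ => (S₁.isChart φ (h₁ hφ)).isOpen_target
      continuousOn := fun φ hφ => (S₁.isChart φ (h₁ hφ)).continuousOn
      continuousOn_symm := fun φ hφ => (S₁.isChart φ (h₁ hφ)).continuousOn_symm
      cover := hc }
  intro ρ hρ
  have hρc := S₁.isChart ρ hρ
  refine S₂.maximal ρ (ht ▸ hρc) fun σ hσ => ?_
  have hσc : IsChart S₁.top univ σ := ht ▸ S₂.isChart σ hσ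
  exact ⟨(smoothInto_symm_of_smoothChange hσc fun e he =>
      S₂.compatible σ hσ e (h₂ he)).isSmoothOn_preimage hσc.isOpen_target.accessible
        hρc.isOpen_source fun e he => S₁.compatible e (h₁ he) ρ hρ,
    (smoothInto_symm_of_smoothChange hρc fun e he =>
      S₁.compatible ρ hρ e (h₁ he)).isSmoothOn_preimage hρc.isOpen_target.accessible
        hσc.isOpen_source fun e he => S₂.compatible e (h₂ he) σ hσ⟩

/-- A manifold structure is determined by any family of charts covering the manifold. -/
theorem ManifoldStructure.eq_of_subset {S₁ S₂ : ManifoldStructure 𝕝 Y F univ}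
    {B : Set (PartialEquiv Y F)} (h₁ : B ⊆ S₁.atlas) (h₂ : B ⊆ S₂.atlas)
    (hc : ∀ y : Y, ∃ e ∈ B, y ∈ e.source) : S₁ = S₂ := by
  have ht : S₁.top = S₂.top := le_antisymm
    (isOpen_of_common_charts (fun e he => S₂.isChart e (h₂ he))
      (fun e he => S₁.isChart e (h₁ he)) hc)
    (isOpen_of_common_charts (fun e he => S₁.isChart e (h₁ he))
      (fun e he => S₂.isChart e (h₂ he)) hc)
  have ha : S₁.atlas = S₂.atlas := Subset.antisymm
    (ManifoldStructure.atlas_subset ht h₁ h₂ hc)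
    (ManifoldStructure.atlas_subset ht.symm h₂ h₁ hc)
  cases S₁
  cases S₂
  simp only at ht ha
  subst ht ha
  rfl

theorem LieGroupStructure.eq_of_subset {G : Type w} [Group G] {S₁ S₂ : LieGroupStructure 𝕝 G F}
    {B : Set (PartialEquiv G F)} (h₁ : B ⊆ S₁.atlas) (h₂ : B ⊆ S₂.atlas)
    (hc : ∀ y : G, ∃ e ∈ B, y ∈ e.source) : S₁ = S₂ := by
  have h := ManifoldStructure.eq_of_subset h₁ h₂ hc
  cases S₁
  cases S₂
  simp only at h
  subst h
  rfl

end Uniqueness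

/-! ### Pushed-forward charts and their left translates. -/

section PushChart

variable {𝕜 𝕝 : Type*} [CommSemiring 𝕜] [CommSemiring 𝕝] [Algebra 𝕜 𝕝]
  {M : Type w} [tM : TopologicalSpace M]
  {E : Type u} [AddCommGroup E] [Module ℝ E] [Module 𝕜 E] [TopologicalSpace E]
  [IsTopologicalAddGroup E] [ContinuousSMul ℝ E]
  {A : Set (PartialEquiv M E)} [IsAtlas A]
  {H : Type v} [AddCommGroup H] [Module ℝ H] [Module 𝕜 H] [Module 𝕝 H] [IsScalarTower 𝕜 𝕝 H]
  [TopologicalSpace H] [IsTopologicalAddGroup H] [ContinuousSMul ℝ H] [LocallyConvexSpace ℝ H]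
  [T2Space H] {K : Type x} [Group K] (S : LieGroupStructure 𝕝 K H)
  {φ : PartialEquiv K H} (hφ : φ ∈ S.atlas)

include hφ

theorem LieGroupStructure.isSmoothOn_chart_comp {γ : M → K} (hγ : γ ∈ S.mapSubgroup 𝕜 A)
    (h : ∀ m, γ m ∈ φ.source) (χ : PartialEquiv M E) (hχ : χ ∈ A) :
    IsSmoothOn 𝕜 (fun x => φ (γ (χ.symm x))) χ.target := by
  let := S.top
  have := S.isOpenAtlas
  exact ((S.isSmoothMap_iff A).1 hγ χ hχ).isSmoothOn (𝕝 := 𝕝) (IsAtlas.accessible χ hχ)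
    (S.isChart φ hφ).isOpen_source (fun e he => S.compatible e he φ hφ) fun x _ => h _

theorem LieGroupStructure.symm_comp_mem {ξ : SmoothFun 𝕜 A H} (h : ∀ m, ξ.1 m ∈ φ.target) :
    (fun m => φ.symm (ξ.1 m)) ∈ S.mapSubgroup 𝕜 A := by
  let := S.top
  have := S.isOpenAtlas
  refine (S.isSmoothMap_iff A).2 fun χ hχ => ?_
  refine (smoothInto_symm hφ).comp_isSmoothOn (ξ.2 χ hχ) (fun x _ => h _) fun x _ => ?_
  rw [(S.isChart φ hφ).isOpen_target.interior_eq]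
  exact h _

open Classical in
variable (𝕜 A) in
/-- The map `γ ↦ φ ∘ γ`, extended by zero. -/
noncomputable def LieGroupStructure.pushFun (γ : S.mapSubgroup 𝕜 A) : SmoothFun 𝕜 A H :=
  if h : ∀ m, γ.1 m ∈ φ.source then
    ⟨fun m => φ (γ.1 m), S.isSmoothOn_chart_comp hφ γ.2 h⟩ else 0

open Classical in
/-- The map `ξ ↦ φ⁻¹ ∘ ξ`, extended by the neutral element. -/
noncomputable def LieGroupStructure.pullFun (ξ : SmoothFun 𝕜 A H) : S.mapSubgroup 𝕜 A :=
  if h : ∀ m, ξ.1 m ∈ φ.target then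
    ⟨fun m => φ.symm (ξ.1 m), S.symm_comp_mem hφ h⟩ else 1

theorem LieGroupStructure.pushFun_apply {γ : S.mapSubgroup 𝕜 A} (h : ∀ m, γ.1 m ∈ φ.source)
    (m : M) : (S.pushFun 𝕜 A hφ γ).1 m = φ (γ.1 m) := by
  have h1 : S.pushFun 𝕜 A hφ γ = ⟨fun m => φ (γ.1 m), S.isSmoothOn_chart_comp hφ γ.2 h⟩ :=
    dif_pos h
  rw [h1]

theorem LieGroupStructure.pullFun_apply {ξ : SmoothFun 𝕜 A H} (h : ∀ m, ξ.1 m ∈ φ.target)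
    (m : M) : (S.pullFun hφ ξ).1 m = φ.symm (ξ.1 m) := by
  have h1 : S.pullFun hφ ξ = ⟨fun m => φ.symm (ξ.1 m), S.symm_comp_mem hφ h⟩ := dif_pos h
  rw [h1]

variable (𝕜 A) in
/-- The push-forward `γ ↦ φ ∘ γ` of a chart. -/
noncomputable def LieGroupStructure.pushChart :
    PartialEquiv (S.mapSubgroup 𝕜 A) (SmoothFun 𝕜 A H) where
  toFun := S.pushFun 𝕜 A hφ
  invFun := S.pullFun hφ
  source := {γ | ∀ m, γ.1 m ∈ φ.source}
  target := {ξ | ∀ m, ξ.1 m ∈ φ.target}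
  map_source' γ hγ m := by
    rw [S.pushFun_apply hφ hγ]
    exact φ.map_source (hγ m)
  map_target' ξ hξ m := by
    rw [S.pullFun_apply hφ hξ]
    exact φ.map_target (hξ m)
  left_inv' γ hγ := by
    have h : ∀ m, (S.pushFun 𝕜 A hφ γ).1 m ∈ φ.target := fun m => by
      rw [S.pushFun_apply hφ hγ]
      exact φ.map_source (hγ m)
    refine Subtype.ext (funext fun m => ?_)
    rw [S.pullFun_apply hφ h, S.pushFun_apply hφ hγ, φ.left_inv (hγ m)]
  right_inv' ξ hξ := by
    have h : ∀ m, (S.pullFun hφ ξ).1 m ∈ φ.source := fun m => by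
      rw [S.pullFun_apply hφ hξ]
      exact φ.map_target (hξ m)
    refine Subtype.ext (funext fun m => ?_)
    rw [S.pushFun_apply hφ h, S.pullFun_apply hφ hξ, φ.right_inv (hξ m)]

theorem LieGroupStructure.pushChart_apply {γ : S.mapSubgroup 𝕜 A} (h : ∀ m, γ.1 m ∈ φ.source)
    (m : M) : (S.pushChart 𝕜 A hφ γ).1 m = φ (γ.1 m) := S.pushFun_apply hφ h m

theorem LieGroupStructure.pushChart_symm_apply {ξ : SmoothFun 𝕜 A H}
    (h : ∀ m, ξ.1 m ∈ φ.target) (m : M) :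
    ((S.pushChart 𝕜 A hφ).symm ξ).1 m = φ.symm (ξ.1 m) := S.pullFun_apply hφ h m

theorem LieGroupStructure.isPushForward_pushChart :
    IsPushForward 𝕜 φ (S.pushChart 𝕜 A hφ) :=
  ⟨rfl, rfl, fun _ hγ m => S.pushChart_apply hφ hγ m⟩

variable (𝕜 A) in
/-- The left translate of the push-forward of a chart. -/
noncomputable def LieGroupStructure.leftChart (a : S.mapSubgroup 𝕜 A) :
    PartialEquiv (S.mapSubgroup 𝕜 A) (SmoothFun 𝕜 A H) :=
  (Equiv.mulLeft a⁻¹).transPartialEquiv (S.pushChart 𝕜 A hφ)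

theorem LieGroupStructure.leftChart_one :
    S.leftChart 𝕜 A hφ 1 = S.pushChart 𝕜 A hφ := by
  refine PartialEquiv.ext (fun γ => ?_) (fun ξ => ?_) ?_
  · simp [LieGroupStructure.leftChart]
  · simp [LieGroupStructure.leftChart]
    rfl
  · ext γ
    simp [LieGroupStructure.leftChart]

theorem LieGroupStructure.mem_leftChart_source {a γ : S.mapSubgroup 𝕜 A} :
    γ ∈ (S.leftChart 𝕜 A hφ a).source ↔ ∀ m, (a.1 m)⁻¹ * γ.1 m ∈ φ.source := Iff.rfl

theorem LieGroupStructure.mem_leftChart_source_self (h1 : (1 : K) ∈ φ.source)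
    (a : S.mapSubgroup 𝕜 A) : a ∈ (S.leftChart 𝕜 A hφ a).source := by
  rw [S.mem_leftChart_source hφ]
  intro m
  rwa [inv_mul_cancel]

theorem LieGroupStructure.leftChart_apply {a γ : S.mapSubgroup 𝕜 A}
    (h : γ ∈ (S.leftChart 𝕜 A hφ a).source) (m : M) :
    (S.leftChart 𝕜 A hφ a γ).1 m = φ ((a.1 m)⁻¹ * γ.1 m) :=
  S.pushChart_apply hφ (γ := a⁻¹ * γ) h m

theorem LieGroupStructure.leftChart_symm_apply {a : S.mapSubgroup 𝕜 A} {ξ : SmoothFun 𝕜 A H}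
    (h : ∀ m, ξ.1 m ∈ φ.target) (m : M) :
    ((S.leftChart 𝕜 A hφ a).symm ξ).1 m = a.1 m * φ.symm (ξ.1 m) := by
  have h1 : (S.leftChart 𝕜 A hφ a).symm ξ = a * (S.pushChart 𝕜 A hφ).symm ξ := by
    simp [LieGroupStructure.leftChart]
  rw [h1]
  exact congrArg (a.1 m * ·) (S.pushChart_symm_apply hφ h m)

end PushChart

/-! ### Lie groups from atlases, and translated charts. -/

section LieGroupAtlas

variable {𝕝 : Type*} [CommSemiring 𝕝] {G : Type w} [Group G] {F : Type v}
  [AddCommGroup F] [Module ℝ F] [Module 𝕝 F]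
  [TopologicalSpace F] [IsTopologicalAddGroup F] [ContinuousSMul ℝ F] [LocallyConvexSpace ℝ F]
  [T2Space F]

/-- The Lie group structure generated by a smooth atlas for which the group operations are
smooth. -/
def LieGroupStructure.ofAtlas [tG : TopologicalSpace G] [T2Space G] (B : Set (PartialEquiv G F))
    [IsOpenAtlas B] (hB : ∀ e ∈ B, ∀ e' ∈ B, SmoothChange 𝕝 e e')
    (hmul : IsSmoothMap 𝕝 instTopologicalSpaceProd (Set.image2 (fun φ ψ => φ.prod ψ) B B) tG B
      (fun p : G × G => p.1 * p.2))
    (hinv : IsSmoothMap 𝕝 tG B tG B (fun g : G => g⁻¹)) : LieGroupStructure 𝕝 G F where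
  toManifoldStructure := ManifoldStructure.ofAtlas B hB
  smooth_mul := by
    refine hmul.of_base ?_ fun σ hσ => ⟨hσ.1.isOpen_source, fun e he => (hσ.2 e he).1⟩
    rintro _ ⟨σ, hσ, σ', hσ', rfl⟩
    have h1 := smoothInto_symm_of_smoothChange hσ.1 fun e he => (hσ.2 e he).2
    have h2 := smoothInto_symm_of_smoothChange hσ'.1 fun e he => (hσ'.2 e he).2
    refine ⟨hσ.1.isOpen_target.prod hσ'.1.isOpen_target, SmoothInto.prodMk
      (h1.comp_continuousLinearMap (ContinuousLinearMap.fst ℝ F F)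
        (LinearMap.fst 𝕝 F F).isLinear (fun p hp => hp.1) fun p hp => ?_)
      (h2.comp_continuousLinearMap (ContinuousLinearMap.snd ℝ F F)
        (LinearMap.snd 𝕝 F F).isLinear (fun p hp => hp.2) fun p hp => ?_)⟩
    · rw [hσ.1.isOpen_target.interior_eq]
      exact (interior_subset hp).1
    · rw [hσ'.1.isOpen_target.interior_eq]
      exact (interior_subset hp).2
  smooth_inv := hinv.of_base
    (fun σ hσ => ⟨hσ.1.isOpen_target,
      smoothInto_symm_of_smoothChange hσ.1 fun e he => (hσ.2 e he).2⟩)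
    fun σ hσ => ⟨hσ.1.isOpen_source, fun e he => (hσ.2 e he).1⟩

theorem LieGroupStructure.isSmoothMap_mul_left (S : LieGroupStructure 𝕝 G F) (a : G) :
    IsSmoothMap 𝕝 S.top S.atlas S.top S.atlas fun g => a * g := by
  let := S.top
  have := S.isOpenAtlas
  exact (S.isSmoothMap_iff S.atlas).2 fun e he =>
    S.smoothInto_mul (SmoothInto.const a _) (smoothInto_symm he)

/-- Left translates of charts are charts. -/
theorem LieGroupStructure.mem_atlas_of_eqOn (S : LieGroupStructure 𝕝 G F) {Φ ρ : PartialEquiv G F}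
    (hΦ : Φ ∈ S.atlas) (a : G) (hs : ρ.source = {g | a⁻¹ * g ∈ Φ.source})
    (ht : ρ.target = Φ.target) (he : ∀ g ∈ ρ.source, ρ g = Φ (a⁻¹ * g))
    (he' : ∀ y ∈ ρ.target, ρ.symm y = a * Φ.symm y) : ρ ∈ S.atlas := by
  let := S.top
  have hc := S.isChart Φ hΦ
  have hl := S.isSmoothMap_mul_left
  -- `ρ` is `Φ` after the diffeomorphism `g ↦ a⁻¹ * g`. Values are compared on source and target
  -- only, since a partial equivalence is arbitrary elsewhere.
  refine S.maximal ρ ⟨?_, ?_, ?_, ?_⟩ fun χ hχ => ⟨?_, ?_⟩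
  · rw [hs]
    exact hc.isOpen_source.preimage (hl a⁻¹).continuous
  · rw [ht]
    exact hc.target_eq
  · refine ContinuousOn.congr (f := fun g => Φ (a⁻¹ * g)) ?_ he
    exact hc.continuousOn.comp (hl a⁻¹).continuous.continuousOn fun g hg => by
      rw [hs] at hg
      exact hg
  · refine ContinuousOn.congr (f := fun y => a * Φ.symm y) ?_ he'
    rw [ht]
    exact (hl a).continuous.comp_continuousOn hc.continuousOn_symm
  · have h1 := (hl a⁻¹).smooth χ hχ Φ hΦ
    have h2 : {x | x ∈ χ.target ∧ χ.symm x ∈ ρ.source} =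
        {x | x ∈ χ.target ∧ a⁻¹ * χ.symm x ∈ Φ.source} := by
      rw [hs]
      rfl
    rw [← h2] at h1
    exact h1.congr fun x hx => (he _ hx.2).symm
  · have h1 := (hl a).smooth Φ hΦ χ hχ
    have h2 : {x | x ∈ ρ.target ∧ ρ.symm x ∈ χ.source} =
        {x | x ∈ Φ.target ∧ a * Φ.symm x ∈ χ.source} := by
      ext x
      constructor
      · rintro ⟨h3, h4⟩
        exact ⟨ht ▸ h3, he' x h3 ▸ h4⟩
      · rintro ⟨h3, h4⟩
        have h3' : x ∈ ρ.target := ht ▸ h3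
        exact ⟨h3', by rw [he' x h3']; exact h4⟩
    rw [SmoothChange, h2]
    refine h1.congr fun x hx => ?_
    rw [← h2] at hx
    simp only [he' x hx.1]

end LieGroupAtlas

/-! ### The Lie group structure on the group of smooth maps. -/

section MapGroup

variable {𝕜 𝕝 : Type*} [CommSemiring 𝕜] [CommSemiring 𝕝] [Algebra 𝕜 𝕝]
  {M : Type w} [tM : TopologicalSpace M] [CompactSpace M] [T2Space M]
  {E : Type u} [AddCommGroup E] [Module ℝ E] [Module 𝕜 E] [TopologicalSpace E]
  [IsTopologicalAddGroup E] [ContinuousSMul ℝ E] [LocallyConvexSpace ℝ E] [T2Space E]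
  {A : Set (PartialEquiv M E)} [IsAtlas A]
  {H : Type v} [AddCommGroup H] [Module ℝ H] [Module 𝕜 H] [Module 𝕝 H] [IsScalarTower 𝕜 𝕝 H]
  [TopologicalSpace H] [IsTopologicalAddGroup H] [ContinuousSMul ℝ H] [LocallyConvexSpace ℝ H]
  [T2Space H] [SMulCommClass 𝕜 ℝ H] [ContinuousConstSMul 𝕜 H] [SMulCommClass ℝ 𝕜 H]
  [ContinuousConstSMul 𝕝 H] [SMulCommClass ℝ 𝕝 H] [SMulCommClass 𝕜 𝕝 H]
  {K : Type x} [Group K] (S : LieGroupStructure 𝕝 K H)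
  {φ : PartialEquiv K H} (hφ : φ ∈ S.atlas)

section Family

variable {F : Type y} [AddCommGroup F] [Module ℝ F] [Module 𝕜 F] [Module 𝕝 F]
  [TopologicalSpace F] [IsTopologicalAddGroup F] [ContinuousSMul ℝ F] [LocallyConvexSpace ℝ F]
  [T2Space F] [SMulCommClass 𝕜 ℝ F] [SMulCommClass 𝕜 𝕝 F] [SMulCommClass ℝ 𝕝 F]
  [ContinuousConstSMul 𝕝 F]
  {X : Type*} [AddCommGroup X] [Module ℝ X] [Module 𝕝 X] [TopologicalSpace X]
  [IsTopologicalAddGroup X] [ContinuousSMul ℝ X]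
  {j : X →L[ℝ] SmoothFun 𝕜 A F} (hj : IsLinearMap 𝕝 j) {g : M → F → K} {D : Set (M × F)}
  (hg : SmoothGroupFamily 𝕜 𝕝 A S.atlas g D) {T : X → S.mapSubgroup 𝕜 A}
  (hT : ∀ x, (∀ m, (m, (j x).1 m) ∈ D) → ∀ m, (T x).1 m = g m ((j x).1 m))

include hj hg hT

/-- In the chart at `b`, the map `T` is the push-forward of the family `φ ((b m)⁻¹ * g m y)`. No
topology on the mapping group is used, so the result may serve to define it. -/
theorem LieGroupStructure.isSmoothOn_leftChart (b : S.mapSubgroup 𝕜 A) :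
    IsOpen {x | (∀ m, (m, (j x).1 m) ∈ D) ∧ T x ∈ (S.leftChart 𝕜 A hφ b).source} ∧
    IsSmoothOn 𝕝 (fun x => S.leftChart 𝕜 A hφ b (T x))
      {x | (∀ m, (m, (j x).1 m) ∈ D) ∧ T x ∈ (S.leftChart 𝕜 A hφ b).source} := by
  let := S.top
  have := S.isOpenAtlas
  have hb := (SmoothGroupFamily.const S (𝕝 := 𝕝) (inv_mem b.2) hg.isOpen).mul S hg
  have hf := hb.smoothFamily (S.isChart φ hφ).isOpen_source fun e he => S.compatible e he φ hφ
  have hset : {x | (∀ m, (m, (j x).1 m) ∈ D) ∧ T x ∈ (S.leftChart 𝕜 A hφ b).source} =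
      {x | ∀ m, (m, (j x).1 m) ∈ {p : M × F | p ∈ D ∧ (b.1⁻¹) p.1 * g p.1 p.2 ∈ φ.source}} := by
    ext x
    constructor
    · rintro ⟨h1, h2⟩ m
      refine ⟨h1 m, ?_⟩
      have := (S.mem_leftChart_source hφ).1 h2 m
      rwa [hT x h1] at this
    · intro h
      have h1 : ∀ m, (m, (j x).1 m) ∈ D := fun m => (h m).1
      refine ⟨h1, (S.mem_leftChart_source hφ).2 fun m => ?_⟩
      rw [hT x h1]
      exact (h m).2
  have hs := hf.isSmoothOn_push j hj
  have ho := hf.isOpen_setOf_forall_mem j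
  rw [hset]
  refine ⟨ho, hs.congr fun x hx => SmoothFun.ext fun m => ?_⟩
  rw [hf.push_val hx]
  have hx' := hx
  rw [← hset] at hx'
  rw [S.leftChart_apply hφ hx'.2, hT x hx'.1]
  rfl

theorem LieGroupStructure.smoothInto_leftChart (h1 : (1 : K) ∈ φ.source) :
    SmoothInto 𝕝 (range (S.leftChart 𝕜 A hφ)) T {x | ∀ m, (m, (j x).1 m) ∈ D} := by
  intro x hx
  obtain ⟨ho, hs⟩ := S.isSmoothOn_leftChart hφ hj hg hT (T x)
  refine ⟨_, ho, ⟨hx, S.mem_leftChart_source_self hφ h1 _⟩, _, mem_range_self (T x),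
    fun y hy => hy.2.2, ?_⟩
  rwa [inter_eq_self_of_subset_right fun y hy => hy.1]

end Family

include hφ

/-- The family of maps describing the inverse of `LieGroupStructure.leftChart`. -/
theorem LieGroupStructure.smoothGroupFamily_leftChart {F : Type y} [AddCommGroup F] [Module ℝ F]
    [Module 𝕜 F] [Module 𝕝 F] [TopologicalSpace F] [IsTopologicalAddGroup F] [ContinuousSMul ℝ F]
    (L : F →L[ℝ] H) (hL : IsLinearMap 𝕜 L) (hL' : IsLinearMap 𝕝 L) (a : S.mapSubgroup 𝕜 A) :
    SmoothGroupFamily 𝕜 𝕝 A S.atlas (fun m y => a.1 m * φ.symm (L y))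
      {p | L p.2 ∈ φ.target} := by
  let := S.top
  have := S.isOpenAtlas
  have h := SmoothGroupFamily.chart (𝕜 := 𝕜) (𝕝 := 𝕝) (A := A) hφ L hL hL'
  exact (SmoothGroupFamily.const S a.2 h.isOpen).mul S h

/-- The special case in which `T` is the inverse of the chart at `a`. The openness feeds
`ChartedSpaceCore`, which builds the topology. -/
theorem LieGroupStructure.leftChart_change (a b : S.mapSubgroup 𝕜 A) :
    IsOpen {ξ | ξ ∈ (S.leftChart 𝕜 A hφ a).target ∧
      (S.leftChart 𝕜 A hφ a).symm ξ ∈ (S.leftChart 𝕜 A hφ b).source} ∧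
    SmoothChange 𝕝 (S.leftChart 𝕜 A hφ a) (S.leftChart 𝕜 A hφ b) :=
  S.isSmoothOn_leftChart hφ (j := ContinuousLinearMap.id ℝ (SmoothFun 𝕜 A H))
    (LinearMap.id : SmoothFun 𝕜 A H →ₗ[𝕝] SmoothFun 𝕜 A H).isLinear
    (S.smoothGroupFamily_leftChart hφ (ContinuousLinearMap.id ℝ H)
      (LinearMap.id : H →ₗ[𝕜] H).isLinear (LinearMap.id : H →ₗ[𝕝] H).isLinear a)
    (fun _ h m => S.leftChart_symm_apply hφ h m) b

variable (h1 : (1 : K) ∈ φ.source)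

variable (𝕜 A) in
/-- The charts `LieGroupStructure.leftChart` as a `ChartedSpaceCore`. -/
noncomputable def LieGroupStructure.mapCore :
    ChartedSpaceCore (SmoothFun 𝕜 A H) (S.mapSubgroup 𝕜 A) where
  atlas := range (S.leftChart 𝕜 A hφ)
  chartAt := S.leftChart 𝕜 A hφ
  mem_chart_source := S.mem_leftChart_source_self hφ h1
  chart_mem_atlas := mem_range_self
  open_source := by
    rintro _ _ ⟨a, rfl⟩ ⟨b, rfl⟩
    exact (S.leftChart_change hφ a b).1
  continuousOn_toFun := by
    rintro _ _ ⟨a, rfl⟩ ⟨b, rfl⟩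
    exact (S.leftChart_change hφ a b).2.continuousOn

variable (𝕜 A) in
/-- The topology on the group of smooth maps. -/
@[reducible] noncomputable def LieGroupStructure.mapTop :
    TopologicalSpace (S.mapSubgroup 𝕜 A) :=
  (S.mapCore 𝕜 A hφ h1).toTopologicalSpace

theorem LieGroupStructure.isOpenAtlas_leftChart :
    @IsOpenAtlas _ _ (S.mapTop 𝕜 A hφ h1) _ (range (S.leftChart 𝕜 A hφ)) :=
  letI := S.mapTop 𝕜 A hφ h1
  { isOpen_source := fun _ he => (S.mapCore 𝕜 A hφ h1).open_source' he
    isOpen_target := fun _ he => (S.mapCore 𝕜 A hφ h1).open_target he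
    continuousOn := fun e he =>
      ((S.mapCore 𝕜 A hφ h1).openPartialHomeomorph e he).continuousOn_toFun
    continuousOn_symm := fun e he =>
      ((S.mapCore 𝕜 A hφ h1).openPartialHomeomorph e he).continuousOn_invFun
    cover := fun a => ⟨_, mem_range_self a, S.mem_leftChart_source_self hφ h1 a⟩ }

theorem LieGroupStructure.continuous_eval_mapTop (m : M) :
    Continuous[S.mapTop 𝕜 A hφ h1, S.top] fun γ : S.mapSubgroup 𝕜 A => γ.1 m := by
  have hA := S.isOpenAtlas_leftChart (𝕜 := 𝕜) (A := A) hφ h1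
  let t1 := S.mapTop 𝕜 A hφ h1
  let t2 := S.top
  have := S.isOpenAtlas
  refine continuous_of_charts (A := range (S.leftChart 𝕜 A hφ)) ?_
  rintro _ ⟨a, rfl⟩
  have h2 := (S.smoothGroupFamily_leftChart (𝕜 := 𝕜) (A := A) hφ (ContinuousLinearMap.id ℝ H)
      (LinearMap.id : H →ₗ[𝕜] H).isLinear (LinearMap.id : H →ₗ[𝕝] H).isLinear a).slice m
  refine (h2.continuousOn.comp (SmoothFun.continuous_eval_const m).continuousOn
    fun ξ (hξ : ∀ m, ξ.1 m ∈ φ.target) => hξ m).congr fun ξ hξ => S.leftChart_symm_apply hφ hξ m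

/-- Point evaluations are continuous into the Hausdorff space `K` and separate maps. -/
theorem LieGroupStructure.t2Space_mapTop : @T2Space _ (S.mapTop 𝕜 A hφ h1) := by
  let t1 := S.mapTop 𝕜 A hφ h1
  let t2 := S.top
  have := S.t2
  exact @T2Space.of_injective_continuous _ (M → K) t1 _ _ (fun γ => γ.1) Subtype.val_injective
    (@continuous_pi _ _ _ t1 _ _ fun m => S.continuous_eval_mapTop hφ h1 m)

theorem LieGroupStructure.isSmoothMap_mul_leftChart :
    IsSmoothMap 𝕝
      (@instTopologicalSpaceProd _ _ (S.mapTop 𝕜 A hφ h1) (S.mapTop 𝕜 A hφ h1))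
      (Set.image2 (fun e e' => e.prod e') (range (S.leftChart 𝕜 A hφ))
        (range (S.leftChart 𝕜 A hφ)))
      (S.mapTop 𝕜 A hφ h1) (range (S.leftChart 𝕜 A hφ)) fun p => p.1 * p.2 := by
  have hA := S.isOpenAtlas_leftChart (𝕜 := 𝕜) (A := A) hφ h1
  let t1 := S.mapTop 𝕜 A hφ h1
  refine (isSmoothMap_iff_smoothInto (𝕜 := 𝕝) (𝕝 := 𝕝) ?_).2 ?_
  · rintro _ ⟨a, rfl⟩ _ ⟨b, rfl⟩
    exact (S.leftChart_change hφ a b).2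
  rintro _ ⟨_, ⟨a, rfl⟩, _, ⟨b, rfl⟩, rfl⟩
  have ha := S.smoothGroupFamily_leftChart (𝕜 := 𝕜) (A := A) hφ (ContinuousLinearMap.fst ℝ H H)
      (LinearMap.fst 𝕜 H H).isLinear (LinearMap.fst 𝕝 H H).isLinear a
  have hb := S.smoothGroupFamily_leftChart (𝕜 := 𝕜) (A := A) hφ (ContinuousLinearMap.snd ℝ H H)
      (LinearMap.snd 𝕜 H H).isLinear (LinearMap.snd 𝕝 H H).isLinear b
  -- `SmoothGroupFamily.mul` wants a single domain, so each factor is restricted to the points where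
  -- both components lie in `φ.target`.
  have ha' := letI := S.top; ha.inter hb.isOpen
  have hb' := letI := S.top; hb.inter ha.isOpen
  rw [inter_comm] at hb'
  have h := S.smoothInto_leftChart hφ (j := SmoothFun.pairCLM
    (ContinuousLinearMap.id ℝ (SmoothFun 𝕜 A H)) (ContinuousLinearMap.id ℝ (SmoothFun 𝕜 A H)))
    ⟨fun _ _ => rfl, fun _ _ => rfl⟩ (ha'.mul S hb')
    (T := fun p => (S.leftChart 𝕜 A hφ a).symm p.1 * (S.leftChart 𝕜 A hφ b).symm p.2)
    (fun p hp m => congrArg₂ (· * ·) (S.leftChart_symm_apply hφ (fun m => (hp m).1) m)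
      (S.leftChart_symm_apply hφ (fun m => (hp m).2) m)) h1
  refine (congrArg (SmoothInto 𝕝 _ _) (Set.ext fun p => ?_)).mpr h
  exact ⟨fun hp m => ⟨hp.1 m, hp.2 m⟩, fun hp => ⟨fun m => (hp m).1, fun m => (hp m).2⟩⟩

theorem LieGroupStructure.isSmoothMap_inv_leftChart :
    IsSmoothMap 𝕝
      (S.mapTop 𝕜 A hφ h1) (range (S.leftChart 𝕜 A hφ))
      (S.mapTop 𝕜 A hφ h1) (range (S.leftChart 𝕜 A hφ)) fun γ => γ⁻¹ := by
  have hA := S.isOpenAtlas_leftChart (𝕜 := 𝕜) (A := A) hφ h1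
  let t1 := S.mapTop 𝕜 A hφ h1
  refine (isSmoothMap_iff_smoothInto (𝕜 := 𝕝) (𝕝 := 𝕝) ?_).2 ?_
  · rintro _ ⟨a, rfl⟩ _ ⟨b, rfl⟩
    exact (S.leftChart_change hφ a b).2
  rintro _ ⟨a, rfl⟩
  have ha := S.smoothGroupFamily_leftChart (𝕜 := 𝕜) (A := A) hφ (ContinuousLinearMap.id ℝ H)
      (LinearMap.id : H →ₗ[𝕜] H).isLinear (LinearMap.id : H →ₗ[𝕝] H).isLinear a
  exact S.smoothInto_leftChart hφ (j := ContinuousLinearMap.id ℝ (SmoothFun 𝕜 A H))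
    (LinearMap.id : SmoothFun 𝕜 A H →ₗ[𝕝] SmoothFun 𝕜 A H).isLinear (ha.inv S)
    (T := fun ξ => ((S.leftChart 𝕜 A hφ a).symm ξ)⁻¹)
    (fun ξ hξ m => congrArg (·⁻¹) (S.leftChart_symm_apply hφ hξ m)) h1

variable (𝕜 A) in
/-- The Lie group structure on the group of smooth maps. -/
noncomputable def LieGroupStructure.mapGroup :
    LieGroupStructure 𝕝 (S.mapSubgroup 𝕜 A) (SmoothFun 𝕜 A H) :=
  letI := S.mapTop 𝕜 A hφ h1
  have := S.t2Space_mapTop (𝕜 := 𝕜) (A := A) hφ h1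
  have := S.isOpenAtlas_leftChart (𝕜 := 𝕜) (A := A) hφ h1
  LieGroupStructure.ofAtlas (range (S.leftChart 𝕜 A hφ))
    (by
      rintro _ ⟨a, rfl⟩ _ ⟨b, rfl⟩
      exact (S.leftChart_change hφ a b).2)
    (S.isSmoothMap_mul_leftChart hφ h1) (S.isSmoothMap_inv_leftChart hφ h1)

theorem LieGroupStructure.leftChart_mem_mapGroup :
    range (S.leftChart 𝕜 A hφ) ⊆ (S.mapGroup 𝕜 A hφ h1).atlas := by
  let := S.mapTop 𝕜 A hφ h1
  have := S.t2Space_mapTop (𝕜 := 𝕜) (A := A) hφ h1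
  have := S.isOpenAtlas_leftChart (𝕜 := 𝕜) (A := A) hφ h1
  refine ManifoldStructure.subset_ofAtlas ?_
  rintro _ ⟨a, rfl⟩ _ ⟨b, rfl⟩
  exact (S.leftChart_change hφ a b).2

/-- The uniqueness half: in any Lie group structure the left translates of `Φ` are charts, and on
their domains they coincide with the left charts. -/
theorem LieGroupStructure.leftChart_mem_of_isPushForward
    {S' : LieGroupStructure 𝕝 (S.mapSubgroup 𝕜 A) (SmoothFun 𝕜 A H)}
    {Φ : PartialEquiv (S.mapSubgroup 𝕜 A) (SmoothFun 𝕜 A H)} (hΦ : Φ ∈ S'.atlas)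
    (h : IsPushForward 𝕜 φ Φ) : range (S.leftChart 𝕜 A hφ) ⊆ S'.atlas := by
  rintro _ ⟨a, rfl⟩
  refine S'.mem_atlas_of_eqOn hΦ a ?_ ?_ (fun γ hγ => ?_) fun ξ hξ => ?_
  · rw [h.source_eq]
    rfl
  · rw [h.target_eq]
    rfl
  · have hγ' : a⁻¹ * γ ∈ Φ.source := by
      rw [h.source_eq]
      exact hγ
    refine SmoothFun.ext fun m => ?_
    rw [h.apply_eq _ hγ', S.leftChart_apply hφ hγ]
    rfl
  · have hξ' : ξ ∈ Φ.target := by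
      rw [h.target_eq]
      exact hξ
    refine Subtype.ext (funext fun m => ?_)
    rw [S.leftChart_symm_apply hφ hξ]
    refine congrArg (a.1 m * ·) ?_
    -- `IsPushForward` does not mention the values of `Φ.symm`; they follow from `φ (Φ.symm ξ m) = ξ
    -- m` and `φ.left_inv`.
    have h2 := Φ.map_target hξ'
    have h3 := h.apply_eq _ h2 m
    rw [Φ.right_inv hξ'] at h3
    rw [h.source_eq] at h2
    rw [h3, φ.left_inv (h2 m)]

include h1 in
/-- The group of smooth maps has a unique Lie group structure for which the push-forward of the
chart `φ` is a chart. -/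
theorem LieGroupStructure.existsUnique_mapGroup :
    ∃! S' : LieGroupStructure 𝕝 (S.mapSubgroup 𝕜 A) (SmoothFun 𝕜 A H),
      ∃ Φ ∈ S'.atlas, IsPushForward 𝕜 φ Φ := by
  refine ⟨S.mapGroup 𝕜 A hφ h1, ⟨S.pushChart 𝕜 A hφ, ?_, S.isPushForward_pushChart hφ⟩, ?_⟩
  · rw [← S.leftChart_one hφ]
    exact S.leftChart_mem_mapGroup hφ h1 (mem_range_self 1)
  · rintro S' ⟨Φ, hΦ, h⟩
    exact LieGroupStructure.eq_of_subset (S.leftChart_mem_of_isPushForward hφ hΦ h)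
      (S.leftChart_mem_mapGroup hφ h1)
      fun γ => ⟨_, mem_range_self γ, S.mem_leftChart_source_self hφ h1 γ⟩

end MapGroup

/-! ### Manifolds with corners have accessible chart images. -/

section Corners

variable {E : Type u} [AddCommGroup E] [Module ℝ E] [TopologicalSpace E]
  [IsTopologicalAddGroup E] [ContinuousSMul ℝ E] {n : ℕ} {lam : Fin n → (E →L[ℝ] ℝ)}

theorem convex_posCone : Convex ℝ (posCone lam) := by
  intro x hx y hy a b ha hb _ i
  rw [map_add, map_smul, map_smul]
  exact add_nonneg (mul_nonneg ha (hx i)) (mul_nonneg hb (hy i))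

/-- By convexity, a segment from any point of the cone towards an interior point runs in the
interior as soon as it leaves its start. -/
theorem accessible_posCone (h : (interior (posCone lam)).Nonempty) :
    Accessible (posCone lam) := by
  obtain ⟨p, hp⟩ := h
  refine fun x hx => ⟨p - x, ?_⟩
  filter_upwards [Ioc_mem_nhdsGT (zero_lt_one (α := ℝ))] with t ht
  exact convex_posCone.add_smul_sub_mem_interior hx hp ht

theorem ManifoldStructure.isAtlas {𝕜 : Type*} [Semiring 𝕜] [Module 𝕜 E] {M : Type w}
    (S : ManifoldStructure 𝕜 M E (posCone lam)) (h : (interior (posCone lam)).Nonempty) :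
    letI := S.top
    IsAtlas S.atlas :=
  letI := S.top
  { accessible := fun φ hφ => by
      obtain ⟨O, hO, hφO⟩ := (S.isChart φ hφ).target_eq
      rw [hφO, inter_comm]
      exact (accessible_posCone h).inter_isOpen hO
    isOpen_source := fun φ hφ => (S.isChart φ hφ).isOpen_source
    continuousOn := fun φ hφ => (S.isChart φ hφ).continuousOn
    continuousOn_symm := fun φ hφ => (S.isChart φ hφ).continuousOn_symm
    cover := S.cover }

end Corners

/-! ### The results for compact manifolds with corners. -/

section MapGroup

variable {𝕜 𝕝 : Type*} [CommSemiring 𝕜] [CommSemiring 𝕝] [Algebra 𝕜 𝕝] [TopologicalSpace 𝕝]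
  {E : Type u} [AddCommGroup E] [Module ℝ E] [Module 𝕜 E] [TopologicalSpace E]
  [IsTopologicalAddGroup E] [ContinuousSMul ℝ E] [LocallyConvexSpace ℝ E] [T2Space E]
  {n : ℕ} {lam : Fin n → (E →L[ℝ] ℝ)} (hlam : (interior (posCone lam)).Nonempty)
  {M : Type w} (SM : ManifoldStructure 𝕜 M E (posCone lam)) (hM : @CompactSpace M SM.top)
  {H : Type v} [AddCommGroup H] [Module ℝ H] [Module 𝕜 H] [Module 𝕝 H] [IsScalarTower 𝕜 𝕝 H]
  [TopologicalSpace H] [IsTopologicalAddGroup H] [ContinuousSMul ℝ H] [LocallyConvexSpace ℝ H]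
  [T2Space H] [SMulCommClass 𝕜 ℝ H] [ContinuousConstSMul 𝕜 H] [SMulCommClass ℝ 𝕜 H]
  [ContinuousSMul 𝕝 H] [SMulCommClass ℝ 𝕝 H] [SMulCommClass 𝕜 𝕝 H]

include hlam hM

theorem isLocallyConvexTVS_smoothFun : IsLocallyConvexTVS 𝕝 (SmoothFun 𝕜 SM.atlas H) := by
  let := SM.top
  have := SM.t2
  have := SM.isAtlas hlam
  exact ⟨inferInstance, inferInstance, inferInstance, inferInstance⟩

theorem exists_mapGroup {K : Type x} [Group K] (SK : LieGroupStructure 𝕝 K H)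
    {φ : PartialEquiv K H} (hφ : φ ∈ SK.atlas) (h1 : (1 : K) ∈ φ.source) :
    ∃ G : Subgroup (M → K),
      (∀ f : M → K, f ∈ G ↔ IsSmoothMap 𝕜 SM.top SM.atlas SK.top SK.atlas f) ∧
      ∃! S : LieGroupStructure 𝕝 G (SmoothFun 𝕜 SM.atlas H),
        ∃ Φ ∈ S.atlas, IsPushForward 𝕜 φ Φ := by
  let := SM.top
  have := SM.t2
  have := SM.isAtlas hlam
  exact ⟨SK.mapSubgroup 𝕜 SM.atlas, fun _ => SK.mem_mapSubgroup SM.atlas,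
    SK.existsUnique_mapGroup hφ h1⟩

end MapGroup

end MappingGroup

theorem mainTheorem1 :
    -- a) `M` smooth, `K` a smooth Lie group
    (∀ (E : Type u) [AddCommGroup E] [Module ℝ E] [TopologicalSpace E]
      [IsTopologicalAddGroup E] [ContinuousSMul ℝ E] [LocallyConvexSpace ℝ E] [T2Space E]
      (n : ℕ) (lam : Fin n → (E →L[ℝ] ℝ)) (_ : (interior (MappingGroup.posCone lam)).Nonempty)
      (M : Type w) (SM : MappingGroup.ManifoldStructure ℝ M E (MappingGroup.posCone lam))
      (_ : @CompactSpace M SM.top)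
      (𝔨 : Type v) [AddCommGroup 𝔨] [Module ℝ 𝔨] [TopologicalSpace 𝔨]
      [IsTopologicalAddGroup 𝔨] [ContinuousSMul ℝ 𝔨] [LocallyConvexSpace ℝ 𝔨] [T2Space 𝔨]
      (K : Type x) [Group K] (SK : MappingGroup.LieGroupStructure ℝ K 𝔨)
      (φ : PartialEquiv K 𝔨) (_ : φ ∈ SK.atlas) (_ : (1 : K) ∈ φ.source) (_ : φ 1 = 0),
      MappingGroup.IsLocallyConvexTVS ℝ (MappingGroup.SmoothFun ℝ SM.atlas 𝔨) ∧
      ∃ G : Subgroup (M → K),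
        (∀ f : M → K, f ∈ G ↔
          MappingGroup.IsSmoothMap ℝ SM.top SM.atlas SK.top SK.atlas f) ∧
        ∃! S : MappingGroup.LieGroupStructure ℝ G (MappingGroup.SmoothFun ℝ SM.atlas 𝔨),
          ∃ Φ ∈ S.atlas, MappingGroup.IsPushForward ℝ φ Φ) ∧
    -- b) `M` smooth, `K` a complex Lie group
    (∀ (E : Type u) [AddCommGroup E] [Module ℝ E] [TopologicalSpace E]
      [IsTopologicalAddGroup E] [ContinuousSMul ℝ E] [LocallyConvexSpace ℝ E] [T2Space E]
      (n : ℕ) (lam : Fin n → (E →L[ℝ] ℝ)) (_ : (interior (MappingGroup.posCone lam)).Nonempty)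
      (M : Type w) (SM : MappingGroup.ManifoldStructure ℝ M E (MappingGroup.posCone lam))
      (_ : @CompactSpace M SM.top)
      (𝔨 : Type v) [AddCommGroup 𝔨] [Module ℝ 𝔨] [Module ℂ 𝔨] [IsScalarTower ℝ ℂ 𝔨]
      [TopologicalSpace 𝔨] [IsTopologicalAddGroup 𝔨] [ContinuousSMul ℝ 𝔨] [ContinuousSMul ℂ 𝔨]
      [LocallyConvexSpace ℝ 𝔨] [T2Space 𝔨]
      (K : Type x) [Group K] (SK : MappingGroup.LieGroupStructure ℂ K 𝔨)
      (φ : PartialEquiv K 𝔨) (_ : φ ∈ SK.atlas) (_ : (1 : K) ∈ φ.source) (_ : φ 1 = 0),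
      MappingGroup.IsLocallyConvexTVS ℂ (MappingGroup.SmoothFun ℝ SM.atlas 𝔨) ∧
      ∃ G : Subgroup (M → K),
        (∀ f : M → K, f ∈ G ↔
          MappingGroup.IsSmoothMap ℝ SM.top SM.atlas SK.top SK.atlas f) ∧
        ∃! S : MappingGroup.LieGroupStructure ℂ G (MappingGroup.SmoothFun ℝ SM.atlas 𝔨),
          ∃ Φ ∈ S.atlas, MappingGroup.IsPushForward ℝ φ Φ) ∧
    -- c) `M` complex, `K` a complex Lie group
    (∀ (E : Type u) [AddCommGroup E] [Module ℝ E] [Module ℂ E] [IsScalarTower ℝ ℂ E]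
      [TopologicalSpace E] [IsTopologicalAddGroup E] [ContinuousSMul ℝ E] [ContinuousSMul ℂ E]
      [LocallyConvexSpace ℝ E] [T2Space E]
      (n : ℕ) (lam : Fin n → (E →L[ℝ] ℝ)) (_ : (interior (MappingGroup.posCone lam)).Nonempty)
      (M : Type w) (SM : MappingGroup.ManifoldStructure ℂ M E (MappingGroup.posCone lam))
      (_ : @CompactSpace M SM.top)
      (𝔨 : Type v) [AddCommGroup 𝔨] [Module ℝ 𝔨] [Module ℂ 𝔨] [IsScalarTower ℝ ℂ 𝔨]
      [TopologicalSpace 𝔨] [IsTopologicalAddGroup 𝔨] [ContinuousSMul ℝ 𝔨] [ContinuousSMul ℂ 𝔨]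
      [LocallyConvexSpace ℝ 𝔨] [T2Space 𝔨]
      (K : Type x) [Group K] (SK : MappingGroup.LieGroupStructure ℂ K 𝔨)
      (φ : PartialEquiv K 𝔨) (_ : φ ∈ SK.atlas) (_ : (1 : K) ∈ φ.source) (_ : φ 1 = 0),
      MappingGroup.IsLocallyConvexTVS ℂ (MappingGroup.SmoothFun ℂ SM.atlas 𝔨) ∧
      ∃ G : Subgroup (M → K),
        (∀ f : M → K, f ∈ G ↔
          MappingGroup.IsSmoothMap ℂ SM.top SM.atlas SK.top SK.atlas f) ∧
        ∃! S : MappingGroup.LieGroupStructure ℂ G (MappingGroup.SmoothFun ℂ SM.atlas 𝔨),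
          ∃ Φ ∈ S.atlas, MappingGroup.IsPushForward ℂ φ Φ) := by
  -- The three parts are the instances `(𝕜, 𝕝) = (ℝ, ℝ)`, `(ℝ, ℂ)` and `(ℂ, ℂ)`.
  refine ⟨?_, ?_, ?_⟩
  · intro E _ _ _ _ _ _ _ n lam hlam M SM hM 𝔨 _ _ _ _ _ _ _ K _ SK φ hφ h1 _
    exact ⟨MappingGroup.isLocallyConvexTVS_smoothFun hlam SM hM,
      MappingGroup.exists_mapGroup hlam SM hM SK hφ h1⟩
  · intro E _ _ _ _ _ _ _ n lam hlam M SM hM 𝔨 _ _ _ _ _ _ _ _ _ _ K _ SK φ hφ h1 _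
    exact ⟨MappingGroup.isLocallyConvexTVS_smoothFun hlam SM hM,
      MappingGroup.exists_mapGroup hlam SM hM SK hφ h1⟩
  · intro E _ _ _ _ _ _ _ _ _ _ n lam hlam M SM hM 𝔨 _ _ _ _ _ _ _ _ _ _ K _ SK φ hφ h1 _
    exact ⟨MappingGroup.isLocallyConvexTVS_smoothFun hlam SM hM,
      MappingGroup.exists_mapGroup hlam SM hM SK hφ h1⟩
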